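/- Let $(Q,\mathfrak m,\Bbbk)$ be a regular local ring, $f=f_1,\dots,f_c$ a $Q$-regular sequence (so $(f_1,\dots,f_c)\ne Q$), and $R=Q/(f_1,\dots,f_c)$. For a commutative ring $A$, a complex $C$ of finitely generated free $A$-modules is totally acyclic if $C$ and $\operatorname{Hom}_A(C,A)$ are exact. $\operatorname{Hom}_A(C,D)$ denotes the set of homotopy classes of chain maps $C\to D$, and $(\Sigma^iC)_n=C_{n-i}$. A complete resolution over $A$ of an $A$-module $M$ is a totally acyclic complex $X$ such that, for some projective resolution $P$ of $M$ and some $i$, the truncations $X_{>i}$ and $P_{>i}$ (which keep the degrees $>i$ and are zero elsewhere) are homotopy equivalent. Let $C,D$ be totally acyclic complexes over $R$. *Support variety.* Lift the differentials of $C$ to homomorphisms $\tilde d_n:\tilde C_n\to\tilde C_{n-1}$ of finitely generated free $Q$-modules with $\tilde C\otimes_QR\cong C$, and write $\tilde d_{n-1}\tilde d_n=\sum_k f_k\tilde t_{k,n}$. Each $t_k=\tilde t_k\otimes_QR$ is a chain map $C\to\Sigma^2C$; the $t_k$ commute up to homotopy, and composition with them makes $\bigoplus_{i\ge0}\operatorname{Hom}_R(C,\Sigma^iD)$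 a module over $R[\chi_1,\dots,\chi_c]$. Let $E=\bigl(\bigoplus_{i\ge0}\operatorname{Hom}_R(C,\Sigma^iD)\bigr)\otimes_R\Bbbk$, a module over $\Bbbk[\chi_1,\dots,\chi_c]$, and $$V(Q,f,C,D)=\{b\in\Bbbk^c:\varphi(b)=0\text{ for all }\varphi\in\operatorname{Ann}_{\Bbbk[\chi_1,\dots,\chi_c]}E\}\cup\{0\}.$$ *Rank variety.* For $a\in Q^c$ let $\bar a\in\Bbbk^c$ be its residue class, and put $Q_a=Q/(a_1f_1+\dots+a_cf_c)$. Over $Q_a$ let $TC$ and $TD$ denote complete resolutions of the images of $d_0^C:C_0\to C_{-1}$ and $d_0^D:D_0\to D_{-1}$. Let $W(Q,f,C,D)$ be the set of all $b\in\Bbbk^c$ for which there are a lifting $a\in Q^c$ of $b$ and complexes $TC,TD$ as above with $\operatorname{Hom}_{Q_a}(TC,\Sigma^iTD)\neq0$ for infinitely many $i>0$, together with $0$. **Theorem.** For every choice of the lift $(\tilde C,\tilde d,\tilde t)$ of $C$, $$V(Q,f,C,D)=W(Q,f,C,D).$$ Moreover $W(Q,f,C,D)$ does not depend on the choices made: for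 every $a\in Q^c$ with $\bar a\ne0$, complexes $TC$ and $TD$ over $Q_a$ exist, and for any such $TC$ and $TD$ one has $\bar a\in W(Q,f,C,D)$ if and only if $\operatorname{Hom}_{Q_a}(TC,\Sigma^iTD)\ne0$ for infinitely many $i>0$. -/

import Mathlib

open CategoryTheory

universe u

noncomputable section

namespace TotallyAcyclic

/-! ### Complete intersections -/

section Ring

variable {Q : Type u} [CommRing Q] {c : ℕ}

/-- The quotient ring `R = Q/(f₁,…,f_c)`. -/
abbrev CIRing (f : Fin c → Q) : Type u := Q ⧸ Ideal.span (Set.range f)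

/-- The relations between the members of a regular sequence have coefficients in the ideal
generated by the sequence. -/
lemma coeff_mem_of_sum_eq_zero {c : ℕ} (f : Fin c → Q)
    (hf : RingTheory.Sequence.IsWeaklyRegular Q (List.ofFn f)) (x : Fin c → Q)
    (hx : ∑ i, f i * x i = 0) (i : Fin c) : x i ∈ Ideal.span (Set.range f) := by
  induction c with
  | zero => exact i.elim0
  | succ n ih =>
    rw [List.ofFn_succ', List.concat_eq_append,
      RingTheory.Sequence.isWeaklyRegular_append_iff,
      RingTheory.Sequence.isWeaklyRegular_singleton_iff] at hf
    obtain ⟨h1, h2⟩ := hf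
    have hspan : Ideal.ofList (List.ofFn fun i : Fin n => f i.castSucc) =
        Ideal.span (Set.range fun i : Fin n => f i.castSucc) := by
      rw [Ideal.ofList]
      congr 1
      ext y
      simp [List.mem_ofFn]
    have hle : Ideal.span (Set.range fun i : Fin n => f i.castSucc) ≤
        Ideal.span (Set.range f) :=
      Ideal.span_mono (by rintro _ ⟨i, rfl⟩; exact ⟨_, rfl⟩)
    rw [Fin.sum_univ_castSucc] at hx
    have hlast : x (Fin.last n) ∈ Ideal.span (Set.range fun i : Fin n => f i.castSucc) := by
      have h3 : f (Fin.last n) • (Submodule.Quotient.mk (x (Fin.last n)) :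
          Q ⧸ (Ideal.ofList (List.ofFn fun i : Fin n => f i.castSucc) • (⊤ : Submodule Q Q))) =
          f (Fin.last n) • 0 := by
        rw [smul_zero, ← Submodule.Quotient.mk_smul, Submodule.Quotient.mk_eq_zero, hspan,
          Ideal.smul_eq_mul, Ideal.mul_top, smul_eq_mul, eq_neg_of_add_eq_zero_right hx]
        exact neg_mem (sum_mem fun j _ => Ideal.mul_mem_right _ _
          (Ideal.subset_span ⟨j, rfl⟩))
      have h4 := h2 h3
      rwa [Submodule.Quotient.mk_eq_zero, hspan, Ideal.smul_eq_mul, Ideal.mul_top] at h4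
    obtain ⟨y, hy⟩ := (Ideal.mem_span_range_iff_exists_fun).1 hlast
    refine Fin.lastCases (hle hlast) (fun j => ?_) i
    have h5 := ih (fun i : Fin n => f i.castSucc) h1
      (fun i => x i.castSucc + y i * f (Fin.last n)) (by
        rw [← hx, ← hy, Finset.mul_sum, ← Finset.sum_add_distrib]
        exact Finset.sum_congr rfl fun j _ => by ring) j
    have h6 : y j * f (Fin.last n) ∈ Ideal.span (Set.range f) :=
      Ideal.mul_mem_left _ _ (Ideal.subset_span ⟨_, rfl⟩)
    exact (Ideal.add_mem_iff_left _ h6).1 (hle h5)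

/-- The same statement for matrices: if `∑ fₖ Aₖ = 0` then every `Aₖ` vanishes over `R`. -/
lemma matrix_map_eq_zero (f : Fin c → Q)
    (hf : RingTheory.Sequence.IsWeaklyRegular Q (List.ofFn f)) {m n : ℕ}
    (A : Fin c → Matrix (Fin m) (Fin n) Q) (hA : ∑ k, f k • A k = 0) (k : Fin c) :
    (A k).map (Ideal.Quotient.mk (Ideal.span (Set.range f))) = 0 := by
  ext i j
  rw [Matrix.map_apply, Matrix.zero_apply, Ideal.Quotient.eq_zero_iff_mem]
  refine coeff_mem_of_sum_eq_zero f hf (fun k => A k i j) ?_ k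
  simpa [Matrix.sum_apply] using congrFun (congrFun hA i) j

/-- A matrix that vanishes over `R` is of the form `∑ fₖ Aₖ`. -/
lemma exists_matrix_sum (f : Fin c → Q) {m n : ℕ} (A : Matrix (Fin m) (Fin n) Q)
    (hA : A.map (Ideal.Quotient.mk (Ideal.span (Set.range f))) = 0) :
    ∃ B : Fin c → Matrix (Fin m) (Fin n) Q, A = ∑ k, f k • B k := by
  have h : ∀ i j, ∃ b : Fin c → Q, ∑ k, b k * f k = A i j := fun i j => by
    rw [← Ideal.mem_span_range_iff_exists_fun, ← Ideal.Quotient.eq_zero_iff_mem]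
    exact congrFun (congrFun hA i) j
  choose b hb using h
  refine ⟨fun k => Matrix.of fun i j => b i j k, ?_⟩
  ext i j
  rw [← hb i j]
  simp [Matrix.sum_apply, mul_comm]

lemma sum_smul_mul_left (f : Fin c → Q) {l m n : ℕ} (A : Matrix (Fin l) (Fin m) Q)
    (B : Fin c → Matrix (Fin m) (Fin n) Q) :
    ∑ k, f k • (A * B k) = A * ∑ k, f k • B k := by
  simp [Matrix.mul_sum]

lemma sum_smul_mul_right (f : Fin c → Q) {l m n : ℕ} (A : Matrix (Fin m) (Fin n) Q)
    (B : Fin c → Matrix (Fin l) (Fin m) Q) :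
    ∑ k, f k • (B k * A) = (∑ k, f k • B k) * A := by
  simp [Matrix.sum_mul]

variable [IsLocalRing Q]

/-- The residue field of the local ring `Q` as an algebra over `R = Q/(f₁,…,f_c)`. -/
instance residueAlgebra (f : Fin c → Q)
    [hf : Fact (RingTheory.Sequence.IsRegular Q (List.ofFn f))] :
    Algebra (CIRing f) (IsLocalRing.ResidueField Q) :=
  (Ideal.Quotient.lift (Ideal.span (Set.range f)) (IsLocalRing.residue Q) (fun x hx => by
    rw [IsLocalRing.residue_eq_zero_iff]
    refine IsLocalRing.le_maximalIdeal (fun h => hf.out.top_ne_smul ?_) hx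
    have : Ideal.ofList (List.ofFn f) = Ideal.span (Set.range f) := by
      rw [Ideal.ofList]
      congr 1
      ext y
      simp [List.mem_ofFn]
    rw [this, h, Ideal.smul_eq_mul, Ideal.mul_top])).toAlgebra

end Ring

/-! ### Totally acyclic complexes

Complexes are indexed cohomologically: the module that sits in homological degree `n` is `C.X (-n)`.
The shift `Σ` is the functor `⟦1⟧`. -/

section Complexes

variable {A : Type u} [CommRing A]

/-- A complex of finitely generated free modules is totally acyclic if it is exact and its dual
`Hom_A(C, A)` is exact. -/
structure IsTotallyAcyclic (C : CochainComplex (ModuleCat.{u} A) ℤ) : Prop where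
  free (n : ℤ) : Module.Free A (C.X n)
  finite (n : ℤ) : Module.Finite A (C.X n)
  acyclic : C.Acyclic
  dual_exact (i j k : ℤ) (hij : i + 1 = j) (hjk : j + 1 = k) :
    Function.Exact (C.d j k).hom.dualMap (C.d i j).hom.dualMap

/-- A complex, seen as an object of the homotopy category. -/
abbrev toK (C : CochainComplex (ModuleCat.{u} A) ℤ) :
    HomotopyCategory (ModuleCat.{u} A) (ComplexShape.up ℤ) :=
  (HomotopyCategory.quotient _ _).obj C

/-- `Hom(C, Σⁱ D)`: the homotopy classes of chain maps from `C` to `Σⁱ D`. -/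
abbrev KHom (C D : CochainComplex (ModuleCat.{u} A) ℤ) (i : ℤ) : Type u :=
  ShiftedHom (toK C) (toK D) i

/-- The truncation `C_{>i}`, which keeps the homological degrees `> i` and is zero elsewhere. -/
def truncGT (C : CochainComplex (ModuleCat.{u} A) ℤ) (i : ℤ) :
    CochainComplex (ModuleCat.{u} A) ℤ :=
  C.stupidTrunc (ComplexShape.embeddingUpIntLE (-i - 1))

/-- `X` is a complete resolution of `M`: it is totally acyclic and, for some projective
resolution `P` of `M` and some `i`, the truncations `X_{>i}` and `P_{>i}` are homotopy
equivalent. -/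
def IsCompleteResolution (X : CochainComplex (ModuleCat.{u} A) ℤ) (M : ModuleCat.{u} A) : Prop :=
  IsTotallyAcyclic X ∧ ∃ (P : ProjectiveResolution M) (i : ℤ),
    Nonempty (HomotopyEquiv (truncGT X i) (truncGT P.cochainComplex i))

/-- The image of the differential `d₀ : C₀ ⟶ C₋₁`. -/
def imageZero (C : CochainComplex (ModuleCat.{u} A) ℤ) : ModuleCat.{u} A :=
  ModuleCat.of A (LinearMap.range (C.d 0 1).hom)

end Complexes

/-! ### Eisenbud operators -/

section Operators

variable {Q : Type u} [CommRing Q] {c : ℕ}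

/-- A lift to `Q` of a complex `C` of finitely generated free modules over `R = Q/(f₁,…,f_c)`:
the modules and differentials are lifted, as matrices with respect to chosen bases, to a sequence
of homomorphisms `d̃` of finitely generated free `Q`-modules, and `d̃ ∘ d̃` is written as
`∑ fₖ t̃ₖ`. -/
structure EisenbudLift (f : Fin c → Q) (C : CochainComplex (ModuleCat.{u} (CIRing f)) ℤ) where
  rank : ℤ → ℕ
  basis (n : ℤ) : Module.Basis (Fin (rank n)) (CIRing f) (C.X n)
  d (p q : ℤ) : Matrix (Fin (rank q)) (Fin (rank p)) Q
  d_map (p q : ℤ) : (d p q).map (Ideal.Quotient.mk (Ideal.span (Set.range f))) =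
    LinearMap.toMatrix (basis p) (basis q) (C.d p q).hom
  t (k : Fin c) (p q : ℤ) : Matrix (Fin (rank q)) (Fin (rank p)) Q
  d_mul_d (p q r : ℤ) (hpq : p + 1 = q) (hqr : q + 1 = r) : d q r * d p q = ∑ k, f k • t k p r

/-- Lifts exist. -/
lemma IsTotallyAcyclic.nonempty_eisenbudLift {f : Fin c → Q}
    {C : CochainComplex (ModuleCat.{u} (CIRing f)) ℤ} (hC : IsTotallyAcyclic C) :
    Nonempty (EisenbudLift f C) := by
  have hb : ∀ n, ∃ r : ℕ, Nonempty (Module.Basis (Fin r) (CIRing f) (C.X n)) := fun n => by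
    have := hC.free n
    have := hC.finite n
    let b := Module.Free.chooseBasis (CIRing f) (C.X n)
    exact ⟨_, ⟨b.reindex (Fintype.equivFin _)⟩⟩
  choose rank hb using hb
  let basis := fun n => (hb n).some
  have hd : ∀ p q, ∃ M : Matrix (Fin (rank q)) (Fin (rank p)) Q,
      M.map (Ideal.Quotient.mk (Ideal.span (Set.range f))) =
        LinearMap.toMatrix (basis p) (basis q) (C.d p q).hom := fun p q => by
    choose g hg using Ideal.Quotient.mk_surjective (I := Ideal.span (Set.range f))
    exact ⟨(LinearMap.toMatrix (basis p) (basis q) (C.d p q).hom).map g, by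
      ext i j; simp [hg]⟩
  choose d hd using hd
  have ht : ∀ p r, ∃ B : Fin c → Matrix (Fin (rank r)) (Fin (rank p)) Q, ∀ q,
      p + 1 = q → q + 1 = r → d q r * d p q = ∑ k, f k • B k := fun p r => by
    obtain ⟨B, hB⟩ := exists_matrix_sum f (d (p + 1) r * d p (p + 1)) (by
      rw [Matrix.map_mul, hd, hd, ← LinearMap.toMatrix_comp, ← ModuleCat.hom_comp,
        C.d_comp_d]
      simp)
    exact ⟨B, fun q hq _ => by subst hq; exact hB⟩
  choose B hB using ht
  exact ⟨⟨rank, basis, d, hd, fun k p r => B p r k, fun p q r h1 h2 => hB p r q h1 h2⟩⟩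

namespace EisenbudLift

variable {f : Fin c → Q} {C : CochainComplex (ModuleCat.{u} (CIRing f)) ℤ}

/-- The reduction to `R` of a matrix over `Q`, as a map between the modules of `C`. -/
def red (L : EisenbudLift f C) {p q : ℤ} (M : Matrix (Fin (L.rank q)) (Fin (L.rank p)) Q) :
    C.X p ⟶ C.X q :=
  ModuleCat.ofHom (Matrix.toLin (L.basis p) (L.basis q)
    (M.map (Ideal.Quotient.mk (Ideal.span (Set.range f)))))

variable (L : EisenbudLift f C)

lemma red_comp {p q r : ℤ} (M : Matrix (Fin (L.rank q)) (Fin (L.rank p)) Q)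
    (N : Matrix (Fin (L.rank r)) (Fin (L.rank q)) Q) :
    L.red M ≫ L.red N = L.red (N * M) := by
  rw [red, red, red, ← ModuleCat.ofHom_comp, Matrix.map_mul,
    Matrix.toLin_mul (L.basis p) (L.basis q) (L.basis r)]

lemma red_add {p q : ℤ} (M N : Matrix (Fin (L.rank q)) (Fin (L.rank p)) Q) :
    L.red (M + N) = L.red M + L.red N := by
  ext1
  simp [red, Matrix.map_add]

lemma red_sub {p q : ℤ} (M N : Matrix (Fin (L.rank q)) (Fin (L.rank p)) Q) :
    L.red (M - N) = L.red M - L.red N := by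
  rw [eq_sub_iff_add_eq, ← red_add, sub_add_cancel]

lemma red_d (p q : ℤ) : L.red (L.d p q) = C.d p q := by
  rw [red, d_map, Matrix.toLin_toMatrix, ModuleCat.ofHom_hom]

lemma red_XIso {p q q' : ℤ} (k : Fin c) (h : q = q') :
    L.red (L.t k p q) ≫ (C.XIsoOfEq h).hom = L.red (L.t k p q') := by
  subst h
  simp

variable [hf : Fact (RingTheory.Sequence.IsRegular Q (List.ofFn f))]

lemma t_comm (k : Fin c) (i j i' j' : ℤ) (hij : i + 1 = j) (hi : i + 2 = i') (hj : j + 2 = j') :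
    L.red (L.t k i i') ≫ C.d i' j' = C.d i j ≫ L.red (L.t k j j') := by
  rw [← red_d L i' j', ← red_d L i j, red_comp, red_comp, ← sub_eq_zero, ← red_sub]
  have h := matrix_map_eq_zero f hf.out.toIsWeaklyRegular
    (fun k => L.d i' j' * L.t k i i' - L.t k j j' * L.d i j) (by
      simp only [smul_sub, Finset.sum_sub_distrib, sum_smul_mul_left, sum_smul_mul_right]
      rw [← L.d_mul_d i j i' hij (by lia), ← L.d_mul_d j i' j' (by lia) (by lia),
        Matrix.mul_assoc, sub_self]) k
  rw [red, h, map_zero, ModuleCat.ofHom_zero]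

lemma exists_homotopy (k l : Fin c) : ∃ z : ∀ p s : ℤ, C.X p ⟶ C.X s,
    ∀ p o q p₂ p₃ p₄ : ℤ, o + 1 = p → p + 1 = q → p + 2 = p₂ → p + 3 = p₃ → p + 4 = p₄ →
      L.red (L.t k p p₂) ≫ L.red (L.t l p₂ p₄) =
        (C.d p q ≫ z q p₄ + z p p₃ ≫ C.d p₃ p₄) + L.red (L.t l p p₂) ≫ L.red (L.t k p₂ p₄) := by
  have hB : ∀ p s, ∃ B : Fin c → Matrix (Fin (L.rank s)) (Fin (L.rank p)) Q, ∀ q p₂,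
      p + 1 = q → p + 2 = p₂ → p + 3 = s →
      L.t l q s * L.d p q - L.d p₂ s * L.t l p p₂ = ∑ k, f k • B k := fun p s => by
    by_cases hs : p + 3 = s
    · obtain ⟨B, hB⟩ := exists_matrix_sum f
        (L.t l (p + 1) s * L.d p (p + 1) - L.d (p + 2) s * L.t l p (p + 2)) (by
          have h := L.t_comm l p (p + 1) (p + 2) s rfl rfl (by lia)
          rw [← red_d L, ← red_d L, red_comp, red_comp, eq_comm, ← sub_eq_zero, ← red_sub] at h
          have h' := congrArg ModuleCat.Hom.hom h
          simpa [red] using h')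
      exact ⟨B, fun q p₂ h1 h2 _ => by subst h1 h2; exact hB⟩
    · exact ⟨0, fun _ _ _ _ h => absurd h hs⟩
  choose B hB using hB
  refine ⟨fun p s => L.red (B p s k), fun p o q p₂ p₃ p₄ ho hq h2 h3 h4 => ?_⟩
  rw [← red_d L p q, ← red_d L p₃ p₄]
  simp only [red_comp, ← red_add]
  rw [← sub_eq_zero, ← red_sub]
  have h := matrix_map_eq_zero f hf.out.toIsWeaklyRegular
    (fun k => L.t l p₂ p₄ * L.t k p p₂ - (B q p₄ k * L.d p q + L.d p₃ p₄ * B p p₃ k +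
      L.t k p₂ p₄ * L.t l p p₂)) (by
      simp only [smul_sub, smul_add, Finset.sum_sub_distrib, Finset.sum_add_distrib,
        sum_smul_mul_left, sum_smul_mul_right]
      rw [← L.d_mul_d p q p₂ hq (by lia), ← L.d_mul_d p₂ p₃ p₄ (by lia) (by lia),
        ← hB q p₄ p₂ p₃ (by lia) (by lia) (by lia), ← hB p p₃ q p₂ hq h2 h3]
      simp only [Matrix.mul_sub, Matrix.sub_mul, Matrix.mul_assoc]
      abel) k
  rw [red, h, map_zero, ModuleCat.ofHom_zero]

/-- The Eisenbud operator `tₖ : C ⟶ Σ² C`, the reduction of `t̃ₖ`. -/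
def operator (k : Fin c) : C ⟶ C⟦(2 : ℤ)⟧ where
  f p := L.red (L.t k p (p + 2))
  comm' i j hij := by
    simp only [CochainComplex.shiftFunctor_obj_d']
    rw [show Int.negOnePow 2 = 1 from rfl, one_smul]
    exact L.t_comm k i j (i + 2) (j + 2) hij rfl rfl

/-- The class of `tₖ` in the homotopy category. -/
def classOp (k : Fin c) : KHom C C 2 :=
  ShiftedHom.map (M := ℤ) (X := C) (Y := C) (L.operator k)
    (HomotopyCategory.quotient (ModuleCat.{u} (CIRing f)) (ComplexShape.up ℤ))

lemma comp_operator_f (k l : Fin c) (p : ℤ) :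
    (ShiftedHom.comp (X := C) (Y := C) (Z := C) (L.operator k) (L.operator l)
      (show (2 : ℤ) + 2 = 4 by norm_num)).f p =
    L.red (L.t k p (p + 2)) ≫ L.red (L.t l (p + 2) (p + 4)) := by
  simp only [ShiftedHom.comp, HomologicalComplex.comp_f]
  rw [CochainComplex.shiftFunctorAdd'_inv_app_f', CochainComplex.shiftFunctor_map_f']
  exact congrArg (fun g => L.red (L.t k p (p + 2)) ≫ g) (L.red_XIso l _)

/-- The Eisenbud operators commute in the homotopy category. -/
lemma classOp_comm (k l : Fin c) :
    (L.classOp k).comp (L.classOp l) (show (2 : ℤ) + 2 = 4 by norm_num) =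
      (L.classOp l).comp (L.classOp k) (show (2 : ℤ) + 2 = 4 by norm_num) := by
  rw [classOp, classOp, ← ShiftedHom.map_comp, ← ShiftedHom.map_comp]
  simp only [ShiftedHom.map]
  congr 1
  obtain ⟨z, hz⟩ := L.exists_homotopy k l
  refine HomotopyCategory.eq_of_homotopy _ _
    ((CochainComplex.HomComplex.Cochain.equivHomotopy _ _).symm
      ⟨CochainComplex.HomComplex.Cochain.mk (fun p q _ => z p (q + 4)), ?_⟩)
  ext p x
  simp only [CochainComplex.HomComplex.Cochain.add_v,
    CochainComplex.HomComplex.Cochain.ofHom_v, comp_operator_f]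
  rw [CochainComplex.HomComplex.δ_v (-1) 0 (by norm_num) _ p p (add_zero p) (p - 1) (p + 1)
    rfl rfl]
  rw [CochainComplex.shiftFunctor_obj_d', show Int.negOnePow 4 = 1 from rfl,
    show Int.negOnePow 0 = 1 from rfl, one_smul, one_smul,
    hz p (p - 1) (p + 1) (p + 2) (p - 1 + 4) (p + 4) (by lia) rfl rfl (by lia) rfl]
  exact congrArg (fun g : C.X p ⟶ C.X (p + 4) =>
      (g + L.red (L.t l p (p + 2)) ≫ L.red (L.t k (p + 2) (p + 4))).hom x)
    (add_comm (C.d p (p + 1) ≫ z (p + 1) (p + 4)) (z p (p - 1 + 4) ≫ C.d (p - 1 + 4) (p + 4)))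

variable (D : CochainComplex (ModuleCat.{u} (CIRing f)) ℤ)

/-- The cohomology operator `χₖ : Hom(C, Σⁱ D) → Hom(C, Σⁱ⁺² D)`, composition with `tₖ`. -/
def chiHom (k : Fin c) (i : ℕ) : KHom C D i →ₗ[CIRing f] KHom C D (i + 2 : ℕ) where
  toFun α := (L.classOp k).comp α (by push_cast; rfl)
  map_add' _ _ := ShiftedHom.comp_add _ _ _ _
  map_smul' _ _ := ShiftedHom.comp_smul _ _ _ _

lemma chiHom_comm (k l : Fin c) (i : ℕ) (α : KHom C D i) :
    L.chiHom D k (i + 2) (L.chiHom D l i α) = L.chiHom D l (i + 2) (L.chiHom D k i α) := by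
  simp only [chiHom, LinearMap.coe_mk, AddHom.coe_mk]
  rw [← ShiftedHom.comp_assoc _ _ _ (show (2 : ℤ) + 2 = 4 by norm_num) _ (by push_cast; rfl),
    ← ShiftedHom.comp_assoc _ _ _ (show (2 : ℤ) + 2 = 4 by norm_num) _ (by push_cast; rfl),
    classOp_comm]

end EisenbudLift

/-- The graded module `⨁_{i ≥ 0} Hom_R(C, Σⁱ D)`. -/
abbrev GradedHom {A : Type u} [CommRing A] (C D : CochainComplex (ModuleCat.{u} A) ℤ) : Type u :=
  DirectSum ℕ fun i => KHom C D (i : ℤ)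

namespace EisenbudLift

variable {f : Fin c → Q} [hf : Fact (RingTheory.Sequence.IsRegular Q (List.ofFn f))]
  {C : CochainComplex (ModuleCat.{u} (CIRing f)) ℤ} (L : EisenbudLift f C)
  (D : CochainComplex (ModuleCat.{u} (CIRing f)) ℤ)

/-- The action of `χₖ` on `⨁_{i ≥ 0} Hom_R(C, Σⁱ D)`. -/
def chi (k : Fin c) : GradedHom C D →ₗ[CIRing f] GradedHom C D :=
  DirectSum.toModule (CIRing f) ℕ _ fun i =>
    DirectSum.lof (CIRing f) ℕ (fun i : ℕ => KHom C D (i : ℤ)) (i + 2) ∘ₗ L.chiHom D k i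

lemma chi_comm (k l : Fin c) : L.chi D k ∘ₗ L.chi D l = L.chi D l ∘ₗ L.chi D k := by
  refine DirectSum.linearMap_ext _ fun i => LinearMap.ext fun α => ?_
  simp [chi, chiHom_comm L D k l]

end EisenbudLift

end Operators

/-! ### Support varieties -/

section Support

variable {Q : Type u} [CommRing Q] [IsLocalRing Q] {c : ℕ} {f : Fin c → Q}
  [hf : Fact (RingTheory.Sequence.IsRegular Q (List.ofFn f))]
  {C : CochainComplex (ModuleCat.{u} (CIRing f)) ℤ}

open scoped TensorProduct

/-- `E = (⨁_{i ≥ 0} Hom_R(C, Σⁱ D)) ⊗_R 𝕜`, where `𝕜` is the residue field of `Q`. The lift of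
`C` determines its structure of a module over `𝕜[χ₁,…,χ_c]`. -/
def Reduced (_L : EisenbudLift f C) (D : CochainComplex (ModuleCat.{u} (CIRing f)) ℤ) : Type u :=
  IsLocalRing.ResidueField Q ⊗[CIRing f] GradedHom C D

variable (L : EisenbudLift f C) (D : CochainComplex (ModuleCat.{u} (CIRing f)) ℤ)

instance : AddCommGroup (Reduced L D) :=
  inferInstanceAs (AddCommGroup (IsLocalRing.ResidueField Q ⊗[CIRing f] GradedHom C D))

instance : Module (IsLocalRing.ResidueField Q) (Reduced L D) :=
  inferInstanceAs (Module (IsLocalRing.ResidueField Q)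
    (IsLocalRing.ResidueField Q ⊗[CIRing f] GradedHom C D))

/-- The action of `χₖ` on `E`. -/
def chiReduced (k : Fin c) : Module.End (IsLocalRing.ResidueField Q) (Reduced L D) :=
  (L.chi D k).baseChange (IsLocalRing.ResidueField Q)

lemma chiReduced_comm (k l : Fin c) :
    chiReduced L D k * chiReduced L D l = chiReduced L D l * chiReduced L D k := by
  have h := congrArg (LinearMap.baseChange (IsLocalRing.ResidueField Q)) (L.chi_comm D k l)
  rw [LinearMap.baseChange_comp, LinearMap.baseChange_comp] at h
  exact h

/-- The subalgebra of `End_𝕜(E)` generated by the operators is commutative. -/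
instance : IsMulCommutative (Algebra.adjoin (IsLocalRing.ResidueField Q)
    (Set.range (chiReduced L D))) :=
  Algebra.isMulCommutative_adjoin _ (by
    rintro _ ⟨k, rfl⟩ _ ⟨l, rfl⟩
    exact chiReduced_comm L D k l)

open scoped IsMulCommutative in
/-- The algebra homomorphism `𝕜[χ₁,…,χ_c] → End_𝕜(E)` sending each variable to the corresponding
operator. -/
def operatorHom : MvPolynomial (Fin c) (IsLocalRing.ResidueField Q) →ₐ[IsLocalRing.ResidueField Q]
    Module.End (IsLocalRing.ResidueField Q) (Reduced L D) :=
  (Subalgebra.val (Algebra.adjoin (IsLocalRing.ResidueField Q) (Set.range (chiReduced L D)))).comp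
    (MvPolynomial.aeval fun k => ⟨chiReduced L D k, Algebra.subset_adjoin ⟨k, rfl⟩⟩)

lemma operatorHom_X (k : Fin c) : operatorHom L D (MvPolynomial.X k) = chiReduced L D k := by
  simp [operatorHom]

instance : Module (MvPolynomial (Fin c) (IsLocalRing.ResidueField Q)) (Reduced L D) :=
  Module.compHom _ (operatorHom L D).toRingHom

/-- The support variety `V(Q, f, C, D)`: the zero set of the annihilator of `E`, together with
the origin. -/
def supportVariety : Set (Fin c → IsLocalRing.ResidueField Q) :=
  MvPolynomial.zeroLocus (IsLocalRing.ResidueField Q)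
    (Module.annihilator (MvPolynomial (Fin c) (IsLocalRing.ResidueField Q)) (Reduced L D)) ∪ {0}

end Support

/-! ### Rank varieties -/

section Rank

variable {Q : Type u} [CommRing Q] {c : ℕ}

/-- The ring `Q_a = Q/(a₁f₁ + ⋯ + a_cf_c)`. -/
abbrev HyperRing (f a : Fin c → Q) : Type u := Q ⧸ Ideal.span {∑ i, a i * f i}

/-- The natural surjection `Q_a → R`. -/
def hyperToCI (f a : Fin c → Q) : HyperRing f a →+* CIRing f :=
  Ideal.Quotient.factor (by
    rw [Ideal.span_singleton_le_iff_mem]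
    exact sum_mem fun i _ => Ideal.mul_mem_left _ _ (Ideal.subset_span ⟨i, rfl⟩))

/-- `X` is a value of `TC`: a complete resolution over `Q_a` of the image of `d₀ : C₀ ⟶ C₋₁`. -/
def IsT (f a : Fin c → Q) (C : CochainComplex (ModuleCat.{u} (CIRing f)) ℤ)
    (X : CochainComplex (ModuleCat.{u} (HyperRing f a)) ℤ) : Prop :=
  IsCompleteResolution X ((ModuleCat.restrictScalars (hyperToCI f a)).obj (imageZero C))

/-- `Hom(X, Σⁱ Y) ≠ 0` for infinitely many `i > 0`. -/
def InfinitelyManyHom {A : Type u} [CommRing A] (X Y : CochainComplex (ModuleCat.{u} A) ℤ) :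
    Prop :=
  {i : ℕ | 0 < i ∧ Nontrivial (KHom X Y (i : ℤ))}.Infinite

/-- The rank variety `W(Q, f, C, D)`: the points `b` such that, for some lifting `a` of `b` to `Q`,
`Hom_{Q_a}(TC, Σⁱ TD) ≠ 0` for infinitely many `i > 0`, together with the origin. -/
def rankVariety [IsLocalRing Q] (f : Fin c → Q)
    (C D : CochainComplex (ModuleCat.{u} (CIRing f)) ℤ) :
    Set (Fin c → IsLocalRing.ResidueField Q) :=
  {b | ∃ a : Fin c → Q, (∀ i, IsLocalRing.residue Q (a i) = b i) ∧
    ∃ X Y : CochainComplex (ModuleCat.{u} (HyperRing f a)) ℤ,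
      IsT f a C X ∧ IsT f a D Y ∧ InfinitelyManyHom X Y} ∪ {0}

end Rank

end TotallyAcyclic

end

/-!
# Support varieties and rank varieties of totally acyclic complexes

Fix `a` with `ā ≠ 0`. The claim is that `ā` lies in the support variety if and only if
`Hom(TC, Σⁱ TD)` over the hypersurface `Q_a` is nonzero for infinitely many `i > 0`
(`infinitelyManyHom_iff`).

Some `aₗ` is a unit, so the equation `∑ aᵢ fᵢ` of `Q_a` may replace `fₗ` in the regular sequence
(`RegularFamily.update`), and the Eisenbud operators for the new sequence are linear combinations
of the old ones. The operators of the new members other than `∑ aᵢ fᵢ` are linear forms in `χ` that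
vanish at `ā`. All complexes are described by sequences of matrices over `Q` whose composites vanish
modulo an ideal (`MatSeq`). If `x` is a nonzerodivisor modulo `J` and `d² = x t` modulo `J`, then
`[[d, x], [-t, -d]]` is a complex modulo `J` (`MatSeq.step`). This construction has two readings:

* Over `R`, where `x` is zero, it becomes the mapping cone of the operator `t` (`stepCocone`). The
  long exact sequence of the cone shows by induction, starting at the regular ring `Q`, over which
  exact complexes of free modules split, that `⨁ Hom(C, Σⁱ D)` is finitely generated over
  `R[χ₁,…,χ_c]` (`finite_khomModule`). If the operator vanishes at `b`, passing to the cone does not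
  change whether `b` is in the support (`OpModule.isKilled_of_isKilled`), by the Cayley–Hamilton
  theorem.
* Modulo `J` it turns a resolution of a module over `Q/(J + (x))` into a resolution of the same
  module over `Q/J` (`MatSeq.Resolves.step`).

Removing the members other than `∑ aᵢ fᵢ` in this way, one obtains a complete resolution of the
image of `d₀` over `Q_a` and a complex `K` over `R`, its reduction, such that `ā` is in the support
of `C` if and only if it is in that of `K` (`exists_resolves_and_isKilled_iff`). On `Hom(K, Σⁱ D)`
every operator is a multiple of a single one, which is surjective, since its cone lifts to `Q`.
Hence `ā` is in the support if and only if `Hom(K, Σⁱ D)` does not vanish for large `i`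
(`isKilled_iff_of_singleton`). Finally `Hom(TC, Σⁱ TD)` vanishes if and only if `Hom(TC, N)`, for
`N` the image of the differential of `D`, is exact in degree `-i`
(`IsCompleteResolution.subsingleton_KHom_iff`). As `N` is an `R`-module, this condition can be read
off from the matrices, and for large `i` it is the same one as for `K`
(`Realization.homExact_iff`). By Nakayama's lemma the support may be computed before reduction to
the residue field (`mem_supportVariety_iff`).
-/

noncomputable section

/-! ### Cocycles and the homotopy category -/

namespace TotallyAcyclic

open CochainComplex.HomComplex

section Classes

variable {A : Type u} [CommRing A] {K D E : CochainComplex (ModuleCat.{u} A) ℤ} {i : ℤ}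

/-- The class in the homotopy category of a cocycle of degree `i` of the complex `Hom(K, D)`. -/
def cls (z : Cocycle K D i) : KHom K D i :=
  ShiftedHom.map (M := ℤ) (X := K) (Y := D) (Cocycle.equivHomShift.symm z)
    (HomotopyCategory.quotient (ModuleCat.{u} A) (ComplexShape.up ℤ))

lemma cls_eq (z : Cocycle K D i) : cls z = CohomologyClass.toHom (CohomologyClass.mk z) ≫
    (((HomotopyCategory.quotient (ModuleCat.{u} A) (ComplexShape.up ℤ)).commShiftIso i).hom.app
      D) := by
  rw [CohomologyClass.toHom_mk]
  rfl

lemma cls_surjective (α : KHom K D i) : ∃ z : Cocycle K D i, cls z = α := by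
  obtain ⟨w, hw⟩ := (CohomologyClass.toHom_bijective K D i).2
    (α ≫ (((HomotopyCategory.quotient (ModuleCat.{u} A) (ComplexShape.up ℤ)).commShiftIso
      i).inv.app D))
  obtain ⟨z, rfl⟩ := w.mk_surjective
  refine ⟨z, ?_⟩
  rw [cls_eq, hw, Category.assoc, Iso.inv_hom_id_app]
  exact Category.comp_id _

lemma cls_eq_zero_iff (z : Cocycle K D i) (m : ℤ) (hm : m + 1 = i) :
    cls z = 0 ↔ ∃ β : Cochain K D m, δ m i β = z := by
  rw [← mem_coboundaries_iff _ _ hm, ← CohomologyClass.toHom_mk_eq_zero_iff, cls_eq]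
  refine ⟨fun h => ?_, fun h => by rw [h]; exact Limits.zero_comp⟩
  rw [← cancel_mono (((HomotopyCategory.quotient (ModuleCat.{u} A)
    (ComplexShape.up ℤ)).commShiftIso i).hom.app D), h]
  exact Limits.zero_comp.symm

lemma cls_add (z w : Cocycle K D i) : cls (z + w) = cls z + cls w := by
  rw [cls_eq, cls_eq, cls_eq, CohomologyClass.mk_add, map_add]
  exact Preadditive.add_comp _ _ _ _ _ _

lemma cls_neg (z : Cocycle K D i) : cls (-z) = -cls z := by
  rw [cls_eq, cls_eq, CohomologyClass.mk_neg, map_neg]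
  exact Preadditive.neg_comp _ _

lemma cls_sub (z w : Cocycle K D i) : cls (z - w) = cls z - cls w := by
  rw [sub_eq_add_neg, cls_add, cls_neg, ← sub_eq_add_neg]

lemma cls_zero : cls (0 : Cocycle K D i) = 0 := by
  simpa using cls_sub (0 : Cocycle K D i) 0

lemma equivHomShift_symm_f (z : Cocycle K D i) (p : ℤ) :
    (Cocycle.equivHomShift.symm z).f p = (z : Cochain K D i).v p (p + i) rfl := by
  simp only [Cocycle.equivHomShift_symm_apply, Cocycle.homOf, Cocycle.rightShift_coe,
    Cochain.rightShift_v _ _ _ _ p p (add_zero p) (p + i) rfl]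
  exact Category.comp_id _

lemma cls_smul (r : A) (z : Cocycle K D i) : cls (r • z) = r • cls z := by
  have : (Cocycle.equivHomShift.symm (r • z) : K ⟶ D⟦i⟧) =
      r • Cocycle.equivHomShift.symm z := by
    ext1 p
    rw [HomologicalComplex.smul_f_apply, equivHomShift_symm_f, equivHomShift_symm_f]
    rfl
  rw [cls, cls, this, ShiftedHom.map, ShiftedHom.map, Functor.map_smul]
  exact Linear.smul_comp _ _ _ _ _ _

lemma cls_comp {j k : ℤ} (z : Cocycle K D i) (w : Cocycle D E j) (y : Cocycle K E k)
    (h : j + i = k) (hy : (y : Cochain K E k) = (z : Cochain K D i).comp (w : Cochain D E j)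
      ((add_comm _ _).trans h)) : (cls z).comp (cls w) h = cls y := by
  rw [cls, cls, cls, ← ShiftedHom.map_comp]
  congr 1
  ext1 p
  rw [equivHomShift_symm_f, hy]
  subst h
  simp only [ShiftedHom.comp, HomologicalComplex.comp_f]
  rw [CochainComplex.shiftFunctorAdd'_inv_app_f', CochainComplex.shiftFunctor_map_f',
    equivHomShift_symm_f, equivHomShift_symm_f,
    Cochain.comp_v _ _ _ p (p + i) (p + (j + i)) rfl (by lia)]
  congr 1
  exact Cochain.v_comp_XIsoOfEq_hom _ _ _ _ _ _

/-- The cocycle underlying an Eisenbud operator. -/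
lemma EisenbudLift.classOp_eq_cls {Q : Type u} [CommRing Q] {c : ℕ} {f : Fin c → Q}
    [hf : Fact (RingTheory.Sequence.IsRegular Q (List.ofFn f))]
    {C : CochainComplex (ModuleCat.{u} (CIRing f)) ℤ} (L : EisenbudLift f C) (k : Fin c) :
    ∃ z : Cocycle C C 2, L.classOp k = cls z ∧
      ∀ p q h, (z : Cochain C C 2).v p q h = L.red (L.t k p q) := by
  refine ⟨Cocycle.equivHomShift (L.operator k), ?_, fun p q h => ?_⟩
  · rw [cls, AddEquiv.symm_apply_apply]
    rfl
  · subst h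
    rw [← equivHomShift_symm_f, AddEquiv.symm_apply_apply]
    rfl

end Classes

end TotallyAcyclic

/-! ### Vanishing of `Hom(X, Σⁱ Y)` in terms of one differential -/

namespace TotallyAcyclic

open CochainComplex.HomComplex

/-- Sequences indexed by `ℤ` can be built from one member by extending step by step in both
directions. -/
lemma exists_int_seq {α : ℤ → Type*} (r : ∀ p q, α p → α q → Prop)
    (up : ∀ p x, ∃ y, r p (p + 1) x y) (down : ∀ p y, ∃ x, r (p - 1) p x y)
    (m : ℤ) (x₀ : α m) :
    ∃ s : ∀ n, α n, s m = x₀ ∧ ∀ p q, p + 1 = q → r p q (s p) (s q) := by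
  choose u hu using up
  choose d hd using down
  refine ⟨fun n => Int.inductionOn' n m x₀ (fun k _ x => u k x) (fun k _ x => d k x),
    Int.inductionOn'_self, fun p q hpq => ?_⟩
  obtain h | h := le_or_gt m p
  · subst hpq
    beta_reduce
    rw [Int.inductionOn'_add_one h]
    exact hu _ _
  · obtain rfl : p = q - 1 := by lia
    beta_reduce
    rw [Int.inductionOn'_sub_one (show q ≤ m by lia)]
    exact hd _ _

section

variable {A : Type u} [CommRing A] (X Y : CochainComplex (ModuleCat.{u} A) ℤ)

/-- Exactness of `Hom(X, N)` at the spot `Hom(Xᵃ, N)`. -/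
def HomExact (N : ModuleCat.{u} A) (a : ℤ) : Prop :=
  ∀ f : X.X a ⟶ N, X.d (a - 1) a ≫ f = 0 → ∃ h : X.X (a + 1) ⟶ N, f = X.d a (a + 1) ≫ h

/-- For `X` consisting of projective modules, exactness of `Hom(X, N)` at the spot `Hom(Xᵃ, N)`,
where `N` is the cokernel of the differential `Yᵇ⁻¹ ⟶ Yᵇ`. -/
def CokerExact (a b : ℤ) : Prop :=
  ∀ (f : X.X a ⟶ Y.X b) (g : X.X (a - 1) ⟶ Y.X (b - 1)),
    X.d (a - 1) a ≫ f = g ≫ Y.d (b - 1) b →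
    ∃ (h : X.X (a + 1) ⟶ Y.X b) (k : X.X a ⟶ Y.X (b - 1)),
      f = X.d a (a + 1) ≫ h + k ≫ Y.d (b - 1) b

/-- Exactness of `Y` at the spot `Yᵇ`, in terms of elements. -/
def ElemExact (b : ℤ) : Prop :=
  ∀ a c, a + 1 = b → b + 1 = c → ∀ y : Y.X b, Y.d b c y = 0 → ∃ x : Y.X a, Y.d a b x = y

variable {X Y}

lemma elemExact_of_acyclic (hY : Y.Acyclic) (b : ℤ) : ElemExact Y b := fun a c ha hc y hy => by
  have h := (Y.exactAt_iff' a b c (by simp [← ha]) (by simp [hc])).1 (hY b)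
  exact (ShortComplex.moduleCat_exact_iff _).1 h y hy

lemma ElemExact.lift {b : ℤ} (hY : ElemExact Y b) {P : ModuleCat.{u} A} [Module.Projective A P]
    {a c : ℤ} (ha : a + 1 = b) (hc : b + 1 = c) (f : P ⟶ Y.X b) (hf : f ≫ Y.d b c = 0) :
    ∃ g : P ⟶ Y.X a, g ≫ Y.d a b = f := by
  have hmem : ∀ x, f.hom x ∈ LinearMap.range (Y.d a b).hom := fun x => by
    obtain ⟨y, hy⟩ := hY a c ha hc (f x) (by
      simpa using congrArg (fun φ => φ.hom x) hf)
    exact ⟨y, hy⟩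
  obtain ⟨g, hg⟩ := Module.projective_lifting_property (Y.d a b).hom.rangeRestrict
    (f.hom.codRestrict _ hmem) (LinearMap.surjective_rangeRestrict _)
  refine ⟨ModuleCat.ofHom g, ?_⟩
  ext x
  exact congrArg Subtype.val (LinearMap.congr_fun hg x)

lemma HomExact.desc {N : ModuleCat.{u} A} {b : ℤ} (h : HomExact X N b) {a c : ℤ} (ha : a + 1 = b)
    (hc : b + 1 = c) (f : X.X b ⟶ N) (hf : X.d a b ≫ f = 0) :
    ∃ g : X.X c ⟶ N, f = X.d b c ≫ g := by
  subst hc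
  obtain rfl : a = b - 1 := by lia
  exact h f hf

variable [hX : ∀ n, Module.Projective A (X.X n)]

/-- A map between single terms of the complexes that is compatible with the differentials on both
sides extends to a cocycle: exactness of `Hom(X, Yᵇ)` continues it to the right, and exactness of
`Y` continues it to the left. -/
lemma exists_cocycle (hY : ∀ b, ElemExact Y b) (hXY : ∀ a b, HomExact X (Y.X b) a)
    {i a b : ℤ} (hab : a + i = b) (f : X.X a ⟶ Y.X b)
    (hf : X.d (a - 1) a ≫ f ≫ Y.d b (b + 1) = 0) : ∃ z : Cocycle X Y i, z.1.v a b hab = f := by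
  subst hab
  obtain ⟨s, hs, hr⟩ := exists_int_seq
    (α := fun n => {f : X.X n ⟶ Y.X (n + i) // X.d (n - 1) n ≫ f ≫ Y.d (n + i) (n + i + 1) = 0})
    (fun p q x y => x.1 ≫ Y.d (p + i) (q + i) = i.negOnePow • X.d p q ≫ y.1)
    (fun p ⟨x, hx⟩ => by
      obtain ⟨y, hy⟩ := (hXY p (p + 1 + i)).desc (a := p - 1) (by lia) rfl
        (i.negOnePow • x ≫ Y.d (p + i) (p + 1 + i)) (by
          rw [show p + i + 1 = p + 1 + i by lia] at hx
          rw [Linear.comp_units_smul, hx, smul_zero])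
      refine ⟨⟨y, ?_⟩, ?_⟩
      · rw [show p + 1 - 1 = p by lia, ← Category.assoc, ← hy]
        simp
      · rw [← hy, smul_smul]
        simp)
    (fun p ⟨y, hy⟩ => by
      obtain ⟨x, hx⟩ := (hY (p + i)).lift (a := p - 1 + i) (by lia) rfl
        (i.negOnePow • X.d (p - 1) p ≫ y) (by
          rw [Linear.units_smul_comp, Category.assoc, hy, smul_zero])
      refine ⟨⟨x, ?_⟩, hx⟩
      rw [show p - 1 + i + 1 = p + i by lia, hx]
      simp)
    a ⟨f, hf⟩
  refine ⟨Cocycle.mk (Cochain.mk fun p q h => (s p).1 ≫ (Y.XIsoOfEq h).hom) (i + 1) rfl ?_, ?_⟩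
  · ext1 p q hpq
    subst hpq
    rw [δ_v i (i + 1) rfl _ p _ rfl (p + i) (p + 1) (by lia) rfl]
    have h := hr p (p + 1) rfl
    rw [Cochain.zero_v, Int.negOnePow_succ, Units.neg_smul, add_neg_eq_zero]
    simp only [Cochain.mk_v, Category.assoc, HomologicalComplex.XIsoOfEq_hom_comp_d]
    rw [← HomologicalComplex.d_comp_XIsoOfEq_hom Y (show p + 1 + i = p + (i + 1) by lia),
      ← Category.assoc, h]
    simp
  · simp [hs]

/-- A nullhomotopy of a cocycle can be built from a single term of it, as in `exists_cocycle`. -/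
lemma exists_coboundary (hY : ∀ b, ElemExact Y b) (hXY : ∀ a b, HomExact X (Y.X b) a)
    {i m a b b' : ℤ} (hm : m + 1 = i) (hab : a + i = b) (hb : b' + 1 = b) (z : Cocycle X Y i)
    (h : X.X a ⟶ Y.X b')
    (hh : X.d (a - 1) a ≫ (z.1.v a b hab - h ≫ Y.d b' b) = 0) :
    ∃ β : Cochain X Y m, δ m i β = z := by
  subst hab hm
  obtain rfl : b' = a + m := by lia
  have hz : ∀ p q p' q' hp hq, p + 1 = p' → q + 1 = q' →
      z.1.v p q hp ≫ Y.d q q' = (m + 1).negOnePow • X.d p p' ≫ z.1.v p' q' hq := by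
    rintro p q p' q' hp hq rfl rfl
    have := congrArg (fun y => y.v p (q + 1) (by lia)) (z.δ_eq_zero (m + 1 + 1))
    simp only [Cochain.zero_v] at this
    rw [δ_v (m + 1) (m + 1 + 1) rfl _ p _ _ q (p + 1) (by lia) rfl] at this
    rw [Int.negOnePow_succ (m + 1), Units.neg_smul, add_neg_eq_zero] at this
    exact this
  obtain ⟨s, hs, hr⟩ := exists_int_seq
    (α := fun n => {h : X.X n ⟶ Y.X (n + m) // ∀ (n' : ℤ) (hn : n + (m + 1) = n'),
      X.d (n - 1) n ≫ (z.1.v n n' hn - h ≫ Y.d (n + m) n') = 0})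
    (fun p q x y => ∀ hp : p + (m + 1) = q + m, z.1.v p (q + m) hp =
      x.1 ≫ Y.d (p + m) (q + m) + (m + 1).negOnePow • X.d p q ≫ y.1)
    (fun p ⟨x, hx⟩ => by
      have hx := hx (p + 1 + m) (by lia)
      obtain ⟨y, hy⟩ := (hXY p (p + 1 + m)).desc (a := p - 1) (by lia) rfl
        ((m + 1).negOnePow • (z.1.v p (p + 1 + m) (by lia) - x ≫ Y.d (p + m) (p + 1 + m))) (by
          rw [Linear.comp_units_smul, hx, smul_zero])
      refine ⟨⟨y, fun n' hn => ?_⟩, fun _ => ?_⟩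
      · rw [show p + 1 - 1 = p by lia, Preadditive.comp_sub, ← Category.assoc, ← hy,
          Linear.units_smul_comp, Preadditive.sub_comp,
          hz p (p + 1 + m) (p + 1) n' (by lia) hn rfl (by lia)]
        simp [smul_smul]
      · rw [← hy, smul_smul]
        simp)
    (fun p ⟨y, hy⟩ => by
      have hy := hy (p + m + 1) (by lia)
      obtain ⟨x, hx⟩ := (hY (p + m)).lift (a := p - 1 + m) (by lia) rfl
        (z.1.v (p - 1) (p + m) (by lia) - (m + 1).negOnePow • X.d (p - 1) p ≫ y) (by
          rw [Preadditive.sub_comp, hz (p - 1) (p + m) p (p + m + 1) (by lia) (by lia) (by lia) rfl,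
            Linear.units_smul_comp, ← smul_sub, Category.assoc, ← Preadditive.comp_sub, hy,
            smul_zero])
      refine ⟨⟨x, fun n' hn => ?_⟩, fun _ => ?_⟩
      · obtain rfl : n' = p + m := by lia
        rw [hx]
        simp
      · rw [hx]
        simp)
    a ⟨h, by rintro _ rfl; exact hh⟩
  refine ⟨Cochain.mk fun p q hpq => (s p).1 ≫ (Y.XIsoOfEq hpq).hom, ?_⟩
  ext1 p q hpq
  obtain rfl : q = p + 1 + m := by lia
  rw [δ_v m (m + 1) rfl _ p _ _ (p + m) (p + 1) (by lia) rfl, hr p (p + 1) rfl (by lia)]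
  simp

/-- A class is determined by any one of the components of a cocycle that represents it. -/
lemma cls_eq_zero_of_v_eq_zero (hY : ∀ b, ElemExact Y b) (hXY : ∀ a b, HomExact X (Y.X b) a)
    {i a b : ℤ} (hab : a + i = b) (z : Cocycle X Y i) (hz : z.1.v a b hab = 0) : cls z = 0 := by
  rw [cls_eq_zero_iff z (i - 1) (by lia)]
  exact exists_coboundary hY hXY (by lia) hab (show b - 1 + 1 = b by lia) z 0 (by simp [hz])

lemma subsingleton_KHom_iff_forall_cls {X Y : CochainComplex (ModuleCat.{u} A) ℤ} {i : ℤ} :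
    Subsingleton (KHom X Y i) ↔ ∀ z : Cocycle X Y i, cls z = 0 := by
  refine ⟨fun h z => Subsingleton.elim _ _, fun h => ⟨fun x y => ?_⟩⟩
  obtain ⟨z, rfl⟩ := cls_surjective x
  obtain ⟨w, rfl⟩ := cls_surjective y
  rw [h, h]

/-- Vanishing of `Hom(X, Σⁱ Y)` can be tested at any one spot of the complexes. -/
theorem subsingleton_KHom_iff (hY : ∀ b, ElemExact Y b) (hXY : ∀ a b, HomExact X (Y.X b) a)
    {i a b : ℤ} (hab : a + i = b) : Subsingleton (KHom X Y i) ↔ CokerExact X Y a b := by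
  rw [subsingleton_KHom_iff_forall_cls]
  constructor
  · intro H f g hfg
    obtain ⟨z, hz⟩ := exists_cocycle hY hXY hab f (by
      rw [← Category.assoc, hfg]
      simp)
    obtain ⟨β, hβ⟩ := (cls_eq_zero_iff z (i - 1) (by lia)).1 (H z)
    have h := congrArg (fun y => y.v a b hab) hβ
    rw [δ_v (i - 1) i (by lia) _ a b hab (b - 1) (a + 1) (by lia) rfl] at h
    refine ⟨i.negOnePow • β.v (a + 1) b (by lia), β.v a (b - 1) (by lia), ?_⟩
    rw [← hz, ← h, add_comm]
    simp
  · intro H z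
    obtain ⟨h, k, hk⟩ := H (z.1.v a b hab)
      (i.negOnePow • z.1.v (a - 1) (b - 1) (by lia)) (by
        have := congrArg (fun y => y.v (a - 1) b (by lia)) (z.δ_eq_zero (i + 1))
        simp only [Cochain.zero_v] at this
        rw [δ_v i (i + 1) rfl _ (a - 1) _ _ (b - 1) a (by lia) (by lia)] at this
        rw [Int.negOnePow_succ, Units.neg_smul, add_neg_eq_zero] at this
        rw [Linear.units_smul_comp, this, smul_smul]
        simp)
    rw [cls_eq_zero_iff z (i - 1) (by lia)]
    exact exists_coboundary hY hXY (by lia) hab (show b - 1 + 1 = b by lia) z k (by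
      rw [hk]
      simp)

end

end TotallyAcyclic

/-! ### Complete resolutions and truncations -/

namespace TotallyAcyclic

open CochainComplex.HomComplex

section

variable {A : Type u} [CommRing A] {X X' Y P : CochainComplex (ModuleCat.{u} A) ℤ}

/-- The part of `X` in cohomological degrees `≤ m` is a retract up to homotopy of the part of `Y`
in these degrees. -/
def TruncRetract (X Y : CochainComplex (ModuleCat.{u} A) ℤ) (m : ℤ) : Prop :=
  ∃ (φ : ∀ n, X.X n ⟶ Y.X n) (γ : ∀ n, Y.X n ⟶ X.X n) (h : ∀ p q, X.X p ⟶ X.X q),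
    (∀ p q, p + 1 = q → q ≤ m → φ p ≫ Y.d p q = X.d p q ≫ φ q) ∧
    (∀ p q, p + 1 = q → q ≤ m → γ p ≫ X.d p q = Y.d p q ≫ γ q) ∧
    (∀ o p q, o + 1 = p → p + 1 = q → q ≤ m →
      𝟙 (X.X p) = φ p ≫ γ p + h p o ≫ X.d o p + X.d p q ≫ h q p) ∧
    (∀ o, o + 1 = m → 𝟙 (X.X m) = φ m ≫ γ m + h m o ≫ X.d o m)

/-- In degrees that survive the truncation, `CokerExact` passes to retracts. -/
lemma TruncRetract.cokerExact {a b m : ℤ} (h : TruncRetract Y P m) (hb : b ≤ m)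
    (hXY : HomExact X (Y.X (b + 1)) a) (hP : CokerExact X P a b) : CokerExact X Y a b := by
  obtain ⟨φ, γ, k, hφ, hγ, hk, hk'⟩ := h
  intro f g hfg
  obtain ⟨r, s, hrs⟩ := hP (f ≫ φ b) (g ≫ φ (b - 1)) (by
    rw [← Category.assoc, hfg, Category.assoc, Category.assoc, hφ _ _ (by lia) hb])
  obtain ⟨t, ht⟩ : ∃ t : X.X (a + 1) ⟶ Y.X b,
      f = (f ≫ φ b) ≫ γ b + f ≫ k b (b - 1) ≫ Y.d (b - 1) b + X.d a (a + 1) ≫ t := by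
    obtain rfl | hb' := hb.eq_or_lt
    · refine ⟨0, ?_⟩
      calc f = f ≫ 𝟙 _ := (Category.comp_id f).symm
        _ = _ := by rw [hk' (b - 1) (by lia)]; simp
    · obtain ⟨t, ht⟩ := hXY (f ≫ Y.d b (b + 1)) (by
        rw [← Category.assoc, hfg]
        simp)
      refine ⟨t ≫ k (b + 1) b, ?_⟩
      calc f = f ≫ 𝟙 _ := (Category.comp_id f).symm
        _ = (f ≫ φ b) ≫ γ b + f ≫ k b (b - 1) ≫ Y.d (b - 1) b +
            (f ≫ Y.d b (b + 1)) ≫ k (b + 1) b := by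
          rw [hk (b - 1) b (b + 1) (by lia) rfl (by lia)]
          simp only [Preadditive.comp_add, Category.assoc]
        _ = _ := by rw [ht, Category.assoc (X.d a (a + 1))]
  refine ⟨r ≫ γ b + t, s ≫ γ (b - 1) + f ≫ k b (b - 1), ht.trans ?_⟩
  rw [hrs]
  simp only [Preadditive.add_comp, Preadditive.comp_add, Category.assoc,
    hγ (b - 1) b (by lia) hb]
  abel

lemma TruncRetract.homExact {a m : ℤ} (h : TruncRetract X X' m) (ha : a < m)
    {N : ModuleCat.{u} A} (hX' : HomExact X' N a) : HomExact X N a := by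
  obtain ⟨φ, γ, k, hφ, hγ, hk, -⟩ := h
  intro f hf
  obtain ⟨r, hr⟩ := hX' (γ a ≫ f) (by
    rw [← Category.assoc, ← hγ _ _ (by lia) ha.le, Category.assoc, hf, Limits.comp_zero])
  refine ⟨φ (a + 1) ≫ r + k (a + 1) a ≫ f, ?_⟩
  calc f = 𝟙 _ ≫ f := (Category.id_comp f).symm
    _ = φ a ≫ γ a ≫ f + k a (a - 1) ≫ X.d (a - 1) a ≫ f + X.d a (a + 1) ≫ k (a + 1) a ≫ f := by
      rw [hk (a - 1) a (a + 1) (by lia) rfl (by lia)]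
      simp only [Preadditive.add_comp, Category.assoc]
    _ = _ := by
      rw [hf, hr, ← Category.assoc, hφ a (a + 1) rfl (by lia)]
      simp

/-- The condition in degree `m` holds when the differential leaving degree `m` is zero, as it is for
a truncation. -/
lemma truncRetract_of_homotopyEquiv (e : HomotopyEquiv X Y) (m : ℤ)
    (hm : ∀ n, m + 1 = n → ∀ f : X.X n ⟶ X.X m, X.d m n ≫ f = 0) : TruncRetract X Y m := by
  have key : ∀ o p q, o + 1 = p → p + 1 = q → 𝟙 (X.X p) = e.hom.f p ≫ e.inv.f p +
      (-e.homotopyHomInvId.hom p o) ≫ X.d o p + X.d p q ≫ (-e.homotopyHomInvId.hom q p) := by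
    intro o p q ho hq
    have h := e.homotopyHomInvId.comm p
    rw [prevD_eq _ (show (ComplexShape.up ℤ).Rel o p from ho),
      dNext_eq _ (show (ComplexShape.up ℤ).Rel p q from hq)] at h
    simp only [HomologicalComplex.comp_f, HomologicalComplex.id_f] at h
    rw [h]
    simp only [Preadditive.neg_comp, Preadditive.comp_neg]
    abel
  refine ⟨e.hom.f, e.inv.f, fun p q => -e.homotopyHomInvId.hom p q,
    fun p q _ _ => e.hom.comm p q, fun p q _ _ => e.inv.comm p q,
    fun o p q ho hq _ => key o p q ho hq, fun o ho => ?_⟩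
  rw [key o m (m + 1) ho rfl, hm _ rfl, add_zero]

lemma TruncRetract.of_iso {T T' : CochainComplex (ModuleCat.{u} A) ℤ} {m : ℤ}
    (σ : ∀ n, n ≤ m → (T.X n ≅ X.X n))
    (hσ : ∀ p q hp hq, (σ p hp).hom ≫ X.d p q = T.d p q ≫ (σ q hq).hom)
    (τ : ∀ n, n ≤ m → (T'.X n ≅ Y.X n))
    (hτ : ∀ p q hp hq, (τ p hp).hom ≫ Y.d p q = T'.d p q ≫ (τ q hq).hom)
    (h : TruncRetract T T' m) : TruncRetract X Y m := by
  have hσ' : ∀ p q hp hq, X.d p q ≫ (σ q hq).inv = (σ p hp).inv ≫ T.d p q := fun p q hp hq => by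
    rw [Iso.eq_inv_comp, ← Category.assoc, hσ p q hp hq]
    simp
  have hτ' : ∀ p q hp hq, Y.d p q ≫ (τ q hq).inv = (τ p hp).inv ≫ T'.d p q := fun p q hp hq => by
    rw [Iso.eq_inv_comp, ← Category.assoc, hτ p q hp hq]
    simp
  obtain ⟨φ, γ, k, hφ, hγ, hk, hk'⟩ := h
  refine ⟨fun n => if hn : n ≤ m then (σ n hn).inv ≫ φ n ≫ (τ n hn).hom else 0,
    fun n => if hn : n ≤ m then (τ n hn).inv ≫ γ n ≫ (σ n hn).hom else 0,
    fun p q => if hp : p ≤ m then if hq : q ≤ m then (σ p hp).inv ≫ k p q ≫ (σ q hq).hom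
      else 0 else 0, fun p q hpq hq => ?_, fun p q hpq hq => ?_, fun o p q ho hpq hq => ?_,
      fun o ho => ?_⟩
  · have hp : p ≤ m := by lia
    simp only [dif_pos hp, dif_pos hq]
    rw [Category.assoc, Category.assoc, hτ p q hp hq,
      ← Category.assoc (φ p), hφ p q hpq hq, ← Category.assoc, ← Category.assoc,
      ← Category.assoc (X.d p q), hσ' p q hp hq]
    simp
  · have hp : p ≤ m := by lia
    simp only [dif_pos hp, dif_pos hq]
    rw [Category.assoc, Category.assoc, hσ p q hp hq,
      ← Category.assoc (γ p), hγ p q hpq hq, ← Category.assoc, ← Category.assoc,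
      ← Category.assoc (Y.d p q), hτ' p q hp hq]
    simp
  · have hp : p ≤ m := by lia
    have ho' : o ≤ m := by lia
    have h1 : 𝟙 (X.X p) = (σ p hp).inv ≫ 𝟙 _ ≫ (σ p hp).hom := by simp
    have h2 := hσ' p q hp hq
    rw [h1, hk o p q ho hpq hq]
    simp only [dif_pos hp, dif_pos hq, dif_pos ho', Preadditive.comp_add, Preadditive.add_comp,
      Category.assoc, Iso.hom_inv_id_assoc, hσ o p ho' hp, reassoc_of% h2]
  · have ho' : o ≤ m := by lia
    have h1 : 𝟙 (X.X m) = (σ m le_rfl).inv ≫ 𝟙 _ ≫ (σ m le_rfl).hom := by simp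
    rw [h1, hk' o ho]
    simp only [dif_pos le_rfl, dif_pos ho', Preadditive.comp_add, Preadditive.add_comp,
      Category.assoc, Iso.hom_inv_id_assoc, hσ o m ho' le_rfl]

lemma embeddingUpIntLE_f_toNat {m n : ℤ} (hn : n ≤ m) :
    (ComplexShape.embeddingUpIntLE m).f (m - n).toNat = n := by
  change m - ((m - n).toNat : ℤ) = n
  lia

/-- A truncation agrees with the complex in the degrees that it keeps. -/
def truncIso (X : CochainComplex (ModuleCat.{u} A) ℤ) (i n : ℤ) (hn : n ≤ -i - 1) :
    (truncGT X i).X n ≅ X.X n :=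
  X.stupidTruncXIso (ComplexShape.embeddingUpIntLE (-i - 1)) (embeddingUpIntLE_f_toNat hn)

lemma truncIso_comm (X : CochainComplex (ModuleCat.{u} A) ℤ) (i p q : ℤ) (hp : p ≤ -i - 1)
    (hq : q ≤ -i - 1) :
    (truncIso X i p hp).hom ≫ X.d p q = (truncGT X i).d p q ≫ (truncIso X i q hq).hom := by
  have key : ∀ (a b : ℕ) (ha : (ComplexShape.embeddingUpIntLE (-i - 1)).f a = p)
      (hb : (ComplexShape.embeddingUpIntLE (-i - 1)).f b = q),
      (X.stupidTruncXIso _ ha).hom ≫ X.d p q =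
        (X.stupidTrunc (ComplexShape.embeddingUpIntLE (-i - 1))).d p q ≫
          (X.stupidTruncXIso _ hb).hom := by
    rintro a b rfl rfl
    have h : ∀ a, (X.stupidTruncXIso (ComplexShape.embeddingUpIntLE (-i - 1))
        (Eq.refl ((ComplexShape.embeddingUpIntLE (-i - 1)).f a))).hom =
        ((X.restriction (ComplexShape.embeddingUpIntLE (-i - 1))).extendXIso _ rfl).hom :=
      fun a => Category.comp_id _
    have h' : ∀ (K : ChainComplex (ModuleCat.{u} A) ℕ)
        (e : (ComplexShape.down ℕ).Embedding (ComplexShape.up ℤ)),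
        (K.extendXIso e (Eq.refl (e.f a))).hom ≫ K.d a b =
          (K.extend e).d _ _ ≫ (K.extendXIso e (Eq.refl (e.f b))).hom := fun K e => by
      rw [K.extend_d_eq e rfl rfl]
      simp
    rw [h, h]
    exact h' (X.restriction _) _
  exact key _ _ _ _

lemma truncRetract_of_truncGT {i : ℤ} (e : HomotopyEquiv (truncGT X i) (truncGT Y i)) :
    TruncRetract X Y (-i - 1) := by
  refine TruncRetract.of_iso (truncIso X i) (truncIso_comm X i) (truncIso Y i)
    (truncIso_comm Y i) (truncRetract_of_homotopyEquiv e _ fun n hn f => ?_)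
  have h : Limits.IsZero ((truncGT X i).X n) :=
    HomologicalComplex.isZero_stupidTrunc_X _ _ _ fun k hk => by
      have : (-i - 1) - (k : ℤ) = n := hk
      lia
  rw [h.eq_of_tgt ((truncGT X i).d (-i - 1) n) 0, Limits.zero_comp]

lemma CokerExact.desc {a b : ℤ} (h : CokerExact X Y a b) {o p q : ℤ} (ho : o + 1 = a)
    (hp : a + 1 = p) (hq : q + 1 = b) (f : X.X a ⟶ Y.X b) (g : X.X o ⟶ Y.X q)
    (hfg : X.d o a ≫ f = g ≫ Y.d q b) :
    ∃ (h : X.X p ⟶ Y.X b) (k : X.X a ⟶ Y.X q), f = X.d a p ≫ h + k ≫ Y.d q b := by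
  subst hp
  obtain rfl : o = a - 1 := by lia
  obtain rfl : q = b - 1 := by lia
  exact h f g hfg

lemma CokerExact.of {a b o q : ℤ} (ho : o + 1 = a) (hq : q + 1 = b)
    (H : ∀ (f : X.X a ⟶ Y.X b) (g : X.X o ⟶ Y.X q), X.d o a ≫ f = g ≫ Y.d q b →
      ∃ (h : X.X (a + 1) ⟶ Y.X b) (k : X.X a ⟶ Y.X q),
        f = X.d a (a + 1) ≫ h + k ≫ Y.d q b) : CokerExact X Y a b := by
  obtain rfl : o = a - 1 := by lia
  obtain rfl : q = b - 1 := by lia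
  exact H

/-- Dimension shifting in the second variable. -/
lemma cokerExact_iff_succ [∀ n, Module.Projective A (X.X n)] {a b a' b' : ℤ} (ha : a + 1 = a')
    (hb : b + 1 = b') (hY : ElemExact Y b) (hXY : ∀ a, HomExact X (Y.X b') a) :
    CokerExact X Y a b ↔ CokerExact X Y a' b' := by
  subst ha hb
  constructor
  · refine fun H => CokerExact.of rfl rfl fun f g hfg => ?_
    obtain ⟨g', hg'⟩ := hY.lift (show b - 1 + 1 = b by lia) rfl (X.d (a - 1) a ≫ g) (by
      rw [Category.assoc, ← hfg]
      simp)
    obtain ⟨h, k, hk⟩ := H g g' hg'.symm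
    obtain ⟨h', hh'⟩ := hXY (a + 1) |>.desc rfl rfl (f - h ≫ Y.d b (b + 1)) (by
      rw [Preadditive.comp_sub, hfg, hk]
      simp)
    exact ⟨h', h, by rw [← hh']; abel⟩
  · intro H f g hfg
    obtain ⟨g', hg'⟩ := (hXY a).desc (show a - 1 + 1 = a by lia) rfl (f ≫ Y.d b (b + 1)) (by
      rw [← Category.assoc, hfg]; simp)
    obtain ⟨h, k, hk⟩ := H.desc rfl rfl rfl g' f hg'.symm
    obtain ⟨k', hk'⟩ := hY.lift (show b - 1 + 1 = b by lia) rfl (f - X.d a (a + 1) ≫ k) (by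
      rw [Preadditive.sub_comp, hg', hk]
      simp)
    exact ⟨k, k', by rw [hk']; abel⟩

/-- If `p : Yᵇ ⟶ N` is a cokernel of `Yᵇ⁻¹ ⟶ Yᵇ`, then `CokerExact X Y a b` says that
`Hom(X, N)` is exact at `Hom(Xᵃ, N)`. -/
lemma cokerExact_iff_homExact [∀ n, Module.Projective A (X.X n)] {a b : ℤ} {N : ModuleCat.{u} A}
    (p : Y.X b ⟶ N) (hp : Function.Surjective p.hom)
    (hpY : Function.Exact (Y.d (b - 1) b).hom p.hom) :
    CokerExact X Y a b ↔ HomExact X N a := by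
  have hdp : Y.d (b - 1) b ≫ p = 0 := by
    ext x
    exact (hpY _).2 ⟨x, rfl⟩
  have lift0 : ∀ {P : ModuleCat.{u} A} [Module.Projective A P] (f : P ⟶ Y.X b), f ≫ p = 0 →
      ∃ g : P ⟶ Y.X (b - 1), g ≫ Y.d (b - 1) b = f := by
    intro P _ f hf
    obtain ⟨g, hg⟩ := Module.projective_lifting_property (Y.d (b - 1) b).hom.rangeRestrict
      (f.hom.codRestrict _ fun x => (hpY _).1 (by
        simpa using congrArg (fun φ => φ.hom x) hf)) (LinearMap.surjective_rangeRestrict _)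
    refine ⟨ModuleCat.ofHom g, ?_⟩
    ext x
    exact congrArg Subtype.val (LinearMap.congr_fun hg x)
  have lift1 : ∀ {P : ModuleCat.{u} A} [Module.Projective A P] (f : P ⟶ N),
      ∃ g : P ⟶ Y.X b, g ≫ p = f := by
    intro P _ f
    obtain ⟨g, hg⟩ := Module.projective_lifting_property p.hom f.hom hp
    exact ⟨ModuleCat.ofHom g, by ext x; exact LinearMap.congr_fun hg x⟩
  constructor
  · intro H f hf
    obtain ⟨f', hf'⟩ := lift1 f
    obtain ⟨g, hg⟩ := lift0 (X.d (a - 1) a ≫ f') (by rw [Category.assoc, hf', hf])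
    obtain ⟨h, k, hk⟩ := H f' g hg.symm
    refine ⟨h ≫ p, ?_⟩
    rw [← hf', hk]
    simp [hdp]
  · intro H f g hfg
    obtain ⟨h, hh⟩ := H (f ≫ p) (by rw [← Category.assoc, hfg, Category.assoc, hdp,
      Limits.comp_zero])
    obtain ⟨h', hh'⟩ := lift1 h
    obtain ⟨k, hk⟩ := lift0 (f - X.d a (a + 1) ≫ h') (by
      rw [Preadditive.sub_comp, hh, Category.assoc, hh', sub_self])
    exact ⟨h', k, by rw [hk]; abel⟩

/-- For a totally acyclic complex `X`, the complex `Hom(X, F)` is exact for all projective `F`. -/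
lemma IsTotallyAcyclic.homExact (hX : IsTotallyAcyclic X) (F : ModuleCat.{u} A)
    [hF : Module.Projective A F] (a : ℤ) : HomExact X F a := by
  intro f hf
  have := hX.finite a
  -- `F` need not be finitely generated, but the image of `f` has only finitely many nonzero
  -- coordinates with respect to a splitting `s` of the free module on `F`.
  obtain ⟨s, hs⟩ := hF.out
  have hp : ∀ x : F, Finsupp.linearCombination A (id : F → F) (s x) = x := fun x => hs x
  obtain ⟨T, hT⟩ := this.fg_top
  classical
  let U : Finset F := T.biUnion fun x => (s (f x)).support
  have hU : ∀ x, (s (f.hom x)).support ⊆ U := by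
    have h : ⊤ ≤ (Finsupp.supported A A (U : Set F)).comap (s ∘ₗ f.hom) := by
      rw [← hT, Submodule.span_le]
      intro x hx
      rw [SetLike.mem_coe, Submodule.mem_comap, Finsupp.mem_supported]
      exact_mod_cast Finset.subset_biUnion_of_mem (fun x => (s (f.hom x)).support) hx
    intro x
    have h2 : s (f.hom x) ∈ Finsupp.supported A A (U : Set F) := h (Submodule.mem_top (x := x))
    exact Finset.coe_subset.1 ((Finsupp.mem_supported A _).1 h2)
  have hc : ∀ t : F, ∃ ψ : X.X (a + 1) →ₗ[A] A, ∀ x, s (f.hom x) t = ψ (X.d a (a + 1) x) := by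
    intro t
    obtain ⟨ψ, hψ⟩ := (hX.dual_exact (a - 1) a (a + 1) (by lia) rfl
      (Finsupp.lapply t ∘ₗ s ∘ₗ f.hom)).1 (by
        ext x
        have : f.hom ((X.d (a - 1) a).hom x) = 0 := by
          simpa using congrArg (fun φ => φ.hom x) hf
        simp [this])
    exact ⟨ψ, fun x => (LinearMap.congr_fun hψ x).symm⟩
  choose ψ hψ using hc
  refine ⟨ModuleCat.ofHom (∑ t ∈ U, (ψ t).smulRight t), ?_⟩
  ext x
  change f.hom x = (∑ t ∈ U, (ψ t).smulRight t) (X.d a (a + 1) x)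
  rw [← hp (f.hom x), Finsupp.linearCombination_apply, Finsupp.sum_of_support_subset _ (hU x)]
  · simp [hψ]
  · simp

end

end TotallyAcyclic

namespace TotallyAcyclic

open CochainComplex.HomComplex

section

variable {A : Type u} [CommRing A] {X X' Y : CochainComplex (ModuleCat.{u} A) ℤ}
  {M N : ModuleCat.{u} A}

lemma projective_cochainComplex (P : ProjectiveResolution M) (n : ℤ) :
    Module.Projective A (P.cochainComplex.X n) :=
  (IsProjective.iff_projective (P.cochainComplex.X n)).2
    (inferInstanceAs (Projective (P.cochainComplex.X n)))

lemma elemExact_cochainComplex (P : ProjectiveResolution M) {b : ℤ} (hb : b < 0) :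
    ElemExact P.cochainComplex b := by
  intro a c ha hc y hy
  have h1 : P.cochainComplex.ExactAt b := by
    refine (HomologicalComplex.extend_exactAt_iff P.complex ComplexShape.embeddingDownNat
      (j := (-b - 1).toNat + 1) (j' := b) ?_).2 (P.complex_exactAt_succ _)
    change -(((-b - 1).toNat + 1 : ℕ) : ℤ) = b
    lia
  have h := (P.cochainComplex.exactAt_iff' a b c (by simp [← ha]) (by simp [hc])).1 h1
  exact (ShortComplex.moduleCat_exact_iff _).1 h y hy

/-- The augmentation of a projective resolution of `M`, as a cokernel of its last differential. -/
lemma exists_cokernel_cochainComplex (P : ProjectiveResolution M) :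
    ∃ p : P.cochainComplex.X 0 ⟶ M, Function.Surjective p.hom ∧
      Function.Exact (P.cochainComplex.d (0 - 1) 0).hom p.hom := by
  let q : P.complex.X 0 ⟶ M := P.π.f 0
  have hq : Function.Surjective q.hom :=
    (ModuleCat.epi_iff_surjective q).1 (inferInstanceAs (Epi (P.π.f 0)))
  have hex : Function.Exact (P.complex.d 1 0).hom q.hom :=
    (ShortComplex.ShortExact.moduleCat_exact_iff_function_exact _).1 P.exact₀
  let e := P.cochainComplexXIso 0 0
  let e' := P.cochainComplexXIso (0 - 1) 1
  have he : ∀ x, e.inv.hom (e.hom.hom x) = x := fun x => by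
    rw [← LinearMap.comp_apply, ← ModuleCat.hom_comp, e.hom_inv_id]; rfl
  have he2 : ∀ x, e.hom.hom (e.inv.hom x) = x := fun x => by
    rw [← LinearMap.comp_apply, ← ModuleCat.hom_comp, e.inv_hom_id]; rfl
  have he' : ∀ x, e'.hom.hom (e'.inv.hom x) = x := fun x => by
    rw [← LinearMap.comp_apply, ← ModuleCat.hom_comp, e'.inv_hom_id]; rfl
  have hd : ∀ x, (P.cochainComplex.d (0 - 1) 0).hom x =
      e.inv.hom ((P.complex.d 1 0).hom (e'.hom.hom x)) := fun x => by
    rw [P.cochainComplex_d (0 - 1) 0 1 0]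
    rfl
  refine ⟨e.hom ≫ q, fun m => ?_, fun x => ?_⟩
  · obtain ⟨x, hx⟩ := hq m
    exact ⟨e.inv.hom x, by simp [he2, hx]⟩
  · have h1 : (e.hom ≫ q).hom x = q.hom (e.hom.hom x) := rfl
    rw [h1, hex (e.hom.hom x)]
    constructor
    · rintro ⟨y, hy⟩
      exact ⟨e'.inv.hom y, by rw [hd, he', hy, he]⟩
    · rintro ⟨y, rfl⟩
      exact ⟨e'.hom.hom y, by rw [hd, he2]⟩

/-- The extension of a homotopy equivalence between chain complexes indexed by `ℕ`. -/
def extendHomotopyEquiv {K L : ChainComplex (ModuleCat.{u} A) ℕ} (h : HomotopyEquiv K L) :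
    HomotopyEquiv (K.extend ComplexShape.embeddingDownNat)
      (L.extend ComplexShape.embeddingDownNat) where
  hom := HomologicalComplex.extendMap h.hom _
  inv := HomologicalComplex.extendMap h.inv _
  homotopyHomInvId := (Homotopy.ofEq (HomologicalComplex.extendMap_comp _ _ _).symm).trans
    ((h.homotopyHomInvId.extend _).trans (Homotopy.ofEq (HomologicalComplex.extendMap_id _ _)))
  homotopyInvHomId := (Homotopy.ofEq (HomologicalComplex.extendMap_comp _ _ _).symm).trans
    ((h.homotopyInvHomId.extend _).trans (Homotopy.ofEq (HomologicalComplex.extendMap_id _ _)))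

lemma homExact_of_homotopyEquiv (e : HomotopyEquiv X X') {a : ℤ} (h : HomExact X' N a) :
    HomExact X N a := by
  intro f hf
  obtain ⟨r, hr⟩ := h (e.inv.f a ≫ f) (by
    rw [← Category.assoc, ← e.inv.comm, Category.assoc, hf, Limits.comp_zero])
  have hk := e.homotopyHomInvId.comm a
  rw [prevD_eq _ (show (ComplexShape.up ℤ).Rel (a - 1) a from sub_add_cancel a 1),
    dNext_eq _ (show (ComplexShape.up ℤ).Rel a (a + 1) from rfl)] at hk
  simp only [HomologicalComplex.comp_f, HomologicalComplex.id_f] at hk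
  refine ⟨e.hom.f (a + 1) ≫ r - e.homotopyHomInvId.hom (a + 1) a ≫ f, ?_⟩
  have h1 := congrArg (fun g => g ≫ f) hk
  simp only [Preadditive.add_comp, Category.assoc, Category.id_comp, hf, Limits.comp_zero,
    add_zero, hr] at h1
  rw [Preadditive.comp_sub, ← Category.assoc, ← e.hom.comm, Category.assoc, h1]
  abel

/-- `Ext` does not depend on the projective resolution. -/
lemma homExact_resolution_iff (P P' : ProjectiveResolution M) (a : ℤ) :
    HomExact P.cochainComplex N a ↔ HomExact P'.cochainComplex N a :=
  ⟨homExact_of_homotopyEquiv (extendHomotopyEquiv (P'.homotopyEquiv P)),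
    homExact_of_homotopyEquiv (extendHomotopyEquiv (P.homotopyEquiv P'))⟩

lemma IsTotallyAcyclic.projective (hX : IsTotallyAcyclic X) (n : ℤ) : Module.Projective A (X.X n) :=
  have := hX.free n
  inferInstance

/-- Complete resolutions of the same module have the same cohomology with coefficients in a
module, in all degrees that are large enough. -/
lemma IsCompleteResolution.homExact_iff (hX : IsCompleteResolution X M)
    (hX' : IsCompleteResolution X' M) :
    ∃ m : ℤ, ∀ N : ModuleCat.{u} A, ∀ a < m, HomExact X N a ↔ HomExact X' N a := by
  obtain ⟨-, P, i, ⟨e⟩⟩ := hX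
  obtain ⟨-, P', i', ⟨e'⟩⟩ := hX'
  refine ⟨min (-i - 1) (-i' - 1), fun N a ha => ?_⟩
  have h1 : a < -i - 1 := ha.trans_le (min_le_left _ _)
  have h2 : a < -i' - 1 := ha.trans_le (min_le_right _ _)
  have h3 : HomExact X N a ↔ HomExact P.cochainComplex N a :=
    ⟨(truncRetract_of_truncGT e.symm).homExact h1, (truncRetract_of_truncGT e).homExact h1⟩
  have h4 : HomExact X' N a ↔ HomExact P'.cochainComplex N a :=
    ⟨(truncRetract_of_truncGT e'.symm).homExact h2, (truncRetract_of_truncGT e').homExact h2⟩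
  rw [h3, h4, homExact_resolution_iff P P']

/-- The Tate cohomology of a complete resolution `Y` of `N` can be computed with `N` in place
of `Y`. -/
lemma IsCompleteResolution.subsingleton_KHom_iff (hX : IsTotallyAcyclic X)
    (hY : IsCompleteResolution Y N) (i : ℤ) :
    Subsingleton (KHom X Y i) ↔ HomExact X N (-i) := by
  have := hX.projective
  have := hY.1.projective
  obtain ⟨hYt, P, j, ⟨e⟩⟩ := hY
  have := projective_cochainComplex P
  have hXY : ∀ a b, HomExact X (Y.X b) a := fun a b => hX.homExact _ a
  have hXP : ∀ a b, HomExact X (P.cochainComplex.X b) a := fun a b => hX.homExact _ a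
  obtain ⟨p, hp, hpP⟩ := exists_cokernel_cochainComplex P
  -- `Y` and `P` agree at the spot `b`; dimension shifting leads from `b` to degree `0`.
  let b := min (-j - 1) 0
  have h1 : Subsingleton (KHom X Y i) ↔ CokerExact X Y (b - i) b :=
    TotallyAcyclic.subsingleton_KHom_iff (elemExact_of_acyclic hYt.acyclic) hXY (by lia)
  have h2 : CokerExact X Y (b - i) b ↔ CokerExact X P.cochainComplex (b - i) b :=
    ⟨(truncRetract_of_truncGT e.symm).cokerExact (min_le_left _ _) (hXP _ _),
      (truncRetract_of_truncGT e).cokerExact (min_le_left _ _) (hXY _ _)⟩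
  have h3 : ∀ n : ℕ, CokerExact X P.cochainComplex (-n - i) (-n) ↔
      CokerExact X P.cochainComplex (-i) 0 := by
    intro n
    induction n with
    | zero => simp
    | succ n ih =>
      rw [← ih]
      push_cast
      exact cokerExact_iff_succ (by lia) (by lia) (elemExact_cochainComplex P (by lia))
        (fun a => hXP a _)
  obtain ⟨n, hn⟩ : ∃ n : ℕ, b = -n := Int.exists_eq_neg_ofNat (min_le_right _ _)
  rw [h1, h2, hn, h3, cokerExact_iff_homExact p hp hpP]

end

end TotallyAcyclic

/-! ### Sequences of matrices that are complexes modulo an ideal -/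

namespace TotallyAcyclic

open Matrix

section Vectors

variable {Q : Type u} [CommRing Q] {m n : Type*} [Fintype n] {J : Ideal Q}

lemma mulVec_mem {M : Matrix m n Q} {v : n → Q} {i : m} (h : ∀ j, M i j * v j ∈ J) :
    (M *ᵥ v) i ∈ J :=
  sum_mem fun j _ => h j

lemma vecMul_mem {M : Matrix n m Q} {v : n → Q} {i : m} (h : ∀ j, v j * M j i ∈ J) :
    (v ᵥ* M) i ∈ J :=
  sum_mem fun j _ => h j

end Vectors

/-- A sequence of matrices over `Q` with composable sizes, seen as a sequence of finitely generated
free `Q`-modules `Q^(ι n)` and homomorphisms that raise the degree by one. The composites of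
consecutive matrices need not vanish. -/
structure MatSeq (Q : Type u) where
  ι : ℤ → Type
  fintype (n : ℤ) : Fintype (ι n)
  decidableEq (n : ℤ) : DecidableEq (ι n)
  d (n : ℤ) : Matrix (ι (n + 1)) (ι n) Q

attribute [instance] MatSeq.fintype MatSeq.decidableEq

namespace MatSeq

variable {Q : Type u} [CommRing Q] (P : MatSeq Q)

/-- The sequence becomes a complex modulo `J`. -/
def IsComplexMod (J : Ideal Q) : Prop :=
  ∀ n i j, (P.d (n + 1) * P.d n) i j ∈ J

/-- A family of matrices, of any degree, maps the span of the basis elements outside of `S` into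
itself. -/
def Triangular {ι κ : Type*} (S : ι → Prop) (T : κ → Prop) (M : Matrix κ ι Q) : Prop :=
  ∀ i j, T i → ¬ S j → M i j = 0

/-- Exactness modulo `J`, in degree `n + 1`, of the quotient of the sequence by the span of the
basis elements outside of `S`. -/
def ExactMod (S : ∀ n, P.ι n → Prop) (J : Ideal Q) (n : ℤ) : Prop :=
  ∀ v : P.ι (n + 1) → Q, (∀ i, S _ i → (P.d (n + 1) *ᵥ v) i ∈ J) →
    ∃ u : P.ι n → Q, ∀ i, S _ i → (v - P.d n *ᵥ u) i ∈ J

/-- Exactness modulo `J`, in degree `n + 1`, of the dual sequence. -/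
def DualExactMod (J : Ideal Q) (n : ℤ) : Prop :=
  ∀ v : P.ι (n + 1) → Q, (∀ j, (v ᵥ* P.d n) j ∈ J) →
    ∃ u : P.ι (n + 1 + 1) → Q, ∀ j, (v - u ᵥ* P.d (n + 1)) j ∈ J

variable (x : Q) (t : ∀ n, Matrix (P.ι (n + 1 + 1)) (P.ι n) Q)

/-- If `d² = x t`, then `[[d, x], [-t, -d]]` squares to zero; this sequence of matrices is a lift
to `Q/J` of the mapping cone of `t`. -/
def step : MatSeq Q where
  ι n := P.ι n ⊕ P.ι (n + 1)
  fintype _ := inferInstance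
  decidableEq _ := inferInstance
  d n := fromBlocks (P.d n) (x • 1) (-t n) (-P.d (n + 1))

/-- The set of basis elements of `P.step x t` that come from `S`. -/
def stepSet (S : ∀ n, P.ι n → Prop) (n : ℤ) : (P.step x t).ι n → Prop :=
  Sum.elim (S n) (S (n + 1))

variable {P x t} {J : Ideal Q} {S : ∀ n, P.ι n → Prop}

lemma triangular_stepSet (hd : ∀ n, Triangular (S n) (S (n + 1)) (P.d n))
    (ht : ∀ n, Triangular (S n) (S (n + 1 + 1)) (t n)) (n : ℤ) :
    Triangular (P.stepSet x t S n) (P.stepSet x t S (n + 1)) ((P.step x t).d n) := by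
  rintro (i | i) (j | j) hi hj
  · exact hd n i j hi hj
  · have : i ≠ j := fun h => hj (h ▸ hi)
    simp [step, this]
  · simpa [step] using ht n i j hi hj
  · simpa [step] using hd (n + 1) i j hi hj

section

variable (hx : ∀ r, x * r ∈ J → r ∈ J)
  (ht : ∀ n i j, (P.d (n + 1) * P.d n - x • t n) i j ∈ J)
include hx ht

/-- The entry in the lower left corner of the square is `d t - t d`, which vanishes modulo `J`
because `x (d t - t d) = d³ - d³` does and `x` is a nonzerodivisor modulo `J`. -/
lemma isComplexMod_step : (P.step x t).IsComplexMod J := by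
  intro n
  have key : ∀ i j, (P.d (n + 1 + 1) * t n - t (n + 1) * P.d n) i j ∈ J := by
    intro i j
    apply hx
    have h : x • (P.d (n + 1 + 1) * t n - t (n + 1) * P.d n) =
        (P.d (n + 1 + 1) * P.d (n + 1) - x • t (n + 1)) * P.d n -
          P.d (n + 1 + 1) * (P.d (n + 1) * P.d n - x • t n) := by
      simp only [Matrix.sub_mul, Matrix.mul_sub, smul_sub, Matrix.mul_assoc, Matrix.mul_smul,
        Matrix.smul_mul]
      abel
    rw [← smul_eq_mul, ← Matrix.smul_apply, h]
    exact sub_mem (sum_mem fun k _ => J.mul_mem_right _ (ht _ _ _))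
      (sum_mem fun k _ => J.mul_mem_left _ (ht _ _ _))
  have h : (P.step x t).d (n + 1) * (P.step x t).d n =
      fromBlocks (P.d (n + 1) * P.d n - x • t n) 0
        (P.d (n + 1 + 1) * t n - t (n + 1) * P.d n)
        (P.d (n + 1 + 1) * P.d (n + 1) - x • t (n + 1)) := by
    refine (fromBlocks_multiply _ _ _ _ _ _ _ _).trans ?_
    congr 1
    · simp [sub_eq_add_neg]
    · simp
    · simp [sub_eq_add_neg, add_comm]
    · simp [sub_eq_add_neg, add_comm]
  rw [h]
  rintro (i | i) (j | j)
  · exact ht _ _ _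
  · exact J.zero_mem
  · exact key _ _
  · exact ht _ _ _

/-- If the sequence is exact modulo `J + (x)`, then the step is exact modulo `J`: for a cycle
`(v₁, v₂)`, exactness gives `v₁ = d w + x z`, and cancelling `x` from `d v₁ + x v₂ = 0` shows
`v₂ = -t w - d z`. -/
lemma exactMod_step (hd : ∀ n, Triangular (S n) (S (n + 1)) (P.d n)) {n : ℤ}
    (h : P.ExactMod S (J ⊔ Ideal.span {x}) n) : (P.step x t).ExactMod (P.stepSet x t S) J n := by
  intro v hv
  let v₁ : P.ι (n + 1) → Q := fun i => v (Sum.inl i)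
  let v₂ : P.ι (n + 1 + 1) → Q := fun i => v (Sum.inr i)
  have hv₁ : ∀ i, S _ i → (P.d (n + 1) *ᵥ v₁ + x • v₂) i ∈ J := fun i hi => by
    have h2 := hv (Sum.inl i) hi
    have h3 : ((P.step x t).d (n + 1) *ᵥ v) (Sum.inl i) = (P.d (n + 1) *ᵥ v₁ + x • v₂) i := by
      have := congrFun (fromBlocks_mulVec (P.d (n + 1)) (x • 1) (-t (n + 1)) (-P.d (n + 1 + 1)) v)
        (Sum.inl i)
      refine this.trans ?_
      simp only [Sum.elim_inl, Pi.add_apply, Matrix.smul_mulVec, Matrix.one_mulVec]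
      rfl
    rwa [h3] at h2
  obtain ⟨w, hw⟩ := h v₁ (fun i hi => by
    have h1 : (P.d (n + 1) *ᵥ v₁) i = (P.d (n + 1) *ᵥ v₁ + x • v₂) i - x * v₂ i := by simp
    rw [h1]
    exact sub_mem (Ideal.mem_sup_left (hv₁ i hi))
      (Ideal.mem_sup_right (Ideal.mul_mem_right _ _ (Ideal.mem_span_singleton_self x))))
  have hz : ∀ i, ∃ z, S _ i → (v₁ - P.d n *ᵥ w) i - x * z ∈ J := fun i => by
    by_cases hi : S _ i
    · obtain ⟨y, hy, z', hz', hyz⟩ := Submodule.mem_sup.1 (hw i hi)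
      obtain ⟨z, rfl⟩ := Ideal.mem_span_singleton'.1 hz'
      exact ⟨z, fun _ => by rw [← hyz, mul_comm x, add_sub_cancel_right]; exact hy⟩
    · exact ⟨0, fun h => absurd h hi⟩
  choose z hz using hz
  refine ⟨Sum.elim w z, ?_⟩
  have hdw : (P.step x t).d n *ᵥ Sum.elim w z =
      Sum.elim (P.d n *ᵥ w + x • z) (-(t n *ᵥ w) - P.d (n + 1) *ᵥ z) := by
    refine (fromBlocks_mulVec _ _ _ _ _).trans ?_
    congr 1
    · simp [Function.comp_def, Matrix.smul_mulVec]
    · simp [Function.comp_def, neg_mulVec, sub_eq_add_neg]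
  rw [hdw]
  rintro (i | i) hi
  · have := hz i hi
    rwa [Pi.sub_apply, sub_sub] at this
  · apply hx
    change x * (v (Sum.inr i) - (-(t n *ᵥ w) - P.d (n + 1) *ᵥ z) i) ∈ J
    have h1 : x * (v (Sum.inr i) - (-(t n *ᵥ w) - P.d (n + 1) *ᵥ z) i)
        = (P.d (n + 1) *ᵥ v₁ + x • v₂) i - (P.d (n + 1) *ᵥ (v₁ - P.d n *ᵥ w - x • z)) i -
          ((P.d (n + 1) * P.d n - x • t n) *ᵥ w) i := by
      simp only [Matrix.mulVec_sub, Matrix.sub_mulVec, Matrix.mulVec_mulVec, Matrix.mulVec_smul,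
        Matrix.smul_mulVec, Pi.sub_apply, Pi.add_apply, Pi.smul_apply, Pi.neg_apply, smul_eq_mul,
        v₂]
      ring
    rw [h1]
    refine sub_mem (sub_mem (hv₁ i hi) (mulVec_mem fun j => ?_))
      (mulVec_mem fun j => J.mul_mem_right _ (ht _ _ _))
    by_cases hj : S _ j
    · exact J.mul_mem_left _ (hz j hj)
    · rw [hd _ i j hi hj, zero_mul]
      exact J.zero_mem

/-- The dual statement to `exactMod_step`. -/
lemma dualExactMod_step {n : ℤ} (h : P.DualExactMod (J ⊔ Ideal.span {x}) (n + 1)) :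
    (P.step x t).DualExactMod J n := by
  intro v hv
  let α : P.ι (n + 1) → Q := fun i => v (Sum.inl i)
  let β : P.ι (n + 1 + 1) → Q := fun i => v (Sum.inr i)
  have hv₂ : ∀ j, (x • α - β ᵥ* P.d (n + 1)) j ∈ J := fun j => by
    have h2 := hv (Sum.inr j)
    have h3 : (v ᵥ* (P.step x t).d n) (Sum.inr j) = (x • α - β ᵥ* P.d (n + 1)) j := by
      have := congrFun (vecMul_fromBlocks (P.d n) (x • 1) (-t n) (-P.d (n + 1)) v) (Sum.inr j)
      refine this.trans ?_
      simp only [Sum.elim_inr, Matrix.vecMul_smul, Matrix.vecMul_one,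
        Matrix.vecMul_neg, Pi.sub_apply, ← sub_eq_add_neg]
      rfl
    rwa [h3] at h2
  obtain ⟨γ, hγ⟩ := h β (fun j => by
    have h1 : (β ᵥ* P.d (n + 1)) j = x * α j - (x • α - β ᵥ* P.d (n + 1)) j := by simp
    rw [h1]
    exact sub_mem (Ideal.mem_sup_right (Ideal.mul_mem_right _ _ (Ideal.mem_span_singleton_self x)))
      (Ideal.mem_sup_left (hv₂ j)))
  have hz : ∀ i, ∃ z, (β - γ ᵥ* P.d (n + 1 + 1)) i - x * z ∈ J := fun i => by
    obtain ⟨y, hy, z', hz', hyz⟩ := Submodule.mem_sup.1 (hγ i)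
    obtain ⟨z, rfl⟩ := Ideal.mem_span_singleton'.1 hz'
    exact ⟨z, by rw [← hyz, mul_comm x, add_sub_cancel_right]; exact hy⟩
  choose z hz using hz
  refine ⟨Sum.elim z (-γ), ?_⟩
  have hdw : Sum.elim z (-γ) ᵥ* (P.step x t).d (n + 1) =
      Sum.elim (z ᵥ* P.d (n + 1) + γ ᵥ* t (n + 1)) (x • z + γ ᵥ* P.d (n + 1 + 1)) := by
    refine (vecMul_fromBlocks _ _ _ _ _).trans ?_
    congr 1
    · change z ᵥ* _ + (-γ) ᵥ* _ = _
      simp [Matrix.neg_vecMul, Matrix.vecMul_neg]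
    · change z ᵥ* _ + (-γ) ᵥ* _ = _
      simp [Matrix.neg_vecMul, Matrix.vecMul_neg, Matrix.vecMul_smul]
  intro j
  refine (congrArg (fun y => v j - y ∈ J) (congrFun hdw j)).mpr ?_
  revert j
  rintro (j | j)
  · apply hx
    change x * (v (Sum.inl j) - (z ᵥ* P.d (n + 1) + γ ᵥ* t (n + 1)) j) ∈ J
    have h1 : x * (v (Sum.inl j) - (z ᵥ* P.d (n + 1) + γ ᵥ* t (n + 1)) j)
        = (x • α - β ᵥ* P.d (n + 1)) j +
          ((β - γ ᵥ* P.d (n + 1 + 1) - x • z) ᵥ* P.d (n + 1)) j +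
          (γ ᵥ* (P.d (n + 1 + 1) * P.d (n + 1) - x • t (n + 1))) j := by
      simp only [Matrix.vecMul_sub, Matrix.sub_vecMul, Matrix.vecMul_vecMul, Matrix.smul_vecMul,
        Matrix.vecMul_smul, Pi.sub_apply, Pi.add_apply, Pi.smul_apply, smul_eq_mul, α]
      ring
    rw [h1]
    exact add_mem (add_mem (hv₂ j) (vecMul_mem fun k => J.mul_mem_right _ (hz k)))
      (vecMul_mem fun k => J.mul_mem_left _ (ht _ _ _))
  · have := hz j
    rwa [Pi.sub_apply, sub_sub, add_comm] at this

end

end MatSeq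

end TotallyAcyclic

/-! ### Complexes over quotients of `Q` realized by matrices over `Q` -/

namespace TotallyAcyclic

open Matrix

variable {Q : Type u} [CommRing Q] {A : Type u} [CommRing A]

/-- A realization over `A`, along `φ : Q →+* A`, of a sequence of matrices over `Q`: bases of the
modules of the complex `K` of `A`-modules for which the differentials are given by the matrices. -/
structure Realization (φ : Q →+* A) (P : MatSeq Q)
    (K : CochainComplex (ModuleCat.{u} A) ℤ) where
  basis (n : ℤ) : Module.Basis (P.ι n) A (K.X n)
  d_eq (n : ℤ) :
    (K.d n (n + 1)).hom = Matrix.toLin (basis n) (basis (n + 1)) ((P.d n).map φ)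

/-- The matrix of the differential from degree `p` to degree `q`, zero unless `p + 1 = q`. -/
def MatSeq.dd (P : MatSeq Q) (p q : ℤ) : Matrix (P.ι q) (P.ι p) Q :=
  if h : p + 1 = q then h ▸ P.d p else 0

lemma MatSeq.dd_succ (P : MatSeq Q) (p : ℤ) : P.dd p (p + 1) = P.d p := by
  simp [MatSeq.dd]

namespace Realization

variable {φ : Q →+* A} {P P' P'' : MatSeq Q} {K K' K'' : CochainComplex (ModuleCat.{u} A) ℤ}
  (r : Realization φ P K) (r' : Realization φ P' K') (r'' : Realization φ P'' K'')

/-- The map between modules of realized complexes given by a matrix over `Q`. -/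
def hom {p q : ℤ} (M : Matrix (P'.ι q) (P.ι p) Q) : K.X p ⟶ K'.X q :=
  ModuleCat.ofHom (Matrix.toLin (r.basis p) (r'.basis q) (M.map φ))

lemma hom_comp {p q s : ℤ} (M : Matrix (P'.ι q) (P.ι p) Q) (N : Matrix (P''.ι s) (P'.ι q) Q) :
    r.hom r' M ≫ r'.hom r'' N = r.hom r'' (N * M) := by
  rw [hom, hom, hom, ← ModuleCat.ofHom_comp, Matrix.map_mul,
    Matrix.toLin_mul (r.basis p) (r'.basis q) (r''.basis s)]

lemma hom_zero {p q : ℤ} : r.hom r' (0 : Matrix (P'.ι q) (P.ι p) Q) = 0 := by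
  ext1; simp [hom]

lemma hom_one {p : ℤ} : r.hom r (1 : Matrix (P.ι p) (P.ι p) Q) = 𝟙 _ := by
  ext1; simp [hom, Matrix.map_one]

lemma hom_add {p q : ℤ} (M N : Matrix (P'.ι q) (P.ι p) Q) :
    r.hom r' (M + N) = r.hom r' M + r.hom r' N := by
  ext1; simp [hom, Matrix.map_add]

lemma hom_neg {p q : ℤ} (M : Matrix (P'.ι q) (P.ι p) Q) :
    r.hom r' (-M) = -r.hom r' M := by
  rw [eq_neg_iff_add_eq_zero, ← hom_add, neg_add_cancel, hom_zero]

lemma hom_sub {p q : ℤ} (M N : Matrix (P'.ι q) (P.ι p) Q) :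
    r.hom r' (M - N) = r.hom r' M - r.hom r' N := by
  rw [sub_eq_add_neg, hom_add, hom_neg, sub_eq_add_neg]

lemma hom_smul {p q : ℤ} (x : Q) (M : Matrix (P'.ι q) (P.ι p) Q) :
    r.hom r' (x • M) = φ x • r.hom r' M := by
  ext1
  simp only [hom, ModuleCat.hom_ofHom, ModuleCat.hom_smul]
  rw [← map_smul]
  congr 1
  ext i j
  simp

lemma hom_eq_zero_iff {p q : ℤ} (M : Matrix (P'.ι q) (P.ι p) Q) :
    r.hom r' M = 0 ↔ ∀ i j, M i j ∈ RingHom.ker φ := by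
  rw [ModuleCat.hom_ext_iff]
  simp only [hom, ModuleCat.hom_ofHom, ModuleCat.hom_zero, LinearEquiv.map_eq_zero_iff]
  rw [← Matrix.ext_iff]
  simp [RingHom.mem_ker]

lemma hom_surjective (hφ : Function.Surjective φ) {p q : ℤ} (f : K.X p ⟶ K'.X q) :
    ∃ M : Matrix (P'.ι q) (P.ι p) Q, r.hom r' M = f := by
  choose g hg using hφ
  refine ⟨(LinearMap.toMatrix (r.basis p) (r'.basis q) f.hom).map g, ?_⟩
  have : ((LinearMap.toMatrix (r.basis p) (r'.basis q) f.hom).map g).map φ =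
      LinearMap.toMatrix (r.basis p) (r'.basis q) f.hom := by
    ext i j; simp [hg]
  rw [hom, this, Matrix.toLin_toMatrix, ModuleCat.ofHom_hom]

lemma d_succ (n : ℤ) : K.d n (n + 1) = r.hom r (P.d n) := by
  ext1; exact r.d_eq n

lemma hom_dd (p q : ℤ) : r.hom r (P.dd p q) = K.d p q := by
  by_cases h : p + 1 = q
  · subst h
    rw [MatSeq.dd_succ, r.d_succ]
  · rw [MatSeq.dd, dif_neg h, hom_zero, K.shape _ _ (by simpa using h)]

include r in
lemma isComplexMod : P.IsComplexMod (RingHom.ker φ) := fun n => by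
  refine (hom_eq_zero_iff r r _).1 ?_
  rw [← hom_comp r r r, ← d_succ, ← d_succ, K.d_comp_d]

end Realization

namespace MatSeq

variable (φ : Q →+* A) (P : MatSeq Q)

/-- The complex over `A` realizing a sequence of matrices. -/
def cplx (h : P.IsComplexMod (RingHom.ker φ)) : CochainComplex (ModuleCat.{u} A) ℤ where
  X n := ModuleCat.of A (P.ι n → A)
  d p q := ModuleCat.ofHom (Matrix.toLin' ((P.dd p q).map φ))
  shape p q hpq := by
    have : P.dd p q = 0 := dif_neg hpq
    ext1; simp [this]
  d_comp_d' p q r hpq hqr := by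
    obtain rfl : p + 1 = q := hpq
    obtain rfl : p + 1 + 1 = r := hqr
    rw [← ModuleCat.ofHom_comp, ← Matrix.toLin'_mul, ← Matrix.map_mul, dd_succ, dd_succ]
    have : (P.d (p + 1) * P.d p).map φ = 0 := by
      ext i j
      exact h p i j
    rw [this, map_zero, ModuleCat.ofHom_zero]

/-- The standard bases. -/
def realization (h : P.IsComplexMod (RingHom.ker φ)) : Realization φ P (P.cplx φ h) where
  basis n := Pi.basisFun A (P.ι n)
  d_eq n := by
    change Matrix.toLin' ((P.dd n (n + 1)).map φ) = _
    rw [dd_succ]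
    rfl

end MatSeq

namespace Realization

variable {φ : Q →+* A} {P : MatSeq Q} {K : CochainComplex (ModuleCat.{u} A) ℤ}
  (r : Realization φ P K)

/-- The element with the given coordinates. -/
def vec {n : ℤ} (v : P.ι n → Q) : K.X n :=
  (r.basis n).equivFun.symm fun i => φ (v i)

/-- The linear form with the given coordinates. -/
def covec {n : ℤ} (v : P.ι n → Q) : Module.Dual A (K.X n) :=
  (r.basis n).constr A fun i => φ (v i)

lemma d_vec {n : ℤ} (v : P.ι n → Q) : (K.d n (n + 1)).hom (r.vec v) = r.vec (P.d n *ᵥ v) := by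
  have h := LinearMap.toMatrix_mulVec_repr (r.basis n) (r.basis (n + 1)) (K.d n (n + 1)).hom
    (r.vec v)
  apply (r.basis (n + 1)).equivFun.injective
  ext i
  rw [Module.Basis.equivFun_apply, ← h, r.d_eq, LinearMap.toMatrix_toLin, vec, vec,
    LinearEquiv.apply_symm_apply, ← Module.Basis.equivFun_apply, LinearEquiv.apply_symm_apply,
    RingHom.map_mulVec]
  rfl

lemma covec_comp_d {n : ℤ} (v : P.ι (n + 1) → Q) :
    (K.d n (n + 1)).hom.dualMap (r.covec v) = r.covec (v ᵥ* P.d n) := by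
  refine (r.basis n).ext fun j => ?_
  rw [LinearMap.dualMap_apply, r.d_eq, Matrix.toLin_self, covec, covec,
    Module.Basis.constr_basis, map_sum]
  simp [Matrix.vecMul, dotProduct, mul_comm]

lemma vec_sub {n : ℤ} (v w : P.ι n → Q) : r.vec (v - w) = r.vec v - r.vec w := by
  rw [vec, vec, vec, ← map_sub]
  congr 1
  ext i
  simp

lemma covec_sub {n : ℤ} (v w : P.ι n → Q) : r.covec (v - w) = r.covec v - r.covec w := by
  rw [covec, covec, covec, ← map_sub]
  congr 1
  ext i
  simp

lemma vec_eq_zero_iff {n : ℤ} (v : P.ι n → Q) : r.vec v = 0 ↔ ∀ i, v i ∈ RingHom.ker φ := by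
  rw [vec, LinearEquiv.map_eq_zero_iff, funext_iff]
  rfl

lemma covec_eq_zero_iff {n : ℤ} (v : P.ι n → Q) : r.covec v = 0 ↔ ∀ i, v i ∈ RingHom.ker φ := by
  rw [covec, LinearEquiv.map_eq_zero_iff, funext_iff]
  rfl

variable (hφ : Function.Surjective φ)
include hφ

lemma vec_surjective {n : ℤ} (x : K.X n) : ∃ v, r.vec v = x := by
  choose g hg using hφ
  refine ⟨fun i => g ((r.basis n).equivFun x i), ?_⟩
  simp [vec, hg]

lemma covec_surjective {n : ℤ} (x : Module.Dual A (K.X n)) : ∃ v, r.covec v = x := by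
  choose g hg using hφ
  refine ⟨fun i => g (x (r.basis n i)), (r.basis n).ext fun i => ?_⟩
  simp [covec, hg]

include r

lemma exactMod_iff (n : ℤ) :
    P.ExactMod (fun _ _ => True) (RingHom.ker φ) n ↔ ElemExact K (n + 1) := by
  constructor
  · rintro h a b ha rfl y hy
    obtain rfl : a = n := by lia
    obtain ⟨v, rfl⟩ := r.vec_surjective hφ y
    obtain ⟨u, hu⟩ := h v fun i _ => by
      rw [r.d_vec, vec_eq_zero_iff] at hy
      exact hy i
    refine ⟨r.vec u, ?_⟩
    rw [r.d_vec, eq_comm, ← sub_eq_zero, ← vec_sub, vec_eq_zero_iff]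
    exact fun i => hu i trivial
  · intro h v hv
    obtain ⟨y, hy⟩ := h n (n + 1 + 1) rfl rfl (r.vec v) (by
      rw [r.d_vec, vec_eq_zero_iff]
      exact fun i => hv i trivial)
    obtain ⟨u, rfl⟩ := r.vec_surjective hφ y
    refine ⟨u, fun i _ => (r.vec_eq_zero_iff _).1 ?_ i⟩
    rw [vec_sub, ← r.d_vec, sub_eq_zero]
    exact hy.symm

lemma dualExactMod_iff (n : ℤ) : P.DualExactMod (RingHom.ker φ) n ↔
    Function.Exact (K.d (n + 1) (n + 1 + 1)).hom.dualMap (K.d n (n + 1)).hom.dualMap := by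
  constructor
  · refine fun h y => ⟨fun hy => ?_, ?_⟩
    · obtain ⟨v, rfl⟩ := r.covec_surjective hφ y
      obtain ⟨u, hu⟩ := h v fun i => by
        rw [r.covec_comp_d, covec_eq_zero_iff] at hy
        exact hy i
      refine ⟨r.covec u, ?_⟩
      rw [r.covec_comp_d, eq_comm, ← sub_eq_zero, ← covec_sub, covec_eq_zero_iff]
      exact hu
    · rintro ⟨y, rfl⟩
      ext x
      have h0 : (K.d (n + 1) (n + 1 + 1)).hom ((K.d n (n + 1)).hom x) = 0 := by
        rw [← LinearMap.comp_apply, ← ModuleCat.hom_comp, K.d_comp_d]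
        rfl
      simp only [LinearMap.dualMap_apply, LinearMap.zero_apply, h0, map_zero]
  · intro h v hv
    obtain ⟨y, hy⟩ := (h (r.covec v)).1 (by
      rw [r.covec_comp_d, covec_eq_zero_iff]
      exact hv)
    obtain ⟨u, rfl⟩ := r.covec_surjective hφ y
    refine ⟨u, ?_⟩
    rw [← covec_eq_zero_iff r, covec_sub, ← r.covec_comp_d, sub_eq_zero]
    exact hy.symm

lemma isTotallyAcyclic_iff : IsTotallyAcyclic K ↔
    (∀ n, P.ExactMod (fun _ _ => True) (RingHom.ker φ) n) ∧
      ∀ n, P.DualExactMod (RingHom.ker φ) n := by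
  refine ⟨fun h => ⟨fun n => (r.exactMod_iff hφ n).2 (elemExact_of_acyclic h.acyclic _),
    fun n => (r.dualExactMod_iff hφ n).2 (h.dual_exact _ _ _ rfl rfl)⟩, fun ⟨h₁, h₂⟩ => ⟨fun n =>
    Module.Free.of_basis (r.basis n), fun n => Module.Finite.of_basis (r.basis n), fun n => ?_,
    ?_⟩⟩
  · rw [K.exactAt_iff' (n - 1) n (n + 1) (by simp) (by simp), ShortComplex.moduleCat_exact_iff]
    intro x hx
    have h := (r.exactMod_iff hφ (n - 1)).1 (h₁ (n - 1))
    rw [sub_add_cancel] at h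
    exact h (n - 1) (n + 1) (by lia) rfl x hx
  · rintro i j k rfl rfl
    exact (r.dualExactMod_iff hφ i).1 (h₂ i)

end Realization

end TotallyAcyclic

/-! ### Passing to a quotient by a regular element, and lifting relations -/

namespace TotallyAcyclic

open Matrix

namespace MatSeq

variable {Q : Type u} [CommRing Q] {P : MatSeq Q} {J : Ideal Q} {x : Q}

lemma exists_sub_mul_mem {ι : Type*} {v : ι → Q} (h : ∀ i, v i ∈ J ⊔ Ideal.span {x}) :
    ∃ z : ι → Q, ∀ i, v i - x * z i ∈ J := by
  have hz : ∀ i, ∃ z, v i - x * z ∈ J := fun i => by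
    obtain ⟨y, hy, z', hz', hyz⟩ := Submodule.mem_sup.1 (h i)
    obtain ⟨z, rfl⟩ := Ideal.mem_span_singleton'.1 hz'
    exact ⟨z, by rw [← hyz, mul_comm x, add_sub_cancel_right]; exact hy⟩
  choose z hz using hz
  exact ⟨z, hz⟩

lemma mul_mem_sup_span (a : Q) : x * a ∈ J ⊔ Ideal.span {x} :=
  Ideal.mem_sup_right (Ideal.mul_mem_right _ _ (Ideal.mem_span_singleton_self x))

variable (hx : ∀ r, x * r ∈ J → r ∈ J) (hJ : P.IsComplexMod J)
include hx hJ

/-- Exactness passes to the quotient by a nonzerodivisor: if `d v = x w`, then `w` is a cycle, hence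
`w = d u`, and `v - x u` is a cycle. -/
lemma exactMod_sup (h : ∀ n, P.ExactMod (fun _ _ => True) J n) (n : ℤ) :
    P.ExactMod (fun _ _ => True) (J ⊔ Ideal.span {x}) n := by
  intro v hv
  obtain ⟨w, hw⟩ := exists_sub_mul_mem fun i => hv i trivial
  obtain ⟨u, hu⟩ := h (n + 1) w fun i _ => hx _ (by
    have e : x * (P.d (n + 1 + 1) *ᵥ w) i =
        ((P.d (n + 1 + 1) * P.d (n + 1)) *ᵥ v) i -
          (P.d (n + 1 + 1) *ᵥ (P.d (n + 1) *ᵥ v - x • w)) i := by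
      simp only [← Matrix.mulVec_mulVec, Matrix.mulVec_sub, Matrix.mulVec_smul, Pi.sub_apply,
        Pi.smul_apply, smul_eq_mul]
      ring
    rw [e]
    exact sub_mem (mulVec_mem fun j => J.mul_mem_right _ (hJ _ _ _))
      (mulVec_mem fun j => J.mul_mem_left _ (hw j)))
  obtain ⟨y, hy⟩ := h n (v - x • u) fun i _ => by
    have e : (P.d (n + 1) *ᵥ (v - x • u)) i = ((P.d (n + 1) *ᵥ v) i - x * w i) +
        x * (w - P.d (n + 1) *ᵥ u) i := by
      simp only [Matrix.mulVec_sub, Matrix.mulVec_smul, Pi.sub_apply, Pi.smul_apply, smul_eq_mul]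
      ring
    rw [e]
    exact add_mem (hw i) (J.mul_mem_left _ (hu i trivial))
  refine ⟨y, fun i _ => ?_⟩
  have e : (v - P.d n *ᵥ y) i = (v - x • u - P.d n *ᵥ y) i + x * u i := by
    simp only [Pi.sub_apply, Pi.smul_apply, smul_eq_mul]
    ring
  rw [e]
  exact add_mem (Ideal.mem_sup_left (hy i trivial)) (mul_mem_sup_span _)

/-- The dual statement to `exactMod_sup`. -/
lemma dualExactMod_sup (h : ∀ n, P.DualExactMod J n) (n : ℤ) :
    P.DualExactMod (J ⊔ Ideal.span {x}) n := by
  obtain ⟨n, rfl⟩ : ∃ m, n = m + 1 := ⟨n - 1, by lia⟩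
  intro v hv
  obtain ⟨w, hw⟩ := exists_sub_mul_mem hv
  obtain ⟨u, hu⟩ := h n w fun i => hx _ (by
    have e : x * (w ᵥ* P.d n) i = (v ᵥ* (P.d (n + 1) * P.d n)) i -
          ((v ᵥ* P.d (n + 1) - x • w) ᵥ* P.d n) i := by
      simp only [← Matrix.vecMul_vecMul, Matrix.sub_vecMul, Matrix.smul_vecMul, Pi.sub_apply,
        Pi.smul_apply, smul_eq_mul]
      ring
    rw [e]
    exact sub_mem (vecMul_mem fun j => J.mul_mem_left _ (hJ _ _ _))
      (vecMul_mem fun j => J.mul_mem_right _ (hw j)))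
  obtain ⟨y, hy⟩ := h (n + 1) (v - x • u) fun i => by
    have e : ((v - x • u) ᵥ* P.d (n + 1)) i = ((v ᵥ* P.d (n + 1)) i - x * w i) +
        x * (w - u ᵥ* P.d (n + 1)) i := by
      simp only [Matrix.sub_vecMul, Matrix.smul_vecMul, Pi.sub_apply, Pi.smul_apply, smul_eq_mul]
      ring
    rw [e]
    exact add_mem (hw i) (J.mul_mem_left _ (hu i))
  refine ⟨y, fun i => ?_⟩
  have e : (v - y ᵥ* P.d (n + 1 + 1)) i = (v - x • u - y ᵥ* P.d (n + 1 + 1)) i + x * u i := by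
    simp only [Pi.sub_apply, Pi.smul_apply, smul_eq_mul]
    ring
  rw [e]
  exact add_mem (Ideal.mem_sup_left (hy i)) (mul_mem_sup_span _)

end MatSeq

namespace MatSeq

variable {Q : Type u} [CommRing Q] {P : MatSeq Q} {κ : Type*} [Fintype κ] [DecidableEq κ]

/-- If the composites of the matrices have entries in the ideal generated by the `g k` for
`k ∈ s`, then they can be written as `∑ gₖ Tₖ`, where `Tₖ = 0` for `k ∉ s`, and `Tₖ` has a nonzero
entry only where the composite has one. -/
lemma exists_lift_of_isComplexMod (g : κ → Q) (s : Finset κ)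
    (h : P.IsComplexMod (Ideal.span (g '' s))) :
    ∃ T : κ → ∀ p q, Matrix (P.ι q) (P.ι p) Q,
      (∀ n, P.d (n + 1) * P.d n = ∑ k, g k • T k n (n + 1 + 1)) ∧ (∀ k ∉ s, T k = 0) ∧
      ∀ k n i j, (P.d (n + 1) * P.d n) i j = 0 → T k n (n + 1 + 1) i j = 0 := by
  have key : ∀ n i j, ∃ y : κ → Q, (P.d (n + 1) * P.d n) i j = ∑ k, g k * y k ∧
      (∀ k ∉ s, y k = 0) ∧ ((P.d (n + 1) * P.d n) i j = 0 → y = 0) := fun n i j => by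
    by_cases h0 : (P.d (n + 1) * P.d n) i j = 0
    · exact ⟨0, by simp [h0], fun _ _ => rfl, fun _ => rfl⟩
    · obtain ⟨y, hy⟩ := (Submodule.mem_span_image_finset_iff_exists_fun Q).1 (h n i j)
      refine ⟨fun k => if hk : k ∈ s then y ⟨k, hk⟩ else 0, ?_, fun k hk => dif_neg hk,
        fun h => absurd h h0⟩
      rw [← hy, ← Finset.sum_subset (Finset.subset_univ s) fun k _ hk => by simp [hk],
        ← Finset.sum_coe_sort s]
      exact Finset.sum_congr rfl fun k _ => by simp [mul_comm]
  choose y hy₁ hy₂ hy₃ using key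
  refine ⟨fun k p q => if h : q = p + 1 + 1 then
    Matrix.of fun i j => y p (h ▸ i) j k else 0, fun n => ?_, fun k hk => ?_, fun k n i j h0 => ?_⟩
  · ext i j
    simp [hy₁, Matrix.sum_apply]
  · funext p q
    dsimp only
    split_ifs with h
    · subst h
      ext i j
      exact hy₂ _ _ _ k hk
    · rfl
  · simp [hy₃ n i j h0]

end MatSeq

end TotallyAcyclic

/-! ### The cone of an operator of degree two -/

namespace TotallyAcyclic

open CochainComplex.HomComplex

variable {A : Type u} [CommRing A] {K K' D : CochainComplex (ModuleCat.{u} A) ℤ}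

/-- The composite of two cocycles. -/
def cocycleComp {i j k : ℤ} (z : Cocycle K K' i) (w : Cocycle K' D j) (h : i + j = k) :
    Cocycle K D k :=
  Cocycle.mk (z.1.comp w.1 h) (k + 1) rfl (by
    rw [δ_comp z.1 w.1 h (i + 1) (j + 1) (k + 1) rfl rfl rfl, z.δ_eq_zero, w.δ_eq_zero]
    simp)

lemma cls_comp_cls {i j k : ℤ} (z : Cocycle K K' i) (w : Cocycle K' D j) (h : i + j = k) :
    (cls z).comp (cls w) ((add_comm j i).trans h) = cls (cocycleComp z w h) :=
  cls_comp z w _ _ rfl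

/-- The complex `K'` is `K ⊕ K[1]` as a sequence of modules, with the differential of the mapping
cocone of the cocycle `t : K ⟶ K[2]`. -/
structure Cocone (t : Cocycle K K 2) (K' : CochainComplex (ModuleCat.{u} A) ℤ) where
  inl : Cochain K K' 0
  inr : Cocycle K K' (-1)
  fst : Cocycle K' K 0
  snd : Cochain K' K 1
  inl_fst : inl.comp fst.1 (add_zero 0) = Cochain.ofHom (𝟙 K)
  inr_fst : inr.1.comp fst.1 (add_zero (-1)) = 0
  fst_inl_add_snd_inr : fst.1.comp inl (add_zero 0) + snd.comp inr.1 (add_neg_cancel 1) =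
    Cochain.ofHom (𝟙 K')
  δ_inl : δ 0 1 inl = -t.1.comp inr.1 (by norm_num)
  δ_snd : δ 1 2 snd = -fst.1.comp t.1 (by norm_num)

namespace Cocone

variable {t : Cocycle K K 2} (e : Cocone t K')
include e

/-- A class on `K` that vanishes on the cocone of `t` is a multiple of `t`. -/
lemma exists_eq_comp_of_fst_comp_eq_zero {i j : ℤ} (hj : j + 2 = i) (α : KHom K D i)
    (hα : (cls e.fst).comp α (add_zero i) = 0) :
    ∃ β : KHom K D j, α = (cls t).comp β hj := by
  obtain ⟨a, rfl⟩ := cls_surjective α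
  rw [cls_comp_cls e.fst a (zero_add i)] at hα
  obtain ⟨η, hη⟩ := (cls_eq_zero_iff _ (i - 1) (by lia)).1 hα
  replace hη : δ (i - 1) i η = e.fst.1.comp a.1 (zero_add i) := hη
  let β : Cocycle K D j := Cocycle.mk (e.inr.1.comp η (by lia)) (j + 1) rfl (by
    rw [δ_comp e.inr.1 η _ 0 i (j + 1) rfl (by lia) (by lia), hη, e.inr.δ_eq_zero,
      ← Cochain.comp_assoc _ _ _ (add_zero (-1)) (by lia) (by lia), e.inr_fst]
    simp)
  refine ⟨cls ((i - 1).negOnePow • β), ?_⟩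
  rw [cls_comp_cls t _ (by lia), ← sub_eq_zero, ← cls_sub, cls_eq_zero_iff _ (i - 1) (by lia)]
  refine ⟨e.inl.comp η (zero_add _), ?_⟩
  rw [δ_comp e.inl η _ 1 i i (by lia) rfl (by lia), hη, e.δ_inl,
    ← Cochain.comp_assoc _ _ _ (add_zero 0) (by lia) (by lia), e.inl_fst, Cochain.neg_comp,
    Cochain.comp_assoc _ _ _ _ (show -1 + (i - 1) = j by lia) (by lia), smul_neg,
    ← sub_eq_add_neg]
  simp [cocycleComp, β]

/-- A class on the cocone of `t` that vanishes on `K[1]` comes from `K`. -/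
lemma exists_eq_fst_comp_of_inr_comp_eq_zero {i j : ℤ} (hj : j + 1 = i) (γ : KHom K' D i)
    (hγ : (cls e.inr).comp γ (show i + -1 = j by lia) = 0) :
    ∃ ζ : KHom K D i, γ = (cls e.fst).comp ζ (add_zero i) := by
  obtain ⟨c, rfl⟩ := cls_surjective γ
  rw [cls_comp_cls e.inr c (show -1 + i = j by lia)] at hγ
  obtain ⟨κ, hκ⟩ := (cls_eq_zero_iff _ (j - 1) (by lia)).1 hγ
  replace hκ : δ (j - 1) j κ = e.inr.1.comp c.1 (by lia) := hκ
  let z : Cochain K D i := e.inl.comp c.1 (zero_add i) +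
    (j - 1).negOnePow • t.1.comp κ (by lia)
  have hδ : δ j i (e.snd.comp κ (by lia)) = c.1 - e.fst.1.comp z (zero_add i) := by
    rw [δ_comp e.snd κ _ 2 j i (by lia) rfl (by lia), hκ, e.δ_snd,
      ← Cochain.comp_assoc _ _ _ (add_neg_cancel 1) (by lia) (by lia),
      ← add_sub_cancel_left (e.fst.1.comp e.inl (add_zero 0)) (e.snd.comp e.inr.1 _),
      e.fst_inl_add_snd_inr]
    simp only [z, Cochain.sub_comp, Cochain.neg_comp, Cochain.comp_add, Cochain.id_comp,
      Cochain.comp_units_smul, smul_neg]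
    rw [Cochain.comp_assoc _ _ _ (add_zero 0) (zero_add i) (by lia),
      Cochain.comp_assoc _ _ _ (zero_add 2) (show 2 + (j - 1) = i by lia) (by lia)]
    abel
  have hz : e.fst.1.comp (δ i (i + 1) z) (zero_add (i + 1)) = 0 := by
    have h := congrArg (δ i (i + 1)) hδ
    rw [δ_δ, δ_sub, c.δ_eq_zero, δ_comp e.fst.1 z _ 1 (i + 1) (i + 1) rfl rfl rfl,
      e.fst.δ_eq_zero] at h
    simpa using h
  let ζ : Cocycle K D i := Cocycle.mk z (i + 1) rfl (by
    have h := congrArg (fun y => e.inl.comp y (zero_add (i + 1))) hz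
    rw [← Cochain.comp_assoc _ _ _ (add_zero 0) (by lia) (by lia), e.inl_fst] at h
    simpa using h)
  refine ⟨cls ζ, ?_⟩
  rw [cls_comp_cls e.fst _ (zero_add i), ← sub_eq_zero, ← cls_sub, cls_eq_zero_iff _ j hj]
  exact ⟨_, hδ⟩

end Cocone

end TotallyAcyclic

namespace TotallyAcyclic

open Matrix CochainComplex.HomComplex

variable {Q : Type u} [CommRing Q]

namespace MatSeq

variable (P : MatSeq Q) (x : Q) (t : ∀ n, Matrix (P.ι (n + 1 + 1)) (P.ι n) Q)

/-- The matrix of the inclusion of the first summand. -/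
def stepInl (p : ℤ) : Matrix ((P.step x t).ι p) (P.ι p) Q :=
  fromRows (1 : Matrix (P.ι p) (P.ι p) Q) 0

/-- The matrix of the inclusion of the second summand. -/
def stepInr (p : ℤ) : Matrix ((P.step x t).ι p) (P.ι (p + 1)) Q :=
  fromRows 0 (1 : Matrix (P.ι (p + 1)) (P.ι (p + 1)) Q)

/-- The matrix of the projection to the first summand. -/
def stepFst (p : ℤ) : Matrix (P.ι p) ((P.step x t).ι p) Q :=
  fromCols (1 : Matrix (P.ι p) (P.ι p) Q) 0

/-- The matrix of the projection to the second summand. -/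
def stepSnd (p : ℤ) : Matrix (P.ι (p + 1)) ((P.step x t).ι p) Q :=
  fromCols 0 (1 : Matrix (P.ι (p + 1)) (P.ι (p + 1)) Q)

lemma stepFst_mul_stepInl (p : ℤ) : P.stepFst x t p * P.stepInl x t p = 1 :=
  (fromCols_mul_fromRows _ _ _ _).trans (by simp)

lemma stepFst_mul_stepInr (p : ℤ) : P.stepFst x t p * P.stepInr x t p = 0 :=
  (fromCols_mul_fromRows _ _ _ _).trans (by simp)

lemma stepInl_mul_stepFst_add (p : ℤ) :
    P.stepInl x t p * P.stepFst x t p + P.stepInr x t p * P.stepSnd x t p = 1 := by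
  refine (congrArg₂ (· + ·) (fromRows_mul_fromCols _ _ _ _)
    (fromRows_mul_fromCols _ _ _ _)).trans ?_
  refine (fromBlocks_add _ _ _ _ _ _ _ _).trans ?_
  simp only [Matrix.mul_zero, Matrix.mul_one, add_zero, zero_add]
  exact fromBlocks_one

lemma step_d_mul_stepInl (p : ℤ) : (P.step x t).d p * P.stepInl x t p =
    P.stepInl x t (p + 1) * P.d p - P.stepInr x t (p + 1) * t p := by
  have h₁ : (P.step x t).d p * P.stepInl x t p = fromRows (P.d p) (-t p) :=
    (fromBlocks_mul_fromRows _ _ _ _ _ _).trans (by simp)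
  have h₂ : P.stepInl x t (p + 1) * P.d p = fromRows (P.d p) 0 :=
    (fromRows_mul _ _ _).trans (by simp)
  have h₃ : P.stepInr x t (p + 1) * t p = fromRows 0 (t p) :=
    (fromRows_mul _ _ _).trans (by simp)
  rw [h₁, h₂, h₃]
  ext (i | i) j
  · exact (sub_zero _).symm
  · exact (zero_sub _).symm

lemma step_d_mul_stepInr (p : ℤ) : (P.step x t).d p * P.stepInr x t p =
    x • P.stepInl x t (p + 1) - P.stepInr x t (p + 1) * P.d (p + 1) := by
  have h₁ : (P.step x t).d p * P.stepInr x t p = fromRows (x • 1) (-P.d (p + 1)) :=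
    (fromBlocks_mul_fromRows _ _ _ _ _ _).trans (by simp)
  have h₃ : P.stepInr x t (p + 1) * P.d (p + 1) = fromRows 0 (P.d (p + 1)) :=
    (fromRows_mul _ _ _).trans (by simp)
  rw [h₁, h₃]
  ext (i | i) j
  · exact (sub_zero _).symm
  · exact (zero_sub _).symm.trans (congrArg (· - _) (mul_zero x).symm)

lemma stepFst_mul_step_d (p : ℤ) : P.stepFst x t (p + 1) * (P.step x t).d p =
    P.d p * P.stepFst x t p + x • P.stepSnd x t p := by
  have h₁ : P.stepFst x t (p + 1) * (P.step x t).d p = fromCols (P.d p) (x • 1) :=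
    (fromCols_mul_fromBlocks _ _ _ _ _ _).trans (by simp)
  have h₃ : P.d p * P.stepFst x t p = fromCols (P.d p) 0 :=
    (mul_fromCols _ _ _).trans (by simp)
  rw [h₁, h₃]
  ext i (j | j)
  · exact (add_zero _).symm.trans (congrArg (_ + ·) (mul_zero x).symm)
  · exact (zero_add _).symm

lemma stepSnd_mul_step_d (p : ℤ) : P.stepSnd x t (p + 1) * (P.step x t).d p =
    -(t p * P.stepFst x t p) - P.d (p + 1) * P.stepSnd x t p := by
  have h₁ : P.stepSnd x t (p + 1) * (P.step x t).d p = fromCols (-t p) (-P.d (p + 1)) :=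
    (fromCols_mul_fromBlocks _ _ _ _ _ _).trans (by simp)
  have h₂ : t p * P.stepFst x t p = fromCols (t p) 0 :=
    (mul_fromCols _ _ _).trans (by simp)
  have h₃ : P.d (p + 1) * P.stepSnd x t p = fromCols 0 (P.d (p + 1)) :=
    (mul_fromCols _ _ _).trans (by simp)
  rw [h₁, h₂, h₃]
  ext i (j | j)
  · exact (sub_zero _).symm
  · exact (zero_sub _).symm.trans (congrArg (· - _) neg_zero.symm)

end MatSeq

variable {A : Type u} [CommRing A] {φ : Q →+* A} {P : MatSeq Q} {x : Q}
  {T : ∀ p q, Matrix (P.ι q) (P.ι p) Q} {K K' : CochainComplex (ModuleCat.{u} A) ℤ}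

/-- If `φ x = 0`, then the complex realizing `P.step x t` is the cocone of the cocycle realizing
`t`. -/
def stepCocone (r : Realization φ P K)
    (r' : Realization φ (P.step x fun n => T n (n + 1 + 1)) K') (hx : φ x = 0) (t : Cocycle K K 2)
    (ht : ∀ p q h, t.1.v p q h = r.hom r (T p q)) : Cocone t K' where
  inl := Cochain.ofHoms fun p => r.hom r' (P.stepInl _ _ p)
  inr := Cocycle.mk (Cochain.mk fun p q h =>
    (K.XIsoOfEq (show p = q + 1 by lia)).hom ≫ r.hom r' (P.stepInr _ _ q)) 0 (by norm_num) (by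
      ext1 p
      obtain ⟨p, rfl⟩ : ∃ s, p = s + 1 := ⟨p - 1, by lia⟩
      rw [δ_v (-1) 0 (by norm_num) _ _ _ _ p (p + 1 + 1) (by lia) rfl]
      simp only [Cochain.mk_v, HomologicalComplex.XIsoOfEq_rfl, Iso.refl_hom, Category.id_comp,
        Int.negOnePow_zero, one_smul, Cochain.zero_v]
      rw [r'.d_succ, r.d_succ, r.hom_comp r' r', r.hom_comp r r', P.step_d_mul_stepInr,
        r.hom_sub, r.hom_smul, hx, zero_smul, zero_sub, neg_add_cancel])
  fst := Cocycle.mk (Cochain.ofHoms fun p => r'.hom r (P.stepFst _ _ p)) 1 (by norm_num) (by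
    ext1 p q hpq
    subst hpq
    rw [δ_zero_cochain_v]
    simp only [Cochain.ofHoms_v, Cochain.zero_v]
    rw [r'.d_succ, r.d_succ, r'.hom_comp r r, r'.hom_comp r' r, P.stepFst_mul_step_d,
      r'.hom_add, r'.hom_smul, hx, zero_smul, add_zero, sub_self])
  snd := Cochain.mk fun p q h => r'.hom r (P.stepSnd _ _ p) ≫ (K.XIsoOfEq h).hom
  inl_fst := by
    ext1 p
    simp [Cocycle.mk, r.hom_comp r' r, P.stepFst_mul_stepInl, r.hom_one]
  inr_fst := by
    ext1 p q hpq
    obtain rfl : p = q + 1 := by lia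
    simp [Cocycle.mk, r.hom_comp r' r, P.stepFst_mul_stepInr, r.hom_zero]
  fst_inl_add_snd_inr := by
    ext1 p
    rw [Cochain.add_v, Cochain.comp_zero_cochain_v, Cochain.comp_v _ _ _ p (p + 1) p rfl (by lia)]
    simp only [Cocycle.mk, Cochain.ofHoms_v, Cochain.mk_v, HomologicalComplex.XIsoOfEq_rfl,
      Iso.refl_hom, Category.id_comp, Category.comp_id, Cochain.ofHom_v]
    rw [r'.hom_comp r r', r'.hom_comp r r', ← r'.hom_add, P.stepInl_mul_stepFst_add, r'.hom_one]
    rfl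
  δ_inl := by
    ext1 p q hpq
    subst hpq
    rw [δ_zero_cochain_v, Cochain.neg_v, Cochain.comp_v _ _ _ p (p + 2) (p + 1) rfl (by lia), ht]
    obtain ⟨q, hq⟩ : ∃ q, p + 2 = q := ⟨_, rfl⟩
    rw! [hq]
    obtain rfl : q = p + 1 + 1 := by lia
    simp only [Cocycle.mk, Cochain.ofHoms_v, Cochain.mk_v, HomologicalComplex.XIsoOfEq_rfl,
      Iso.refl_hom, Category.id_comp]
    rw [r'.d_succ, r.d_succ, r.hom_comp r' r', r.hom_comp r r', r.hom_comp r r',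
      P.step_d_mul_stepInl, r.hom_sub]
    abel
  δ_snd := by
    ext1 p q hpq
    obtain rfl : q = p + 1 + 1 := by lia
    rw [δ_v 1 2 (by norm_num) _ _ _ _ (p + 1) (p + 1) (by lia) rfl, Cochain.neg_v,
      Cochain.comp_v _ _ _ p p (p + 1 + 1) (by lia) (by lia), ht]
    simp only [Cocycle.mk, Cochain.ofHoms_v, Cochain.mk_v, HomologicalComplex.XIsoOfEq_rfl,
      Iso.refl_hom, Category.comp_id]
    rw [r'.d_succ, r.d_succ, r'.hom_comp r r, r'.hom_comp r' r, r'.hom_comp r r,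
      P.stepSnd_mul_step_d, r'.hom_sub, r'.hom_neg, show Int.negOnePow 2 = 1 from rfl, one_smul]
    abel

end TotallyAcyclic

/-! ### Naturality of the Eisenbud operators -/

namespace TotallyAcyclic

open Matrix CochainComplex.HomComplex

variable {Q : Type u} [CommRing Q] {A : Type u} [CommRing A] {φ : Q →+* A}

namespace Realization

variable {κ : Type*} [Fintype κ] {h : κ → Q}
  {P P' : MatSeq Q} {K K' : CochainComplex (ModuleCat.{u} A) ℤ}
  (r : Realization φ P K) (r' : Realization φ P' K')

/-- When relations between the `h k` have coefficients in the kernel of `φ`, so do relations with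
matrices as coefficients. -/
lemma hom_eq_zero_of_sum_eq_zero
    (hrel : ∀ x : κ → Q, ∑ k, h k * x k = 0 → ∀ k, x k ∈ RingHom.ker φ) {p q : ℤ}
    (M : κ → Matrix (P'.ι q) (P.ι p) Q) (hM : ∑ k, h k • M k = 0) (k : κ) :
    r.hom r' (M k) = 0 := by
  rw [hom_eq_zero_iff]
  intro i j
  refine hrel (fun k => M k i j) ?_ k
  simpa [Matrix.sum_apply] using congrFun (congrFun hM i) j

lemma exists_sum_of_hom_eq_zero (hker : RingHom.ker φ = Ideal.span (Set.range h)) {p q : ℤ}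
    (M : Matrix (P'.ι q) (P.ι p) Q) (hM : r.hom r' M = 0) :
    ∃ W : κ → Matrix (P'.ι q) (P.ι p) Q, M = ∑ k, h k • W k := by
  rw [hom_eq_zero_iff, hker] at hM
  choose b hb using fun i j => (Ideal.mem_span_range_iff_exists_fun).1 (hM i j)
  refine ⟨fun k => Matrix.of fun i j => b i j k, ?_⟩
  ext i j
  rw [← hb i j]
  simp [Matrix.sum_apply, mul_comm]

omit [Fintype κ] in
lemma sum_smul_mul {ι₁ ι₂ ι₃ : Type*} [Fintype ι₂] (s : Finset κ) (M : κ → Matrix ι₁ ι₂ Q)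
    (N : Matrix ι₂ ι₃ Q) : ∑ k ∈ s, h k • (M k * N) = (∑ k ∈ s, h k • M k) * N := by
  simp [Matrix.sum_mul]

omit [Fintype κ] in
lemma sum_smul_mul' {ι₁ ι₂ ι₃ : Type*} [Fintype ι₂] (s : Finset κ) (M : κ → Matrix ι₂ ι₃ Q)
    (N : Matrix ι₁ ι₂ Q) : ∑ k ∈ s, h k • (N * M k) = N * ∑ k ∈ s, h k • M k := by
  simp [Matrix.mul_sum]

lemma dd_mul_dd {T : κ → ∀ p q, Matrix (P.ι q) (P.ι p) Q}
    (hT : ∀ n, P.d (n + 1) * P.d n = ∑ k, h k • T k n (n + 1 + 1)) {p q s : ℤ} (hq : p + 1 = q)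
    (hs : q + 1 = s) : P.dd q s * P.dd p q = ∑ k, h k • T k p s := by
  subst hq hs
  rw [MatSeq.dd_succ, MatSeq.dd_succ, hT]

/-- If `d² = ∑ hₖ Tₖ`, then the reductions of the `Tₖ` are cocycles. -/
lemma exists_cocycle (hrel : ∀ x : κ → Q, ∑ k, h k * x k = 0 → ∀ k, x k ∈ RingHom.ker φ)
    {T : κ → ∀ p q, Matrix (P.ι q) (P.ι p) Q}
    (hT : ∀ n, P.d (n + 1) * P.d n = ∑ k, h k • T k n (n + 1 + 1)) (k : κ) :
    ∃ t : Cocycle K K 2, ∀ p q h, t.1.v p q h = r.hom r (T k p q) := by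
  refine ⟨Cocycle.mk (Cochain.mk fun p q _ => r.hom r (T k p q)) 3 rfl ?_, fun _ _ _ => rfl⟩
  ext1 p q hpq
  rw [δ_v 2 3 rfl _ _ _ _ (p + 2) (p + 1) (by lia) rfl, show Int.negOnePow 3 = -1 from rfl]
  simp only [Cochain.mk_v, Cochain.zero_v, Units.neg_smul, one_smul]
  rw [← r.hom_dd, ← r.hom_dd, hom_comp, hom_comp, ← sub_eq_add_neg, ← hom_sub]
  refine hom_eq_zero_of_sum_eq_zero r r hrel
    (fun k => P.dd (p + 2) q * T k p (p + 2) - T k (p + 1) q * P.dd p (p + 1)) ?_ k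
  simp only [smul_sub, Finset.sum_sub_distrib, sum_smul_mul, sum_smul_mul']
  rw [← dd_mul_dd hT (show p + 1 = p + 1 from rfl) (show p + 1 + 1 = p + 2 by lia),
    ← dd_mul_dd hT (show p + 1 + 1 = p + 2 by lia) (show p + 2 + 1 = q by lia),
    Matrix.mul_assoc, sub_self]

/-- The classes of the reductions of the `Tₖ` are natural: they commute with every morphism of the
homotopy category. The homotopy is found by lifting a cochain map to `Q`. -/
lemma cls_comp_comm (hφ : Function.Surjective φ)
    (hrel : ∀ x : κ → Q, ∑ k, h k * x k = 0 → ∀ k, x k ∈ RingHom.ker φ)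
    (hker : RingHom.ker φ = Ideal.span (Set.range h))
    {T : κ → ∀ p q, Matrix (P.ι q) (P.ι p) Q}
    (hT : ∀ n, P.d (n + 1) * P.d n = ∑ k, h k • T k n (n + 1 + 1))
    {T' : κ → ∀ p q, Matrix (P'.ι q) (P'.ι p) Q}
    (hT' : ∀ n, P'.d (n + 1) * P'.d n = ∑ k, h k • T' k n (n + 1 + 1)) (k : κ)
    (t : Cocycle K K 2) (ht : ∀ p q h, t.1.v p q h = r.hom r (T k p q))
    (t' : Cocycle K' K' 2) (ht' : ∀ p q h, t'.1.v p q h = r'.hom r' (T' k p q))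
    {i j : ℤ} (hij : i + 2 = j) (β : KHom K K' i) :
    (cls t).comp β hij = β.comp (cls t') ((add_comm 2 i).trans hij) := by
  obtain ⟨b, rfl⟩ := cls_surjective β
  rw [cls_comp_cls t b ((add_comm 2 i).trans hij), cls_comp_cls b t' hij, eq_comm, ← sub_eq_zero,
    ← cls_sub, cls_eq_zero_iff _ (i + 1) (by lia)]
  choose B hB using fun p q (h : p + i = q) => r.hom_surjective r' hφ (b.1.v p q h)
  obtain ⟨ε, hε, hε'⟩ : ∃ ε : Q, ε * ε = 1 ∧
      ∀ {p q : ℤ} (f : K.X p ⟶ K'.X q), φ ε • f = i.negOnePow • f := by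
    obtain h | h := Int.units_eq_one_or i.negOnePow
    · exact ⟨1, by simp, fun f => by simp [h]⟩
    · exact ⟨-1, by simp, fun f => by simp [h]⟩
  have hW : ∀ p s, p + (i + 1) = s → ∃ W : κ → Matrix (P'.ι s) (P.ι p) Q,
      ∀ p' q (h1 : p + i = q) (h2 : p' + i = s), p + 1 = p' → q + 1 = s →
        P'.dd q s * B p q h1 = ε • (B p' s h2 * P.dd p p') + ∑ k, h k • W k := fun p s hs => by
    obtain ⟨W, hW⟩ := r.exists_sum_of_hom_eq_zero r' hker
      (P'.dd (p + i) s * B p (p + i) rfl - ε • (B (p + 1) s (by lia) * P.dd p (p + 1))) (by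
        rw [hom_sub, hom_smul, ← hom_comp r r' r', ← hom_comp r r r', hom_dd, hom_dd, hB, hB, hε']
        have := congrArg (fun y => y.v p s hs) (b.δ_eq_zero (i + 1))
        simp only [Cochain.zero_v] at this
        rw [δ_v i (i + 1) rfl _ p _ _ (p + i) (p + 1) (by lia) rfl] at this
        rw [Int.negOnePow_succ, Units.neg_smul, ← sub_eq_add_neg] at this
        exact this)
    refine ⟨W, fun p' q h1 h2 h3 h4 => ?_⟩
    subst h1 h3
    rw [← hW, add_sub_cancel]
  choose W hW using hW
  refine ⟨Cochain.mk fun p q h => r.hom r' (W p q h k), ?_⟩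
  ext1 p s hps
  obtain ⟨q, hq⟩ : ∃ q, p + i = q := ⟨_, rfl⟩
  obtain ⟨p₁, hp₁⟩ : ∃ q, p + 1 = q := ⟨_, rfl⟩
  obtain ⟨p₂, hp₂⟩ : ∃ q, p + 2 = q := ⟨_, rfl⟩
  obtain ⟨q₁, hq₁⟩ : ∃ r, q + 1 = r := ⟨_, rfl⟩
  rw [δ_v (i + 1) j (by lia) _ _ _ _ q₁ p₁ (by lia) hp₁]
  simp only [Cochain.mk_v]
  change _ = (b.1.comp t'.1 hij).v p s hps - (t.1.comp b.1 ((add_comm 2 i).trans hij)).v p s hps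
  rw [Cochain.comp_v b.1 t'.1 hij p q s hq (by lia), Cochain.comp_v t.1 b.1 _ p p₂ s hp₂ (by lia),
    ht, ht', ← hB, ← hB, hom_comp, hom_comp, ← hom_dd r', ← hom_dd r, hom_comp, hom_comp,
    show j.negOnePow = i.negOnePow by
      rw [← hij, Int.negOnePow_add, show Int.negOnePow 2 = 1 from rfl, mul_one], ← hε', ← hom_smul,
    ← hom_add, ← hom_sub, eq_comm, ← sub_eq_zero, ← hom_sub]
  refine hom_eq_zero_of_sum_eq_zero r r' hrel
    (fun k => T' k q s * B p q hq - B p₂ s (by lia) * T k p p₂ -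
      (P'.dd q₁ s * W p q₁ (by lia) k + ε • (W p₁ s (by lia) k * P.dd p p₁))) ?_ k
  simp only [smul_sub, smul_add, Finset.sum_sub_distrib, Finset.sum_add_distrib, smul_comm _ ε,
    sum_smul_mul, sum_smul_mul', ← Finset.smul_sum]
  have e₁ := hW p q₁ (by lia) p₁ q hq (by lia) hp₁ hq₁
  have e₂ := hW p₁ s (by lia) p₂ q₁ (by lia) (by lia) (by lia) (by lia)
  rw [← dd_mul_dd hT hp₁ (show p₁ + 1 = p₂ by lia), ← dd_mul_dd hT' hq₁ (show q₁ + 1 = s by lia),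
    eq_sub_iff_add_eq'.2 e₁.symm, eq_sub_iff_add_eq'.2 e₂.symm]
  simp only [Matrix.mul_sub, Matrix.sub_mul, Matrix.mul_assoc, Matrix.mul_smul, Matrix.smul_mul,
    smul_sub, smul_smul, hε, one_smul]
  abel

end Realization

end TotallyAcyclic

/-! ### Construction of complete resolutions -/

namespace TotallyAcyclic

open Matrix

section

variable {A : Type u} [CommRing A] {M : ModuleCat.{u} A}

/-- A chain complex of projective modules that is exact in positive degrees is a projective
resolution of any module `M` with `G₁ ⟶ G₀ ⟶ M ⟶ 0` exact. -/
def resolutionOfExact (G : ChainComplex (ModuleCat.{u} A) ℕ)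
    (hG : ∀ n, Module.Projective A (G.X n))
    (hex : ∀ n, Function.Exact (G.d (n + 2) (n + 1)).hom (G.d (n + 1) n).hom)
    (ε : G.X 0 ⟶ M) (hε : Function.Surjective ε.hom)
    (hε' : Function.Exact (G.d 1 0).hom ε.hom) : ProjectiveResolution M where
  complex := G
  projective n := (IsProjective.iff_projective _).1 (hG n)
  π := (ChainComplex.toSingle₀Equiv _ _).symm ⟨ε, by
    ext x
    exact (hε' _).2 ⟨x, rfl⟩⟩
  quasiIso := ⟨fun n => by
    cases n with
    | zero =>
      rw [ChainComplex.quasiIsoAt₀_iff, ShortComplex.quasiIso_iff_of_zeros']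
      · refine (ShortComplex.exact_and_epi_g_iff_of_iso ?_).2
          (⟨(ShortComplex.ShortExact.moduleCat_exact_iff_function_exact
              (ShortComplex.mk (G.d 1 0) ε (by ext x; exact (hε' _).2 ⟨x, rfl⟩))).2 hε',
            (ModuleCat.epi_iff_surjective ε).2 hε⟩ : _ ∧ Epi _)
        exact ShortComplex.isoMk (Iso.refl _) (Iso.refl _) (Iso.refl _)
          ((Category.id_comp _).trans (Category.comp_id _).symm)
          ((Category.id_comp _).trans (Category.comp_id _).symm)
      · exact G.shape _ _ (by simp)
      all_goals rfl
    | succ n =>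
      rw [quasiIsoAt_iff_exactAt']
      · rw [G.exactAt_iff' (n + 2) (n + 1) n (by simp) (by simp),
          ShortComplex.ShortExact.moduleCat_exact_iff_function_exact]
        exact hex n
      · apply ChainComplex.exactAt_succ_single_obj⟩

/-- The part in nonpositive degrees of a cochain complex as a projective resolution. -/
def restrictionResolution (F : CochainComplex (ModuleCat.{u} A) ℤ)
    (hF : ∀ n, Module.Projective A (F.X n)) (hex : ∀ b < 0, ElemExact F b) (ε : F.X 0 ⟶ M)
    (hε : Function.Surjective ε.hom) (hε' : Function.Exact (F.d (-1) 0).hom ε.hom) :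
    ProjectiveResolution M :=
  resolutionOfExact (F.restriction ComplexShape.embeddingDownNat) (fun _ => hF _)
    (fun n x => ⟨fun hx => hex (-((n + 1 : ℕ) : ℤ)) (by lia) (-((n + 2 : ℕ) : ℤ)) (-(n : ℤ))
      (by lia) (by lia) x hx, by
      rintro ⟨y, rfl⟩
      change ((F.restriction ComplexShape.embeddingDownNat).d (n + 2) (n + 1) ≫
        (F.restriction ComplexShape.embeddingDownNat).d (n + 1) n).hom y = 0
      rw [HomologicalComplex.d_comp_d]
      rfl⟩) ε hε hε'

/-- Complexes that agree in the degrees `≤ -i-1` have isomorphic truncations. -/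
def truncGTIso (X Y : CochainComplex (ModuleCat.{u} A) ℤ) (i : ℤ)
    (σ : ∀ n, n ≤ -i - 1 → (X.X n ≅ Y.X n))
    (hσ : ∀ p q hp hq, (σ p hp).hom ≫ Y.d p q = X.d p q ≫ (σ q hq).hom) :
    truncGT X i ≅ truncGT Y i :=
  (ComplexShape.Embedding.extendFunctor (ComplexShape.embeddingUpIntLE (-i - 1))
    (ModuleCat.{u} A)).mapIso
    (HomologicalComplex.Hom.isoOfComponents
      (C₁ := X.restriction (ComplexShape.embeddingUpIntLE (-i - 1)))
      (C₂ := Y.restriction (ComplexShape.embeddingUpIntLE (-i - 1)))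
      (fun k => σ (-i - 1 - k) (by lia)) (fun p q _ => hσ _ _ _ _))

/-- A totally acyclic complex that agrees in low degrees with a resolution `F` of `M` is a complete
resolution of `M`. -/
lemma isCompleteResolution_of_iso (X F : CochainComplex (ModuleCat.{u} A) ℤ)
    (hX : IsTotallyAcyclic X) (hF : ∀ n, Module.Projective A (F.X n))
    (hex : ∀ b < 0, ElemExact F b) (ε : F.X 0 ⟶ M)
    (hε : Function.Surjective ε.hom) (hε' : Function.Exact (F.d (-1) 0).hom ε.hom) (s : ℤ)
    (σ : ∀ n, n ≤ s → (X.X n ≅ F.X n))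
    (hσ : ∀ p q hp hq, (σ p hp).hom ≫ F.d p q = X.d p q ≫ (σ q hq).hom) :
    IsCompleteResolution X M := by
  let P := restrictionResolution F hF hex ε hε hε'
  let τ (n : ℤ) (hn : n ≤ 0) : F.X n ≅ P.cochainComplex.X n :=
    F.XIsoOfEq (show n = -((-n).toNat : ℤ) by lia) ≪≫
      (P.cochainComplexXIso n (-n).toNat (by lia)).symm
  refine ⟨hX, P, max (-s - 1) 0, ⟨HomotopyEquiv.ofIso (truncGTIso _ _ _ (fun n hn =>
    σ n (by lia) ≪≫ τ n (by lia)) fun p q hp hq => ?_)⟩⟩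
  have key : (show F.X p ⟶ P.complex.X (-p).toNat from
      (F.XIsoOfEq (show p = -((-p).toNat : ℤ) by lia)).hom) ≫ P.complex.d _ _ =
      F.d p q ≫ (show F.X q ⟶ P.complex.X (-q).toNat from
        (F.XIsoOfEq (show q = -((-q).toNat : ℤ) by lia)).hom) :=
    (F.XIsoOfEq_hom_comp_d _ _).trans (F.d_comp_XIsoOfEq_hom _ _).symm
  have hτ : (τ p (by lia)).hom ≫ P.cochainComplex.d p q = F.d p q ≫ (τ q (by lia)).hom := by
    rw [P.cochainComplex_d p q (-p).toNat (-q).toNat (by lia) (by lia)]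
    refine (Category.assoc _ _ _).trans ?_
    refine (congrArg (_ ≫ ·) (Iso.inv_hom_id_assoc _ _)).trans ?_
    refine (Category.assoc _ _ _).symm.trans ?_
    refine (congrArg (· ≫ _) key).trans ?_
    exact Category.assoc _ _ _
  rw [Iso.trans_hom, Iso.trans_hom, Category.assoc, hτ, ← Category.assoc, hσ, Category.assoc]

end

end TotallyAcyclic

namespace TotallyAcyclic

open Matrix

variable {Q : Type u} [CommRing Q]

namespace MatSeq

section Sub

variable (P : MatSeq Q) (S : ∀ n, P.ι n → Prop)

open Classical in
/-- The quotient of the sequence by the span of the basis elements outside of `S`. -/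
def sub : MatSeq Q where
  ι n := {i : P.ι n // S n i}
  fintype _ := inferInstance
  decidableEq _ := inferInstance
  d n := (P.d n).submatrix Subtype.val Subtype.val

open Classical in
/-- The matrix of the projection to the quotient. -/
def sel (n : ℤ) : Matrix ((P.sub S).ι n) (P.ι n) Q :=
  (1 : Matrix (P.ι n) (P.ι n) Q).submatrix Subtype.val id

/-- The image of a vector in the quotient. -/
def res {n : ℤ} (v : P.ι n → Q) : (P.sub S).ι n → Q := fun i => v i.1

variable {P S}

lemma res_surjective {n : ℤ} (v : (P.sub S).ι n → Q) : ∃ w, P.res S w = v := by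
  classical
  exact ⟨fun i => if hi : S _ i then v ⟨i, hi⟩ else 0, funext fun j => dif_pos j.2⟩

open Classical in
omit [CommRing Q] in
lemma sum_subtype_eq {n : ℤ} {M : Type*} [AddCommMonoid M] (g : P.ι n → M)
    (hg : ∀ i, ¬ S n i → g i = 0) : ∑ i : (P.sub S).ι n, g i.1 = ∑ i, g i := by
  refine (Finset.sum_subtype (Finset.univ.filter (S n)) (by simp) g).symm.trans ?_
  exact Finset.sum_filter_of_ne fun i _ h => by_contra fun hs => h (hg i hs)

variable (hd : ∀ n, Triangular (S n) (S (n + 1)) (P.d n))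
include hd

lemma sub_d_mul_sel (n : ℤ) :
    (P.sub S).d n * P.sel S n = P.sel S (n + 1) * P.d n := by
  ext i j
  have h₁ : ((P.sub S).d n * P.sel S n) i j =
      ∑ k : (P.sub S).ι n, P.d n i.1 k.1 * (1 : Matrix (P.ι n) (P.ι n) Q) k.1 j := rfl
  rw [h₁, sum_subtype_eq (fun k => P.d n i.1 k * (1 : Matrix (P.ι n) (P.ι n) Q) k j)
    fun k hk => by rw [hd n i.1 k i.2 hk, zero_mul]]
  have h₂ : (P.sel S (n + 1) * P.d n) i j =
      ∑ k, (1 : Matrix (P.ι (n + 1)) (P.ι (n + 1)) Q) i.1 k * P.d n k j := rfl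
  rw [h₂]
  simp [Matrix.one_apply]

lemma sub_mulVec {n : ℤ} (v : P.ι n → Q) :
    (P.sub S).d n *ᵥ P.res S v = P.res S (P.d n *ᵥ v) := by
  funext i
  exact sum_subtype_eq (fun k => P.d n i.1 k * v k)
    fun k hk => by rw [hd n i.1 k i.2 hk, zero_mul]

lemma isComplexMod_sub {J : Ideal Q} (h : P.IsComplexMod J) : (P.sub S).IsComplexMod J := by
  intro n i j
  have h₁ : ((P.sub S).d (n + 1) * (P.sub S).d n) i j = (P.d (n + 1) * P.d n) i.1 j.1 :=
    sum_subtype_eq (fun k => P.d (n + 1) i.1 k * P.d n k j.1)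
      fun k hk => by rw [hd (n + 1) i.1 k i.2 hk, zero_mul]
  rw [h₁]
  exact h _ _ _

lemma exactMod_sub {J : Ideal Q} {n : ℤ} (h : P.ExactMod S J n) :
    (P.sub S).ExactMod (fun _ _ => True) J n := by
  intro v hv
  obtain ⟨v, rfl⟩ := res_surjective v
  rw [sub_mulVec hd] at hv
  obtain ⟨u, hu⟩ := h v fun i hi => hv ⟨i, hi⟩ trivial
  refine ⟨P.res S u, fun i _ => ?_⟩
  rw [sub_mulVec hd]
  exact hu i.1 i.2

end Sub

/-- The quotient of the sequence of matrices by the span of the basis elements outside of `S`,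
considered modulo `J`, is a resolution of the module `M`, placed in degrees `≤ m + 1`; the elements
`e i` are the images of the basis elements in degree `m + 1`. -/
structure Resolves {B : Type u} [CommRing B] (φ : Q →+* B) (P : MatSeq Q) (S : ∀ n, P.ι n → Prop)
    (m : ℤ) (J : Ideal Q) {M : Type u} [AddCommGroup M] [Module B M] (e : P.ι (m + 1) → M) :
    Prop where
  triangular : ∀ n, Triangular (S n) (S (n + 1)) (P.d n)
  eq_zero : ∀ i, ¬ S (m + 1) i → e i = 0
  comp : ∀ j, ∑ i, φ (P.d m i j) • e i = 0
  surjective : ∀ x, ∃ v : P.ι (m + 1) → Q, ∑ i, φ (v i) • e i = x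
  exact' : ∀ v : P.ι (m + 1) → Q, ∑ i, φ (v i) • e i = 0 →
    ∃ u : P.ι m → Q, ∀ i, S _ i → (v - P.d m *ᵥ u) i ∈ J
  exact : ∀ n < m, P.ExactMod S J n
  bounded : ∀ n > m + 1, ∀ i, ¬ S n i
  full : ∃ s, ∀ n ≤ s, ∀ i, S n i

/-- A resolution modulo `J + (x)` gives a resolution modulo `J` of the same module. -/
lemma Resolves.step {B : Type u} [CommRing B] {φ : Q →+* B} {P : MatSeq Q} {S : ∀ n, P.ι n → Prop}
    {m : ℤ} {J : Ideal Q} {M : Type u} [AddCommGroup M] [Module B M] {e : P.ι (m + 1) → M} {x : Q}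
    (h : Resolves φ P S m (J ⊔ Ideal.span {x}) e) (hx : ∀ r, x * r ∈ J → r ∈ J) (hφ : φ x = 0)
    {t : ∀ n, Matrix (P.ι (n + 1 + 1)) (P.ι n) Q}
    (ht : ∀ n i j, (P.d (n + 1) * P.d n - x • t n) i j ∈ J)
    (ht' : ∀ n, Triangular (S n) (S (n + 1 + 1)) (t n)) :
    Resolves φ (P.step x t) (P.stepSet x t S) m J (Sum.elim e fun _ => (0 : M)) where
  triangular := triangular_stepSet h.triangular ht'
  eq_zero := by
    rintro (i | i) hi
    · exact h.eq_zero i hi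
    · rfl
  comp := by
    rintro (j | j)
    · refine (Fintype.sum_sum_type _).trans ?_
      simpa [MatSeq.step] using h.comp j
    · refine (Fintype.sum_sum_type _).trans ?_
      simp [MatSeq.step, hφ]
  surjective y := by
    obtain ⟨v, hv⟩ := h.surjective y
    refine ⟨Sum.elim v 0, (Fintype.sum_sum_type _).trans ?_⟩
    simpa using hv
  exact' v hv := by
    replace hv := (Fintype.sum_sum_type _).symm.trans hv
    obtain ⟨w, hw⟩ := h.exact' (fun i => v (Sum.inl i)) (by simpa using hv)
    have hz : ∀ i, ∃ z, S _ i → (v (Sum.inl i) - (P.d m *ᵥ w) i) - x * z ∈ J := fun i => by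
      by_cases hi : S _ i
      · obtain ⟨z, hz⟩ := exists_sub_mul_mem (ι := Unit) fun _ => hw i hi
        exact ⟨z (), fun _ => hz ()⟩
      · exact ⟨0, fun h => absurd h hi⟩
    choose z hz using hz
    refine ⟨Sum.elim w z, ?_⟩
    have hdw : ∀ i, ((P.step x t).d m *ᵥ Sum.elim w z) (Sum.inl i) =
        (P.d m *ᵥ w) i + x * z i := fun i => by
      refine (congrFun (fromBlocks_mulVec (P.d m) (x • 1) (-t m) (-P.d (m + 1)) (Sum.elim w z))
        (Sum.inl i)).trans ?_
      simp [Matrix.smul_mulVec]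
    rintro (i | i) hi
    · refine (congrArg (fun y => v (Sum.inl i) - y ∈ J) (hdw i)).mpr ?_
      rw [← sub_sub]
      exact hz i hi
    · exact absurd hi (h.bounded _ (by lia) i)
  exact n hn := exactMod_step hx ht h.triangular (h.exact n hn)
  bounded := by
    rintro n hn (i | i) hi
    · exact h.bounded n hn i hi
    · exact h.bounded (n + 1) (by lia) i hi
  full := by
    obtain ⟨s, hs⟩ := h.full
    refine ⟨s - 1, ?_⟩
    rintro n hn (i | i)
    · exact hs n (by lia) i
    · exact hs (n + 1) (by lia) i

end MatSeq

/-- The complex realizing a sequence of matrices that resolves `M` is a complete resolution. -/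
lemma MatSeq.Resolves.isCompleteResolution {A B : Type u} [CommRing A] [CommRing B] {φ : Q →+* A}
    (hφ : Function.Surjective φ) (ψ : A →+* B) {P : MatSeq Q} {S : ∀ n, P.ι n → Prop} {m : ℤ}
    {M : ModuleCat.{u} B} {e : P.ι (m + 1) → M}
    (h : Resolves (ψ.comp φ) P S m (RingHom.ker φ) e) (hm : m + 1 = 0)
    (hP : P.IsComplexMod (RingHom.ker φ)) (hX : IsTotallyAcyclic (P.cplx φ hP)) :
    IsCompleteResolution (P.cplx φ hP) ((ModuleCat.restrictScalars ψ).obj M) := by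
  classical
  let F := (P.sub S).cplx φ (isComplexMod_sub h.triangular hP)
  let r := P.realization φ hP
  let rs : Realization φ (P.sub S) F := (P.sub S).realization φ _
  have hε : ∀ z w, m + 1 = z → w + 1 = z → ∃ ε : F.X z ⟶ (ModuleCat.restrictScalars ψ).obj M,
      Function.Surjective ε.hom ∧ Function.Exact (F.d w z).hom ε.hom := by
    rintro z w rfl hw
    obtain rfl : w = m := by lia
    let e' : P.ι (w + 1) → (ModuleCat.restrictScalars ψ).obj M := e
    have hcomp : ∀ j, ∑ i, φ (P.d w i j) • e' i = 0 := h.comp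
    let ε₀ : ((P.sub S).ι (w + 1) → A) →ₗ[A] (ModuleCat.restrictScalars ψ).obj M :=
      Fintype.linearCombination A (fun i : (P.sub S).ι (w + 1) => e' i.1)
    let ε : F.X (w + 1) ⟶ (ModuleCat.restrictScalars ψ).obj M := (ModuleCat.ofHom ε₀ :)
    have hεv : ∀ v : P.ι (w + 1) → Q, ε.hom (rs.vec (P.res S v)) = ∑ i, φ (v i) • e' i :=
      fun v => sum_subtype_eq (fun i => φ (v i) • e' i) fun i hi => by
        rw [show e' i = 0 from h.eq_zero i hi, smul_zero]
    refine ⟨ε, fun x => ?_, fun x => ⟨fun hx => ?_, ?_⟩⟩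
    · obtain ⟨v, hv⟩ := h.surjective x
      exact ⟨_, (hεv v).trans hv⟩
    · obtain ⟨v, rfl⟩ := rs.vec_surjective hφ x
      obtain ⟨v, rfl⟩ := res_surjective v
      obtain ⟨u, hu⟩ := h.exact' v ((hεv v).symm.trans hx)
      refine ⟨rs.vec (P.res S u), ?_⟩
      rw [rs.d_vec, eq_comm, ← sub_eq_zero, ← rs.vec_sub, rs.vec_eq_zero_iff,
        sub_mulVec h.triangular]
      exact fun i => hu i.1 i.2
    · rintro ⟨y, rfl⟩
      obtain ⟨u, rfl⟩ := rs.vec_surjective hφ y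
      obtain ⟨u, rfl⟩ := res_surjective u
      rw [rs.d_vec, sub_mulVec h.triangular, hεv]
      have : ∑ i, φ ((P.d w *ᵥ u) i) • e' i =
          ∑ j, φ (u j) • ∑ i, φ (P.d w i j) • e' i := by
        simp only [Matrix.mulVec, dotProduct, map_sum, Finset.sum_smul, Finset.smul_sum, map_mul]
        rw [Finset.sum_comm]
        exact Finset.sum_congr rfl fun j _ => Finset.sum_congr rfl fun i _ => by
          rw [smul_smul, mul_comm]
      rw [this]
      exact Finset.sum_eq_zero fun j _ => by rw [hcomp, smul_zero]
  obtain ⟨ε, hε₁, hε₂⟩ := hε 0 (-1) hm rfl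
  obtain ⟨s, hs⟩ := h.full
  have hsel : ∀ n, P.sel S n * (P.sel S n)ᵀ = 1 := fun n => by
    ext i j
    have h₁ : (P.sel S n * (P.sel S n)ᵀ) i j = ∑ k : P.ι n,
        (1 : Matrix (P.ι n) (P.ι n) Q) i.1 k * (1 : Matrix (P.ι n) (P.ι n) Q) j.1 k := rfl
    rw [h₁]
    simp only [Matrix.one_apply, ite_mul, one_mul, zero_mul, Finset.sum_ite_eq, Finset.mem_univ,
      if_true]
    exact if_congr (eq_comm.trans Subtype.ext_iff.symm) rfl rfl
  have hsel' : ∀ n ≤ s, (P.sel S n)ᵀ * P.sel S n = 1 := fun n hn => by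
    ext i j
    have h₁ : ((P.sel S n)ᵀ * P.sel S n) i j = ∑ k : (P.sub S).ι n,
        (1 : Matrix (P.ι n) (P.ι n) Q) k.1 i * (1 : Matrix (P.ι n) (P.ι n) Q) k.1 j := rfl
    rw [h₁, sum_subtype_eq (fun k => (1 : Matrix (P.ι n) (P.ι n) Q) k i *
      (1 : Matrix (P.ι n) (P.ι n) Q) k j) fun k hk => absurd (hs n hn k) hk]
    simp [Matrix.one_apply, eq_comm]
  refine isCompleteResolution_of_iso _ F hX (fun n => ?_) (fun b hb => ?_) ε hε₁ hε₂ s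
    (fun n hn => ⟨r.hom rs (P.sel S n), rs.hom r (P.sel S n)ᵀ, ?_, ?_⟩) (fun p q hp hq => ?_)
  · exact Module.Projective.of_basis (rs.basis n)
  · obtain ⟨n, rfl⟩ : ∃ n, b = n + 1 := ⟨b - 1, by lia⟩
    exact (rs.exactMod_iff hφ n).1 (exactMod_sub h.triangular (h.exact n (by lia)))
  · rw [r.hom_comp rs r, hsel' n hn, r.hom_one]
  · rw [rs.hom_comp r rs, hsel n, rs.hom_one]
  · by_cases hpq : p + 1 = q
    · subst hpq
      dsimp only
      rw [rs.d_succ, r.d_succ, r.hom_comp rs rs, r.hom_comp r rs, sub_d_mul_sel h.triangular]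
    · rw [F.shape p q (by simpa using hpq), (P.cplx φ hP).shape p q (by simpa using hpq)]
      simp

end TotallyAcyclic

/-! ### Exact sequences of matrices over a regular local ring -/

namespace TotallyAcyclic

section Domain

open IsLocalRing

/-- In a family of generators of an ideal, one member may be replaced by a linear combination in
which it has a unit as coefficient. -/
lemma span_update_eq {A : Type*} [CommRing A] {n : ℕ} (v : Fin n → A) (a : Fin n → A) (i : Fin n)
    (hi : IsUnit (a i)) :
    Ideal.span (Set.range (Function.update v i (∑ j, a j * v j))) = Ideal.span (Set.range v) := by
  set x := ∑ j, a j * v j with hx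
  have hmem : ∀ j, j ≠ i → v j ∈ Ideal.span (Set.range (Function.update v i x)) := fun j hj =>
    Ideal.subset_span ⟨j, Function.update_of_ne hj _ _⟩
  apply le_antisymm
  · rw [Ideal.span_le]
    rintro _ ⟨j, rfl⟩
    by_cases hj : j = i
    · subst hj
      rw [Function.update_self]
      exact sum_mem fun k _ => Ideal.mul_mem_left _ _ (Ideal.subset_span ⟨k, rfl⟩)
    · rw [Function.update_of_ne hj]
      exact Ideal.subset_span ⟨j, rfl⟩
  · rw [Ideal.span_le]
    rintro _ ⟨j, rfl⟩
    by_cases hj : j = i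
    · subst hj
      have h1 : a j * v j ∈ Ideal.span (Set.range (Function.update v j x)) := by
        have : a j * v j = x - ∑ k ∈ Finset.univ.erase j, a k * v k := by
          rw [hx, ← Finset.add_sum_erase _ _ (Finset.mem_univ j), add_sub_cancel_right]
        rw [this]
        refine sub_mem (Ideal.subset_span ⟨j, Function.update_self _ _ _⟩)
          (sum_mem fun k hk => Ideal.mul_mem_left _ _ (hmem k (Finset.ne_of_mem_erase hk)))
      exact (Ideal.unit_mul_mem_iff_mem _ hi).1 h1
    · exact hmem j hj

lemma span_quotient_eq {A : Type*} [CommRing A] [IsLocalRing A] {n : ℕ} {v : Fin (n + 1) → A}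
    (hv : Ideal.span (Set.range v) = maximalIdeal A) (i : Fin (n + 1))
    [IsLocalRing (A ⧸ Ideal.span {v i})] :
    Ideal.span (Set.range fun j : Fin n => Ideal.Quotient.mk (Ideal.span {v i}) (v (i.succAbove j)))
      = maximalIdeal (A ⧸ Ideal.span {v i}) := by
  have h1 : maximalIdeal (A ⧸ Ideal.span {v i}) =
      (maximalIdeal A).map (Ideal.Quotient.mk (Ideal.span {v i})) :=
    (map_maximalIdeal_of_surjective _ Ideal.Quotient.mk_surjective).symm
  rw [h1, ← hv, Ideal.map_span]
  apply le_antisymm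
  · refine Ideal.span_mono ?_
    rintro _ ⟨j, rfl⟩
    exact ⟨_, ⟨_, rfl⟩, rfl⟩
  · rw [Ideal.span_le]
    rintro _ ⟨_, ⟨j, rfl⟩, rfl⟩
    refine Fin.succAboveCases i ?_ (fun j => ?_) j
    · rw [Ideal.Quotient.eq_zero_iff_mem.2 (Ideal.mem_span_singleton_self _)]
      exact zero_mem _
    · exact Ideal.subset_span ⟨j, rfl⟩

lemma isLocalRing_quotient {A : Type*} [CommRing A] [IsLocalRing A] {x : A}
    (hx : x ∈ maximalIdeal A) : IsLocalRing (A ⧸ Ideal.span {x}) := by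
  have : Nontrivial (A ⧸ Ideal.span {x}) := Ideal.Quotient.nontrivial_iff.2 fun h =>
    (maximalIdeal.isMaximal A).ne_top
      (top_le_iff.1 (h ▸ (Ideal.span_singleton_le_iff_mem _).2 hx))
  exact .of_surjective' _ Ideal.Quotient.mk_surjective

lemma le_ringKrullDim_quotient {A : Type*} [CommRing A] [IsLocalRing A] [IsNoetherianRing A]
    {x : A} (hx : x ∈ maximalIdeal A) {n : ℕ} (hn : ((n + 1 : ℕ) : WithBot ℕ∞) ≤ ringKrullDim A) :
    (n : WithBot ℕ∞) ≤ ringKrullDim (A ⧸ Ideal.span {x}) := by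
  have h := hn.trans (ringKrullDim_le_ringKrullDim_quotient_add_card {x} (by
    simpa [IsLocalRing.ringJacobson_eq_maximalIdeal] using hx))
  rw [Finset.card_singleton, Finset.coe_singleton] at h
  exact ENat.WithBot.add_le_add_natCast_right_iff.1 (by exact_mod_cast h)

/-- A regular local ring is a domain. -/
lemma isDomain_of_span_eq_maximalIdeal (n : ℕ) : ∀ (A : Type u) [CommRing A] [IsLocalRing A]
    [IsNoetherianRing A] (v : Fin n → A), Ideal.span (Set.range v) = maximalIdeal A →
    (n : WithBot ℕ∞) ≤ ringKrullDim A → IsDomain A := by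
  induction n with
  | zero =>
    intro A _ _ _ v hv _
    have h : maximalIdeal A = ⊥ := by
      rw [← hv, Set.range_eq_empty, Ideal.span_empty]
    exact (isField_iff_maximalIdeal_eq.2 h).isDomain
  | succ n ih =>
    intro A _ _ _ v hv hn
    have hdim : ¬ Ring.KrullDimLE 0 A := fun h => by
      have h' := hn.trans (Ring.krullDimLE_iff.1 h)
      norm_cast at h'
    have hmin : ∀ p ∈ minimalPrimes A, ¬ maximalIdeal A ≤ p := fun p hp h => by
      refine hdim (.mk₀ fun I hI => ?_)
      have : p ≤ I := hp.2 ⟨hI, bot_le⟩ ((le_maximalIdeal hI.ne_top).trans h)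
      rw [(h.trans this).antisymm' (le_maximalIdeal hI.ne_top)]
      infer_instance
    -- By prime avoidance there is a parameter outside of the square of the maximal ideal and of all
    -- minimal primes. It is part of a minimal system of generators.
    obtain ⟨x, hx, hx2, hxp⟩ : ∃ x ∈ maximalIdeal A, x ∉ maximalIdeal A ^ 2 ∧
        ∀ p ∈ minimalPrimes A, x ∉ p := by
      by_contra! hcon
      obtain ⟨p, hp, hle⟩ := (Ideal.subset_union_prime_finite
        ((minimalPrimes.finite_of_isNoetherianRing A).insert (maximalIdeal A ^ 2)) (f := id)
        (maximalIdeal A ^ 2) (maximalIdeal A ^ 2) (I := maximalIdeal A) (fun p hp h _ =>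
          ((Set.mem_insert_iff.1 hp).resolve_left h).1.1)).1 (fun x hx => by
            by_cases hx2 : x ∈ maximalIdeal A ^ 2
            · exact Set.mem_biUnion (Set.mem_insert _ _) hx2
            · obtain ⟨p, hp, hxp⟩ := hcon x hx hx2
              exact Set.mem_biUnion (Set.mem_insert_of_mem _ hp) hxp)
      rcases hp with rfl | hp
      · refine (maximalIdeal_sq_lt_of_ringKrullDim_ne_zero fun h => hdim ?_).not_ge hle
        exact Ring.krullDimLE_iff.2 h.le
      · exact hmin p hp hle
    rw [← hv] at hx
    obtain ⟨a, ha⟩ := (Ideal.mem_span_range_iff_exists_fun).1 hx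
    obtain ⟨i, hi⟩ : ∃ i, IsUnit (a i) := by
      by_contra! hcon
      refine hx2 ?_
      rw [← ha, pow_two]
      refine sum_mem fun i _ => Ideal.mul_mem_mul (hcon i) ?_
      rw [← hv]
      exact Ideal.subset_span ⟨i, rfl⟩
    have hw := (span_update_eq v a i hi).trans hv
    rw [ha] at hw
    rw [hv] at hx
    have hwi : Function.update v i x i = x := Function.update_self _ _ _
    have := isLocalRing_quotient hx
    have hdom : IsDomain (A ⧸ Ideal.span {x}) := by
      have : IsLocalRing (A ⧸ Ideal.span {Function.update v i x i}) := by rwa [hwi]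
      have h := ih _ _ (span_quotient_eq hw i) (by
        rw [hwi]
        exact le_ringKrullDim_quotient hx hn)
      rwa [hwi] at h
    have hprime : (Ideal.span {x}).IsPrime := (Ideal.Quotient.isDomain_iff_prime _).1 hdom
    obtain ⟨p, hp, hpx⟩ := Ideal.exists_minimalPrimes_le (I := ⊥) (J := Ideal.span {x}) bot_le
    have hpp : p.IsPrime := hp.1.1
    -- A minimal prime `p` inside of `(x)` satisfies `p = x p`, so it is zero by Nakayama's lemma.
    have hp0 : p = ⊥ := by
      refine Submodule.eq_bot_of_le_smul_of_le_jacobson_bot (maximalIdeal A) p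
        (IsNoetherian.noetherian p) (fun y hy => ?_) (maximalIdeal_le_jacobson _)
      obtain ⟨z, rfl⟩ := Ideal.mem_span_singleton'.1 (hpx hy)
      rw [mul_comm]
      exact Ideal.mul_mem_mul hx ((hpp.mem_or_mem hy).resolve_right (hxp p hp))
    subst hp0
    exact (IsDomain.of_bot_isPrime A)

/-- A sequence of matrices that is exact modulo the kernel of a surjection onto a regular local
ring is exact modulo the maximal ideal: divide by a regular system of parameters, one element at a
time. -/
lemma exactMod_maximalIdeal_of_surjective {Q : Type u} [CommRing Q] [IsLocalRing Q] {P : MatSeq Q}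
    (n : ℕ) : ∀ (A : Type u) [CommRing A] [IsLocalRing A]
    [IsNoetherianRing A] (v : Fin n → A), Ideal.span (Set.range v) = maximalIdeal A →
    (n : WithBot ℕ∞) ≤ ringKrullDim A → ∀ π : Q →+* A, Function.Surjective π →
    P.IsComplexMod (RingHom.ker π) → (∀ k, P.ExactMod (fun _ _ => True) (RingHom.ker π) k) →
    ∀ k, P.ExactMod (fun _ _ => True) (maximalIdeal Q) k := by
  induction n with
  | zero =>
    intro A _ _ _ v hv _ π hπ _ h
    have h0 : maximalIdeal A = ⊥ := by
      rw [← hv, Set.range_eq_empty, Ideal.span_empty]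
    have h1 : RingHom.ker π = maximalIdeal Q := by
      rw [RingHom.ker_eq_comap_bot, ← h0]
      exact eq_maximalIdeal (Ideal.comap_isMaximal_of_surjective π hπ)
    rwa [← h1]
  | succ n ih =>
    intro A _ _ _ v hv hn π hπ hP h
    have hdom := isDomain_of_span_eq_maximalIdeal _ A v hv hn
    have hx : v 0 ∈ maximalIdeal A := by
      rw [← hv]
      exact Ideal.subset_span ⟨0, rfl⟩
    have := isLocalRing_quotient hx
    obtain ⟨x, hxv⟩ := hπ (v 0)
    have hker : RingHom.ker ((Ideal.Quotient.mk (Ideal.span {v 0})).comp π) =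
        RingHom.ker π ⊔ Ideal.span {x} := by
      rw [RingHom.ker_eq_comap_bot, ← Ideal.comap_comap, ← RingHom.ker_eq_comap_bot,
        Ideal.mk_ker, ← hxv, ← Set.image_singleton, ← Ideal.map_span,
        Ideal.comap_map_of_surjective π hπ, sup_comm, ← RingHom.ker_eq_comap_bot]
    refine ih _ _ (span_quotient_eq hv 0) (le_ringKrullDim_quotient hx hn)
      ((Ideal.Quotient.mk (Ideal.span {v 0})).comp π) (Ideal.Quotient.mk_surjective.comp hπ) ?_ ?_
    · rw [hker]
      exact fun n i j => Ideal.mem_sup_left (hP n i j)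
    · rw [hker]
      by_cases h0 : v 0 = 0
      · rwa [sup_of_le_left]
        rw [Ideal.span_singleton_le_iff_mem, RingHom.mem_ker, hxv, h0]
      · refine MatSeq.exactMod_sup (fun r hr => ?_) hP h
        rw [RingHom.mem_ker, map_mul, hxv] at hr
        exact (mul_eq_zero.1 hr).resolve_left h0

/-- Over a regular local ring, exact sequences of matrices remain exact modulo the maximal
ideal. -/
lemma exactMod_maximalIdeal {Q : Type u} [CommRing Q] [IsRegularLocalRing Q] {P : MatSeq Q}
    (hP : P.IsComplexMod ⊥) (h : ∀ k, P.ExactMod (fun _ _ => True) ⊥ k) (k : ℤ) :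
    P.ExactMod (fun _ _ => True) (maximalIdeal Q) k := by
  obtain ⟨s, hs, hsm⟩ := (IsNoetherian.noetherian
    (maximalIdeal Q)).exists_span_finset_card_eq_spanFinrank
  have hk : RingHom.ker (RingHom.id Q) = ⊥ := RingHom.ker_eq_bot_iff_eq_zero _ |>.2 fun _ h => h
  refine exactMod_maximalIdeal_of_surjective s.card Q (fun i => s.equivFin.symm i) ?_
    (by rw [hs]; exact IsRegularLocalRing.spanFinrank_maximalIdeal.le) (RingHom.id Q)
    Function.surjective_id (by rwa [hk]) (by rwa [hk]) k
  rw [← hsm, Ideal.span, ← Subtype.range_coe (s := (s : Set Q))]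
  congr 1
  exact s.equivFin.symm.surjective.range_comp (fun x : s => (x : Q))

end Domain

end TotallyAcyclic

/-! ### Homomorphisms into a module -/

namespace TotallyAcyclic

open Matrix

/-- Exactness, in degree `n + 1`, of the sequence of homomorphisms from a complex realizing `P`
into a module, in terms of the values on the basis elements. -/
def MatSeq.HomCond {Q A : Type u} [CommRing Q] [CommRing A] (φ : Q →+* A) (P : MatSeq Q)
    (M : Type u) [AddCommGroup M] [Module A M] (n : ℤ) : Prop :=
  ∀ e : P.ι (n + 1) → M, (∀ j, ∑ i, φ (P.d n i j) • e i = 0) →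
    ∃ e' : P.ι (n + 1 + 1) → M, ∀ i, e i = ∑ k, φ (P.d (n + 1) k i) • e' k

lemma Realization.homExact_iff {Q A : Type u} [CommRing Q] [CommRing A] {φ : Q →+* A}
    {P : MatSeq Q} {K : CochainComplex (ModuleCat.{u} A) ℤ} (r : Realization φ P K)
    (N : ModuleCat.{u} A) (n : ℤ) : HomExact K N (n + 1) ↔ P.HomCond φ N n := by
  have hcomp : ∀ (m : ℤ) (f : K.X (m + 1) ⟶ N) (j : P.ι m),
      (K.d m (m + 1) ≫ f).hom (r.basis m j) =
        ∑ i, φ (P.d m i j) • f.hom (r.basis (m + 1) i) := fun m f j => by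
    rw [ModuleCat.hom_comp, LinearMap.comp_apply, r.d_eq, Matrix.toLin_self, map_sum]
    simp
  constructor
  · intro h e he
    let f : K.X (n + 1) ⟶ N := ModuleCat.ofHom ((r.basis (n + 1)).constr A e)
    have hf : ∀ i, f.hom (r.basis (n + 1) i) = e i := fun i =>
      Module.Basis.constr_basis (r.basis (n + 1)) A e i
    obtain ⟨g, hg⟩ := h f (by
      rw [show n + 1 - 1 = n by lia]
      ext1
      refine (r.basis n).ext fun j => ?_
      rw [hcomp]
      simpa [hf] using he j)
    refine ⟨fun k => g.hom (r.basis (n + 1 + 1) k), fun i => ?_⟩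
    rw [← hcomp, ← hg, hf]
  · intro h f hf
    obtain ⟨e', he'⟩ := h (fun i => f.hom (r.basis (n + 1) i)) fun j => by
      rw [show n + 1 - 1 = n by lia] at hf
      rw [← hcomp, hf]
      rfl
    refine ⟨ModuleCat.ofHom ((r.basis (n + 1 + 1)).constr A e'), ?_⟩
    ext1
    refine (r.basis (n + 1)).ext fun i => ?_
    rw [hcomp, he']
    exact Finset.sum_congr rfl fun k _ => congrArg _
      (Module.Basis.constr_basis (r.basis (n + 1 + 1)) A e' k).symm

/-- Over a regular local ring, an exact sequence of matrices is split exact, and hence homomorphisms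
into any module form an exact sequence. -/
lemma MatSeq.homCond_of_exactMod {Q A : Type u} [CommRing Q] [IsRegularLocalRing Q] [CommRing A]
    (φ : Q →+* A) {P : MatSeq Q} (hP : P.IsComplexMod ⊥)
    (h : ∀ k, P.ExactMod (fun _ _ => True) ⊥ k) (M : Type u) [AddCommGroup M] [Module A M]
    (n : ℤ) : P.HomCond φ M n := by
  intro e he
  let : Module Q M := Module.compHom M φ
  have hsmul : ∀ (q : Q) (x : M), q • x = φ q • x := fun _ _ => rfl
  simp only [← hsmul] at he ⊢
  let k := IsLocalRing.ResidueField Q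
  let B := LinearMap.range (P.d n).mulVecLin
  have hd : ∀ v, P.d (n + 1) *ᵥ (P.d n *ᵥ v) = 0 := fun v => by
    rw [Matrix.mulVec_mulVec, show P.d (n + 1) * P.d n = 0 from Matrix.ext fun i j => hP n i j,
      Matrix.zero_mulVec]
  let l : ((P.ι (n + 1) → Q) ⧸ B) →ₗ[Q] (P.ι (n + 1 + 1) → Q) :=
    B.liftQ (P.d (n + 1)).mulVecLin (by
      rintro _ ⟨v, rfl⟩
      exact hd v)
  -- A map from a finitely generated module to a free one that is injective modulo the maximal ideal
  -- has a retraction.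
  have hl : Function.Injective (l.lTensor k) := by
    rw [injective_iff_map_eq_zero]
    intro y hy
    obtain ⟨y, rfl⟩ := TensorProduct.mk_surjective Q _ k IsLocalRing.residue_surjective y
    obtain ⟨v, rfl⟩ := B.mkQ_surjective y
    have hy' := congrArg (TensorProduct.piScalarRightHom Q Q k (P.ι (n + 1 + 1))) hy
    rw [TensorProduct.mk_apply, LinearMap.lTensor_tmul, TensorProduct.piScalarRightHom_tmul,
      map_zero] at hy'
    obtain ⟨u, hu⟩ := exactMod_maximalIdeal hP h n v fun i _ => by
      have h1 : (P.d (n + 1) *ᵥ v) i • (1 : k) = 0 := congrFun hy' i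
      rwa [← Algebra.algebraMap_eq_smul_one, IsLocalRing.ResidueField.algebraMap_eq,
        IsLocalRing.residue_eq_zero_iff] at h1
    have h2 : B.mkQ v = B.mkQ (v - P.d n *ᵥ u) := by
      rw [← sub_eq_zero, ← map_sub, sub_sub_cancel]
      exact (Submodule.Quotient.mk_eq_zero _).2 ⟨u, rfl⟩
    rw [h2, pi_eq_sum_univ (v - P.d n *ᵥ u), map_sum, map_sum]
    refine Finset.sum_eq_zero fun i _ => ?_
    rw [map_smul, TensorProduct.mk_apply, ← TensorProduct.smul_tmul,
      ← Algebra.algebraMap_eq_smul_one, IsLocalRing.ResidueField.algebraMap_eq,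
      (IsLocalRing.residue_eq_zero_iff _).2 (hu i trivial), TensorProduct.zero_tmul]
  obtain ⟨l', hl'⟩ := (IsLocalRing.split_injective_iff_lTensor_residueField_injective l).2 hl
  let g : ((P.ι (n + 1) → Q) ⧸ B) →ₗ[Q] M :=
    B.liftQ (Fintype.linearCombination Q e) (by
      rintro _ ⟨v, rfl⟩
      rw [LinearMap.mem_ker, Matrix.mulVecLin_apply, Fintype.linearCombination_apply]
      simp only [Matrix.mulVec, dotProduct, Finset.sum_smul]
      rw [Finset.sum_comm]
      refine Finset.sum_eq_zero fun j _ => ?_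
      rw [← smul_zero (v j), ← he j, Finset.smul_sum]
      exact Finset.sum_congr rfl fun i _ => by rw [smul_smul, mul_comm])
  refine ⟨fun k => g (l' (Pi.single k 1)), fun i => ?_⟩
  simp only [← map_smul, ← map_sum]
  have h3 : ∑ k, P.d (n + 1) k i • (Pi.single k 1 : P.ι (n + 1 + 1) → Q) =
      l (B.mkQ (Pi.single i 1)) := by
    have : l (B.mkQ (Pi.single i 1)) = P.d (n + 1) *ᵥ Pi.single i 1 := B.liftQ_apply _ _
    rw [this, Matrix.mulVec_single_one]
    exact (pi_eq_sum_univ' _).symm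
  rw [h3, show l' (l (B.mkQ (Pi.single i 1))) = B.mkQ (Pi.single i 1) from
    LinearMap.congr_fun hl' _]
  have : g (B.mkQ (Pi.single i 1)) = Fintype.linearCombination Q e (Pi.single i 1) :=
    B.liftQ_apply _ _
  rw [this, Fintype.linearCombination_apply_single, one_smul]

end TotallyAcyclic

/-! ### Regular sequences in a local ring -/

namespace TotallyAcyclic

open RingTheory.Sequence IsLocalRing

section Regular

variable {Q : Type u} [CommRing Q] {κ : Type*} [DecidableEq κ]

/-- A family of ring elements is regular in any order: each member is a nonzerodivisor modulo the
ideal generated by any set of other members. -/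
def RegularFamily (g : κ → Q) : Prop :=
  ∀ (s : Finset κ), ∀ l ∉ s, ∀ r, g l * r ∈ Ideal.span (g '' s) → r ∈ Ideal.span (g '' s)

lemma isWeaklyRegular_append_singleton_iff (rs : List Q) (x : Q) :
    IsWeaklyRegular Q (rs ++ [x]) ↔
      IsWeaklyRegular Q rs ∧ ∀ r, x * r ∈ Ideal.ofList rs → r ∈ Ideal.ofList rs := by
  rw [isWeaklyRegular_append_iff, isWeaklyRegular_singleton_iff,
    isSMulRegular_iff_right_eq_zero_of_smul]
  refine and_congr_right fun _ => ⟨fun h r hr => ?_, fun h y hy => ?_⟩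
  · have := h (Submodule.Quotient.mk r) (by
      rw [← Submodule.Quotient.mk_smul, Submodule.Quotient.mk_eq_zero]
      simpa using hr)
    rw [Submodule.Quotient.mk_eq_zero] at this
    simpa using this
  · obtain ⟨r, rfl⟩ := Submodule.Quotient.mk_surjective _ y
    rw [← Submodule.Quotient.mk_smul, Submodule.Quotient.mk_eq_zero] at hy
    rw [Submodule.Quotient.mk_eq_zero]
    simpa using h r (by simpa using hy)

omit [DecidableEq κ] in
lemma ofList_map_toList (g : κ → Q) (s : Finset κ) :
    Ideal.ofList (s.toList.map g) = Ideal.span (g '' s) := by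
  rw [Ideal.ofList]
  congr 1
  ext y
  simp

variable [Fintype κ] [IsLocalRing Q] [IsNoetherianRing Q]

lemma perm_append_cons_toList {L : List κ} (hL : L.Nodup) (hL' : ∀ k, k ∈ L) (s : Finset κ) {l : κ}
    (hl : l ∉ s) : L.Perm (s.toList ++ [l] ++ (Finset.univ \ insert l s).toList) := by
  rw [List.perm_ext_iff_of_nodup hL]
  · intro k
    by_cases h1 : k ∈ s <;> by_cases h2 : k = l <;> simp [hL', h1, h2]
  · rw [List.nodup_append, List.nodup_append]
    refine ⟨⟨s.nodup_toList, List.nodup_singleton _, ?_⟩, Finset.nodup_toList _, ?_⟩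
    · rintro x hx y hy rfl
      rw [List.mem_singleton] at hy
      subst hy
      exact hl (Finset.mem_toList.1 hx)
    · rintro x hx y hy rfl
      simp at hx hy
      tauto

/-- Regular sequences in the maximal ideal of a noetherian local ring may be permuted. -/
lemma regularFamily_of_isWeaklyRegular {g : κ → Q} {L : List κ} (hL : L.Nodup)
    (hL' : ∀ k, k ∈ L) (h : IsWeaklyRegular Q (L.map g)) (hg : ∀ k, g k ∈ maximalIdeal Q) :
    RegularFamily g := by
  intro s l hl
  have h' := isWeaklyRegular_of_perm_of_subset_maximalIdeal h
    ((perm_append_cons_toList hL hL' s hl).map g) (by simpa using fun k _ => hg k)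
  rw [List.map_append, List.map_append, List.map_singleton, isWeaklyRegular_append_iff,
    isWeaklyRegular_append_singleton_iff, ofList_map_toList] at h'
  exact h'.1.2

omit [Fintype κ] [IsLocalRing Q] [IsNoetherianRing Q] in
lemma RegularFamily.isWeaklyRegular_map {g : κ → Q} (h : RegularFamily g) {L : List κ}
    (hL : L.Nodup) : IsWeaklyRegular Q (L.map g) := by
  induction L using List.reverseRecOn with
  | nil => exact IsWeaklyRegular.nil Q Q
  | append_singleton L l ih =>
    rw [List.nodup_append] at hL
    rw [List.map_append, List.map_singleton, isWeaklyRegular_append_singleton_iff]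
    have : Ideal.ofList (L.map g) = Ideal.span (g '' L.toFinset) := by
      rw [Ideal.ofList]
      congr 1
      ext y
      simp
    rw [this]
    exact ⟨ih hL.1, h _ l fun hl => hL.2.2 l (List.mem_toFinset.1 hl) l (by simp) rfl⟩

/-- In a regular family, one member may be replaced by a linear combination in which it has a unit
as coefficient. -/
lemma RegularFamily.update {f : κ → Q} (h : RegularFamily f) (hf : ∀ k, f k ∈ maximalIdeal Q)
    (a : κ → Q) {i : κ} (hi : IsUnit (a i)) :
    RegularFamily (Function.update f i (∑ k, a k * f k)) := by
  set g := Function.update f i (∑ k, a k * f k) with hg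
  have hgi : g i = ∑ k, a k * f k := Function.update_self _ _ _
  have hgk : ∀ k, k ≠ i → g k = f k := fun k hk => Function.update_of_ne hk _ _
  have himg : g '' (Finset.univ.erase i : Finset κ) = f '' (Finset.univ.erase i : Finset κ) :=
    Set.image_congr fun k hk => hgk k (Finset.ne_of_mem_erase hk)
  refine regularFamily_of_isWeaklyRegular (L := (Finset.univ.erase i).toList ++ [i]) ?_ ?_ ?_ ?_
  · rw [List.nodup_append]
    refine ⟨Finset.nodup_toList _, List.nodup_singleton _, ?_⟩
    rintro x hx y hy rfl
    simp at hx hy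
    tauto
  · intro k
    by_cases hk : k = i <;> simp [hk]
  · rw [List.map_append, List.map_singleton, isWeaklyRegular_append_singleton_iff,
      ofList_map_toList, himg]
    refine ⟨?_, fun r hr => h _ i (Finset.notMem_erase _ _) r ?_⟩
    · rw [show (Finset.univ.erase i).toList.map g = (Finset.univ.erase i).toList.map f from
        List.map_congr_left fun k hk => hgk k (Finset.ne_of_mem_erase (Finset.mem_toList.1 hk))]
      exact h.isWeaklyRegular_map (Finset.nodup_toList _)
    · rw [hgi, ← Finset.add_sum_erase _ _ (Finset.mem_univ i), add_mul, Finset.sum_mul] at hr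
      refine (Ideal.unit_mul_mem_iff_mem _ hi).1 ?_
      rw [← mul_assoc]
      refine (Ideal.add_mem_iff_left _ ?_).1 hr
      exact sum_mem fun k hk => Ideal.mul_mem_right _ _ (Ideal.mul_mem_left _ _
        (Ideal.subset_span ⟨k, hk, rfl⟩))
  · intro k
    by_cases hk : k = i
    · rw [hk, hgi]
      exact sum_mem fun k _ => Ideal.mul_mem_left _ _ (hf k)
    · rw [hgk k hk]
      exact hf k

lemma mem_maximalIdeal_of_isRegular {Q : Type u} [CommRing Q] [IsLocalRing Q] {c : ℕ}
    {f : Fin c → Q} (h : RingTheory.Sequence.IsRegular Q (List.ofFn f)) (k : Fin c) :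
    f k ∈ maximalIdeal Q := by
  refine le_maximalIdeal (fun h' => h.top_ne_smul ?_)
    (Ideal.subset_span (show f k ∈ {r | r ∈ List.ofFn f} by simp))
  rw [Ideal.ofList, h', Ideal.smul_eq_mul, Ideal.mul_top]

lemma regularFamily_of_isRegular {c : ℕ} {f : Fin c → Q}
    (h : RingTheory.Sequence.IsRegular Q (List.ofFn f)) : RegularFamily f :=
  regularFamily_of_isWeaklyRegular (List.nodup_finRange c) List.mem_finRange
    (by rw [← List.ofFn_eq_map]; exact h.toIsWeaklyRegular) (mem_maximalIdeal_of_isRegular h)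

end Regular

end TotallyAcyclic

/-! ### Graded modules over a polynomial ring -/

namespace TotallyAcyclic

/-- A graded `R`-module with commuting operators of degree `2`. -/
structure OpModule (R : Type u) [CommRing R] (κ : Type) where
  H : ℤ → Type u
  [addCommGroup (i : ℤ) : AddCommGroup (H i)]
  [module (i : ℤ) : Module R (H i)]
  op (k : κ) (i j : ℤ) : i + 2 = j → H i →ₗ[R] H j
  op_comm (k l : κ) (i j m : ℤ) (hij : i + 2 = j) (hjm : j + 2 = m) (x : H i) :
    op k j m hjm (op l i j hij x) = op l j m hjm (op k i j hij x)

attribute [instance] OpModule.addCommGroup OpModule.module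

namespace OpModule

variable {R : Type u} [CommRing R] {κ : Type}

/-- The direct sum of the components of nonnegative degree. -/
def Total (M : OpModule R κ) : Type u := DirectSum ℕ fun n => M.H n

variable (M : OpModule R κ)

instance : AddCommGroup M.Total := inferInstanceAs (AddCommGroup (DirectSum ℕ fun n => M.H n))

instance : Module R M.Total := inferInstanceAs (Module R (DirectSum ℕ fun n => M.H n))

/-- The inclusion of a component. -/
def ι (n : ℕ) : M.H n →ₗ[R] M.Total := DirectSum.lof R ℕ (fun n => M.H n) n

/-- The projection to a component. -/
def π (n : ℕ) : M.Total →ₗ[R] M.H n := DirectSum.component R ℕ (fun n => M.H n) n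

variable {M}

lemma π_ι (n : ℕ) (x : M.H n) : M.π n (M.ι n x) = x :=
  DirectSum.component.lof_self R _ _

lemma π_ι_of_ne {m n : ℕ} (h : m ≠ n) (x : M.H m) : M.π n (M.ι m x) = 0 :=
  (DirectSum.component.of R _ _ _).trans (dif_neg h)

lemma hom_ext {N : Type*} [AddCommMonoid N] [Module R N] {f g : M.Total →ₗ[R] N}
    (h : ∀ n, f ∘ₗ M.ι n = g ∘ₗ M.ι n) : f = g :=
  DirectSum.linearMap_ext R h

lemma total_induction {p : M.Total → Prop} (x : M.Total) (zero : p 0)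
    (add : ∀ x y, p x → p y → p (x + y)) (ι : ∀ n x, p (M.ι n x)) : p x :=
  DirectSum.induction_on x zero ι add

lemma sum_ι_π (x : M.Total) : ∃ s : Finset ℕ, x = ∑ n ∈ s, M.ι n (M.π n x) := by
  classical
  exact ⟨_, (DirectSum.sum_support_of x).symm⟩

/-- The linear map induced by maps of the components. -/
def fromTotal {N : Type*} [AddCommMonoid N] [Module R N] (f : ∀ n : ℕ, M.H n →ₗ[R] N) :
    M.Total →ₗ[R] N :=
  DirectSum.toModule R ℕ N f

lemma fromTotal_ι {N : Type*} [AddCommMonoid N] [Module R N] (f : ∀ n : ℕ, M.H n →ₗ[R] N) (n : ℕ)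
    (x : M.H n) : fromTotal f (M.ι n x) = f n x :=
  DirectSum.toModule_lof ..

variable (M)

/-- The action of an operator on the direct sum. -/
def chi (k : κ) : Module.End R M.Total :=
  fromTotal fun n => M.ι (n + 2) ∘ₗ M.op k n (n + 2 : ℕ) (by push_cast; rfl)

variable {M}

lemma chi_ι (k : κ) (n : ℕ) (x : M.H n) :
    M.chi k (M.ι n x) = M.ι (n + 2) (M.op k n (n + 2 : ℕ) (by push_cast; rfl) x) :=
  fromTotal_ι _ _ _

lemma chi_comm (k l : κ) : M.chi k * M.chi l = M.chi l * M.chi k := by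
  refine hom_ext fun n => LinearMap.ext fun x => ?_
  simp only [LinearMap.comp_apply, Module.End.mul_apply, chi_ι, M.op_comm k l]

variable (M)

instance : IsMulCommutative (Algebra.adjoin R (Set.range M.chi)) :=
  Algebra.isMulCommutative_adjoin _ (by
    rintro _ ⟨k, rfl⟩ _ ⟨l, rfl⟩
    exact chi_comm k l)

open scoped IsMulCommutative in
/-- The action of polynomials in the operators on the direct sum. -/
def action : MvPolynomial κ R →ₐ[R] Module.End R M.Total :=
  (Subalgebra.val (Algebra.adjoin R (Set.range M.chi))).comp
    (MvPolynomial.aeval fun k => ⟨M.chi k, Algebra.subset_adjoin ⟨k, rfl⟩⟩)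

lemma action_X (k : κ) : M.action (MvPolynomial.X k) = M.chi k := by
  simp [action]

instance : Module (MvPolynomial κ R) M.Total := Module.compHom _ M.action.toRingHom

lemma smul_def (p : MvPolynomial κ R) (x : M.Total) : p • x = M.action p x := rfl

lemma X_smul (k : κ) (x : M.Total) : (MvPolynomial.X k : MvPolynomial κ R) • x = M.chi k x := by
  rw [smul_def, action_X]

instance : IsScalarTower R (MvPolynomial κ R) M.Total where
  smul_assoc r p x := by simp [smul_def]

lemma C_smul (r : R) (x : M.Total) : (MvPolynomial.C r : MvPolynomial κ R) • x = r • x := by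
  rw [← MvPolynomial.algebraMap_eq, algebraMap_smul]

variable {M}

/-- A linear map commuting with the operators is linear over polynomials. -/
def polyLinear {N : OpModule R κ} (f : M.Total →ₗ[R] N.Total)
    (hf : ∀ k x, f (M.chi k x) = N.chi k (f x)) : M.Total →ₗ[MvPolynomial κ R] N.Total where
  toFun := f
  map_add' := f.map_add
  map_smul' p x := by
    induction p using MvPolynomial.induction_on generalizing x with
    | C r => simp [C_smul]
    | add p q hp hq => simp only [add_smul, map_add, hp, hq, RingHom.id_apply]
    | mul_X p k hp => simp only [mul_smul, hp, X_smul, hf, RingHom.id_apply]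

/-- The map of direct sums induced by maps of degree `m` that commute with the operators. -/
def totalMap {N : OpModule R κ} (m : ℕ) (F : ∀ i j : ℤ, i + m = j → M.H i →ₗ[R] N.H j)
    (hF : ∀ k i i' j j' hi hj hij hij' x, F i' j' hij' (M.op k i i' hi x) =
      N.op k j j' hj (F i j hij x)) : M.Total →ₗ[MvPolynomial κ R] N.Total :=
  polyLinear (fromTotal fun n => N.ι (n + m) ∘ₗ F n (n + m : ℕ) (by push_cast; rfl)) fun k x => by
    induction x using total_induction with
    | zero => simp
    | add x y hx hy => simp only [map_add, hx, hy]
    | ι n x =>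
      simp only [chi_ι, fromTotal_ι, LinearMap.comp_apply]
      have key : ∀ (a b : ℕ) (h : a = b) (ha : ((n + 2 : ℕ) : ℤ) + m = (a : ℕ))
          (hb : ((n + m : ℕ) : ℤ) + 2 = (b : ℕ)),
          N.ι a (F _ _ ha (M.op k n (n + 2 : ℕ) (by push_cast; rfl) x)) =
            N.ι b (N.op k (n + m : ℕ) _ hb (F n (n + m : ℕ) (by push_cast; rfl) x)) := by
        rintro a b rfl ha hb
        rw [hF k _ _ _ _ (by push_cast; rfl) hb]
      exact key _ _ (by lia) _ _

lemma totalMap_ι {N : OpModule R κ} (m : ℕ) (F : ∀ i j : ℤ, i + m = j → M.H i →ₗ[R] N.H j)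
    (hF) (n : ℕ) (x : M.H n) : totalMap m F hF (M.ι n x) =
      N.ι (n + m) (F n (n + m : ℕ) (by push_cast; rfl) x) :=
  fromTotal_ι _ _ _

lemma π_totalMap {N : OpModule R κ} (m : ℕ) (F : ∀ i j : ℤ, i + m = j → M.H i →ₗ[R] N.H j)
    (hF) (n : ℕ) (x : M.Total) : N.π (n + m) (totalMap m F hF x) =
      F n (n + m : ℕ) (by push_cast; rfl) (M.π n x) := by
  induction x using total_induction with
  | zero => simp
  | add x y hx hy => simp only [map_add, hx, hy]
  | ι l x =>
    rw [totalMap_ι]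
    by_cases h : l = n
    · subst h
      rw [π_ι, π_ι]
    · rw [π_ι_of_ne h, π_ι_of_ne (by lia), map_zero]

lemma π_chi (k : κ) (n : ℕ) (x : M.Total) : M.π (n + 2) (M.chi k x) =
    M.op k n (n + 2 : ℕ) (by push_cast; rfl) (M.π n x) := by
  induction x using total_induction with
  | zero => simp
  | add x y hx hy => simp only [map_add, hx, hy]
  | ι l x =>
    rw [chi_ι]
    by_cases h : l = n
    · subst h
      rw [π_ι, π_ι]
    · rw [π_ι_of_ne h, π_ι_of_ne (by lia), map_zero]

lemma π_chi_of_lt (k : κ) {n : ℕ} (hn : n < 2) (x : M.Total) : M.π n (M.chi k x) = 0 := by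
  induction x using total_induction with
  | zero => simp
  | add x y hx hy => simp only [map_add, hx, hy, add_zero]
  | ι l x => rw [chi_ι, π_ι_of_ne (by lia)]

end OpModule

end TotallyAcyclic

namespace TotallyAcyclic

namespace OpModule

open MvPolynomial

variable {R : Type u} [CommRing R] {κ : Type} {M N : OpModule R κ}

variable (M) in
/-- The submodule generated by the components of degree at most `d`. -/
def low (d : ℕ) : Submodule (MvPolynomial κ R) M.Total :=
  Submodule.span _ {x | ∃ n ≤ d, ∃ y, x = M.ι n y}

lemma ι_mem_low {n d : ℕ} (h : n ≤ d) (y : M.H n) : M.ι n y ∈ M.low d :=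
  Submodule.subset_span ⟨n, h, y, rfl⟩

lemma low_mono {d e : ℕ} (h : d ≤ e) : M.low d ≤ M.low e :=
  Submodule.span_mono fun _ ⟨n, hn, hy⟩ => ⟨n, hn.trans h, hy⟩

lemma smul_mem_low {d : ℕ} (r : R) {x : M.Total} (hx : x ∈ M.low d) : r • x ∈ M.low d := by
  rw [← M.C_smul]
  exact (M.low d).smul_mem _ hx

/-- The submodule `low d` is graded. -/
lemma ι_π_mem_low {d : ℕ} {x : M.Total} (hx : x ∈ M.low d) (n : ℕ) :
    M.ι n (M.π n x) ∈ M.low d := by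
  refine Submodule.span_induction (p := fun x _ => ∀ n, M.ι n (M.π n x) ∈ M.low d) ?_ ?_ ?_ ?_ hx n
  · rintro _ ⟨m, hm, y, rfl⟩ n
    by_cases h : m = n
    · subst h
      rw [π_ι]
      exact ι_mem_low hm y
    · rw [π_ι_of_ne h, map_zero]
      exact zero_mem _
  · simp
  · intro x y _ _ hx hy n
    rw [map_add, map_add]
    exact add_mem (hx n) (hy n)
  · intro p x _ hx
    induction p using MvPolynomial.induction_on with
    | C r =>
      intro n
      rw [M.C_smul, map_smul, map_smul]
      exact smul_mem_low r (hx n)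
    | add p q hp hq =>
      intro n
      rw [add_smul, map_add, map_add]
      exact add_mem (hp n) (hq n)
    | mul_X p k hp =>
      intro n
      rw [mul_comm, mul_smul, M.X_smul]
      rcases lt_or_ge n 2 with h | h
      · rw [π_chi_of_lt k h, map_zero]
        exact zero_mem _
      · obtain ⟨n, rfl⟩ := Nat.exists_eq_add_of_le' h
        rw [π_chi, ← chi_ι, ← X_smul]
        exact (M.low d).smul_mem _ (hp n)

lemma fg_low (hM : ∀ n : ℕ, Module.Finite R (M.H n)) (d : ℕ) : (M.low d).FG := by
  choose s hs using fun n => (hM n).fg_top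
  have h : M.low d = Submodule.span _
      (⋃ n ∈ Finset.range (d + 1), M.ι n '' (s n : Set (M.H n))) := by
    apply le_antisymm
    · rw [low, Submodule.span_le]
      rintro _ ⟨n, hn, y, rfl⟩
      have hy : y ∈ Submodule.span R (s n : Set (M.H n)) := by rw [hs]; trivial
      induction hy using Submodule.span_induction with
      | mem x hx =>
        exact Submodule.subset_span (Set.mem_biUnion (by simpa using hn) ⟨x, hx, rfl⟩)
      | zero => simp
      | add x y _ _ hx hy =>
        rw [map_add]
        exact add_mem hx hy
      | smul r x _ hx =>
        rw [map_smul, ← M.C_smul]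
        exact Submodule.smul_mem _ _ hx
    · rw [Submodule.span_le]
      intro x hx
      simp only [Set.mem_iUnion] at hx
      obtain ⟨n, hn, y, hy, rfl⟩ := hx
      exact ι_mem_low (by simpa using hn) y
  rw [h]
  exact Submodule.fg_span (Set.Finite.biUnion (Finset.finite_toSet _)
    fun n _ => (s n).finite_toSet.image _)

lemma sum_op_smul [Fintype κ] (c : κ → R) (n : ℕ) (β : M.H n) :
    (∑ k, C (c k) * X k : MvPolynomial κ R) • M.ι n β = M.ι (n + 2)
      (∑ k, c k • M.op k n (n + 2 : ℕ) (by push_cast; rfl) β) := by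
  rw [Finset.sum_smul, map_sum]
  exact Finset.sum_congr rfl fun k _ => by rw [mul_smul, M.X_smul, chi_ι, M.C_smul, map_smul]

variable [Fintype κ]

/-- If the kernel of a map of graded modules to a finitely generated one consists of multiples of an
element of positive degree, then the source is finitely generated. -/
lemma finite_of_ker [IsNoetherianRing R] [Module.Finite (MvPolynomial κ R) N.Total]
    (hM : ∀ n : ℕ, Module.Finite R (M.H n)) (F : ∀ i j : ℤ, i + (0 : ℕ) = j → M.H i →ₗ[R] N.H j)
    (hF : ∀ k i i' j j' hi hj hij hij' x, F i' j' hij' (M.op k i i' hi x) =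
      N.op k j j' hj (F i j hij x)) (c : κ → R)
    (hker : ∀ i j (h : i + 2 = j) (x : M.H j), F j j (by simp) x = 0 →
      ∃ y : M.H i, x = ∑ k, c k • M.op k i j h y) :
    Module.Finite (MvPolynomial κ R) M.Total := by
  let f := totalMap 0 F hF
  -- The images of the submodules `low d` become stationary. The components of degree above `d + 1`
  -- are then generated, by induction, by the lower ones.
  obtain ⟨d, hd⟩ := monotone_stabilizes_iff_noetherian.2
    (inferInstanceAs (IsNoetherian (MvPolynomial κ R) N.Total))
    ⟨fun d => (M.low d).map f, fun _ _ h => Submodule.map_mono (low_mono h)⟩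
  have key : ∀ n x, M.ι n x ∈ M.low (d + 1) := fun n => by
    induction n using Nat.strong_induction_on with
    | _ n ih =>
      intro x
      rcases le_or_gt n (d + 1) with h | h
      · exact ι_mem_low h x
      obtain ⟨n, rfl⟩ := Nat.exists_eq_add_of_le' (show 2 ≤ n by lia)
      have h1 : f (M.ι _ x) ∈ (M.low (d + 1)).map f := by
        have e : (M.low d).map f = (M.low (d + 1)).map f := hd (d + 1) (by lia)
        have e' : (M.low d).map f = (M.low (n + 2)).map f := hd (n + 2) (by lia)
        rw [← e, e']
        exact ⟨_, ι_mem_low le_rfl x, rfl⟩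
      obtain ⟨y, hy, hxy⟩ := h1
      have h2 : F (n + 2 : ℕ) (n + 2 : ℕ) (by simp) (x - M.π (n + 2) y) = 0 := by
        have h3 := congrArg (N.π (n + 2 + 0)) hxy
        rw [π_totalMap, π_totalMap, π_ι] at h3
        rw [map_sub, sub_eq_zero]
        exact h3.symm
      obtain ⟨β, hβ⟩ := hker n (n + 2 : ℕ) (by push_cast; rfl) _ h2
      rw [← sub_add_cancel x (M.π (n + 2) y), map_add, hβ, ← sum_op_smul]
      exact add_mem (Submodule.smul_mem _ _ (ih n (by lia) β)) (ι_π_mem_low hy _)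
  refine ⟨?_⟩
  rw [← show M.low (d + 1) = ⊤ from ?_]
  · exact fg_low hM _
  · rw [eq_top_iff]
    rintro x -
    obtain ⟨s, hs⟩ := sum_ι_π x
    rw [hs]
    exact sum_mem fun n _ => key _ _

end OpModule

end TotallyAcyclic

/-! ### Elements of the support -/

namespace TotallyAcyclic

/-- If multiplication by `q` maps a finitely generated module into its product with an ideal, then
the module is annihilated by a power of `q`, up to an element of the ideal. -/
lemma exists_pow_add_smul_eq_zero {A M : Type*} [CommRing A] [AddCommGroup M] [Module A M]
    [Module.Finite A M] (I : Ideal A) (q : A) (h : ∀ x : M, q • x ∈ I • (⊤ : Submodule A M)) :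
    ∃ y ∈ I, ∃ n : ℕ, ∀ x : M, (q ^ n + y) • x = 0 := by
  obtain ⟨p, hp, -, hc, h0⟩ :=
    LinearMap.exists_monic_and_natDegree_eq_and_coeff_mem_pow_and_aeval_eq_zero A
      (LinearMap.lsmul A M q) I (by rintro _ ⟨x, rfl⟩; exact h x)
  refine ⟨∑ i ∈ Finset.range p.natDegree, p.coeff i * q ^ i, sum_mem fun i hi => ?_, p.natDegree,
    fun x => ?_⟩
  · rw [Finset.mem_range] at hi
    exact I.mul_mem_right _ (Ideal.pow_le_self (by lia) (hc i))
  · have h1 : (q ^ p.natDegree + ∑ i ∈ Finset.range p.natDegree, p.coeff i * q ^ i) =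
        p.eval q := by
      rw [Polynomial.eval_eq_sum_range, Finset.sum_range_succ, hp.coeff_natDegree, one_mul,
        add_comm]
    rw [h1]
    have h2 : Polynomial.aeval (LinearMap.lsmul A M q) p = LinearMap.lsmul A M (p.eval q) := by
      have := Polynomial.aeval_algHom_apply (Algebra.lsmul A A M) q p
      exact this
    exact (LinearMap.congr_fun h2 x).symm.trans (LinearMap.congr_fun h0 x)

namespace OpModule

open MvPolynomial

variable {R : Type u} [CommRing R] {κ : Type} {M N : OpModule R κ}
  {k : Type*} [Field k] (ρ : R →+* k) (b : κ → k)

variable (M) in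
/-- Some polynomial that does not vanish at `b` annihilates the module: the point `b` is not in the
support. -/
def IsKilled : Prop := ∃ p : MvPolynomial κ R, eval₂Hom ρ b p ≠ 0 ∧ ∀ x : M.Total, p • x = 0

variable {ρ b}

variable [Fintype κ]

/-- If the kernel of a map to `N` consists of multiples of an operator that vanishes at `b`, and `b`
is outside of the support of `N`, then `b` is outside of the support of `M`: some `q`
with `q(b) ≠ 0` maps `M` into the multiples of the operator, and the Cayley–Hamilton theorem
applies. -/
lemma isKilled_of_isKilled [Module.Finite (MvPolynomial κ R) M.Total]
    (F : ∀ i j : ℤ, i + (0 : ℕ) = j → M.H i →ₗ[R] N.H j)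
    (hF : ∀ k i i' j j' hi hj hij hij' x, F i' j' hij' (M.op k i i' hi x) =
      N.op k j j' hj (F i j hij x)) (c : κ → R) (hc : ∑ l, ρ (c l) * b l = 0)
    (hker : ∀ i j (h : i + 2 = j) (x : M.H j), F j j (by simp) x = 0 →
      ∃ y : M.H i, x = ∑ k, c k • M.op k i j h y) (hb : b ≠ 0) (h : N.IsKilled ρ b) :
    M.IsKilled ρ b := by
  obtain ⟨p, hp, hpx⟩ := h
  obtain ⟨l, hl⟩ := Function.ne_iff.1 hb
  let f := totalMap 0 F hF
  let θ : MvPolynomial κ R := ∑ k, C (c k) * X k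
  have hθ : eval₂Hom ρ b θ = 0 := by
    rw [map_sum, ← hc]
    exact Finset.sum_congr rfl fun k _ => by simp
  -- The factor `X l` makes up for the element `β` of degree `n - 2` below, which may be negative.
  obtain ⟨y, hy, n, hn⟩ := exists_pow_add_smul_eq_zero (M := M.Total) (Ideal.span {θ})
    (X l * p) fun x => by
      have h0 : f (p • x) = 0 := by rw [map_smul, hpx]
      obtain ⟨s, hs⟩ := sum_ι_π (p • x)
      rw [mul_smul, hs, Finset.smul_sum]
      refine sum_mem fun n _ => ?_
      obtain ⟨β, hβ⟩ := hker ((n : ℤ) - 2) n (by lia) (M.π n (p • x)) (by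
        have h1 := congrArg (N.π (n + 0)) h0
        rwa [π_totalMap, map_zero] at h1)
      have h2 : (X l : MvPolynomial κ R) • M.ι n (M.π n (p • x)) =
          θ • M.ι n (M.op l (n - 2) n (by lia) β) := by
        rw [sum_op_smul, M.X_smul, chi_ι, hβ, map_sum]
        congr 1
        exact Finset.sum_congr rfl fun k _ => by rw [map_smul, M.op_comm l k]
      rw [h2]
      exact Submodule.smul_mem_smul (Ideal.mem_span_singleton_self θ) trivial
  refine ⟨_, ?_, hn⟩
  obtain ⟨z, rfl⟩ := Ideal.mem_span_singleton'.1 hy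
  rw [map_add, map_mul _ z, hθ, mul_zero, add_zero, map_pow, map_mul]
  exact pow_ne_zero _ (mul_ne_zero (by simpa using hl) hp)

omit [Fintype κ] in
/-- If `N` is the middle term of an exact sequence `M → N → M` of graded modules and `b` is outside
of the support of `M`, then `b` is outside of the support of `N`. -/
lemma isKilled_of_isKilled'
    (F : ∀ i j : ℤ, i + (0 : ℕ) = j → M.H i →ₗ[R] N.H j)
    (hF : ∀ k i i' j j' hi hj hij hij' x, F i' j' hij' (M.op k i i' hi x) =
      N.op k j j' hj (F i j hij x))
    (B : ∀ i j : ℤ, j + 1 = i → N.H i →ₗ[R] M.H j)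
    (hB : ∀ k i i' j j' hi hj hij hij' x, B i' j' hij' (N.op k i i' hi x) =
      M.op k j j' hj (B i j hij x))
    (hker : ∀ i j (h : j + 1 = i) (x : N.H i), B i j h x = 0 →
      ∃ y : M.H i, x = F i i (by simp) y) (hb : b ≠ 0) (h : M.IsKilled ρ b) :
    N.IsKilled ρ b := by
  obtain ⟨p, hp, hpx⟩ := h
  obtain ⟨l, hl⟩ := Function.ne_iff.1 hb
  let f := totalMap 0 F hF
  -- `B` has degree `-1`; composing it with an operator avoids negative degrees.
  let g := totalMap 1 (fun i j h => B (i + 2) j (by lia) ∘ₗ N.op l i (i + 2) rfl)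
    (fun k i i' j j' hi hj hij hij' x => by
      subst hi
      simp only [LinearMap.comp_apply]
      rw [N.op_comm l k]
      exact hB ..)
  have hfg : ∀ x : N.Total, g x = 0 → ∃ y, (X l : MvPolynomial κ R) • x = f y := fun x hx => by
    obtain ⟨s, hs⟩ := sum_ι_π x
    have h1 : ∀ n : ℕ, ∃ y, (X l : MvPolynomial κ R) • N.ι n (N.π n x) = f y := fun n => by
      have h2 := congrArg (M.π (n + 1)) hx
      rw [π_totalMap, map_zero] at h2
      obtain ⟨y, hy⟩ := hker _ _ _ _ h2
      refine ⟨M.ι (n + 2) y, ?_⟩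
      rw [N.X_smul, chi_ι, totalMap_ι]
      exact congrArg (N.ι (n + 2)) hy
    choose y hy using h1
    refine ⟨∑ n ∈ s, y n, ?_⟩
    rw [map_sum, hs, Finset.smul_sum]
    exact Finset.sum_congr rfl fun n _ => hy n
  refine ⟨p * (X l * p), ?_, fun x => ?_⟩
  · rw [map_mul, map_mul]
    exact mul_ne_zero hp (mul_ne_zero (by simpa using hl) hp)
  · obtain ⟨y, hy⟩ := hfg (p • x) (by rw [map_smul, hpx])
    rw [mul_smul, mul_smul, hy, ← map_smul, hpx, map_zero]

section Base

omit [Fintype κ]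

lemma exists_pow_smul_chi_ι (u : R) (l : κ) (e n : ℕ) (x : M.H n) :
    ∃ z, ((u • M.chi l) ^ e) (M.ι n x) = M.ι (n + 2 * e) z := by
  induction e with
  | zero => exact ⟨x, rfl⟩
  | succ e ih =>
    obtain ⟨z, hz⟩ := ih
    rw [pow_succ', Module.End.mul_apply, hz, LinearMap.smul_apply, chi_ι, ← map_smul]
    exact ⟨_, rfl⟩

lemma exists_ι_eq_pow_smul_chi {u : R} {l : κ}
    (h : ∀ i j (hij : i + 2 = j) (y : M.H j), ∃ x, y = u • M.op l i j hij x) (e n : ℕ)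
    (y : M.H (n + 2 * e : ℕ)) : ∃ x, M.ι (n + 2 * e) y = ((u • M.chi l) ^ e) (M.ι n x) := by
  induction e with
  | zero => exact ⟨y, rfl⟩
  | succ e ih =>
    obtain ⟨z, hz⟩ := h (n + 2 * e : ℕ) (n + 2 * (e + 1) : ℕ) (by push_cast; ring) y
    obtain ⟨x, hx⟩ := ih z
    refine ⟨x, ?_⟩
    rw [pow_succ', Module.End.mul_apply, ← hx, LinearMap.smul_apply, chi_ι, ← map_smul]
    exact congrArg (M.ι _) hz

/-- When all the operators are multiples of a single surjective one, a point on the corresponding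
line is outside of the support if and only if the module vanishes in high degrees. -/
lemma isKilled_iff_of_surjective (hρ : ∀ r, ρ r ≠ 0 → IsUnit r) {a : κ → R} {u : R} {l : κ}
    (hop : ∀ k i j (hij : i + 2 = j) x, M.op k i j hij x = a k • u • M.op l i j hij x)
    (hsurj : ∀ i j (hij : i + 2 = j) (y : M.H j), ∃ x, y = u • M.op l i j hij x)
    (hb : (fun k => ρ (a k)) ≠ 0) :
    M.IsKilled ρ (fun k => ρ (a k)) ↔ ∃ m : ℕ, ∀ n : ℕ, m ≤ n → Subsingleton (M.H n) := by
  have hchi : ∀ k x, M.chi k x = a k • (u • M.chi l) x := fun k x => by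
    induction x using total_induction with
    | zero => simp
    | add x y hx hy => simp only [map_add, hx, hy, smul_add]
    | ι n x =>
      rw [LinearMap.smul_apply, chi_ι, chi_ι, ← map_smul, ← map_smul, hop]
  constructor
  · rintro ⟨p, hp, hpx⟩
    -- All polynomials act through polynomials in one variable.
    let ev : MvPolynomial κ R →ₐ[R] Polynomial R :=
      aeval fun k => Polynomial.C (a k) * Polynomial.X
    have hev : ∀ p x, p • x = Polynomial.aeval (u • M.chi l) (ev p) x := fun p x => by
      induction p using MvPolynomial.induction_on generalizing x with
      | C r => simp [ev, M.C_smul]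
      | add p q hp hq => rw [add_smul, map_add, map_add, LinearMap.add_apply, hp, hq]
      | mul_X p k hp =>
        rw [mul_smul, M.X_smul, hp, map_mul, map_mul, Module.End.mul_apply]
        rw [hchi]
        simp [ev, smul_comm u]
    obtain ⟨d, hd⟩ : ∃ d, ρ ((ev p).coeff d) ≠ 0 := by
      by_contra! hcon
      refine hp ?_
      have h1 : eval₂Hom ρ (fun k => ρ (a k)) p = ρ ((ev p).eval 1) := by
        have : eval₂Hom ρ (fun k => ρ (a k)) =
            ρ.comp ((Polynomial.evalRingHom 1).comp ev.toRingHom) :=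
          MvPolynomial.ringHom_ext (by simp [ev]) (by simp [ev])
        rw [this]
        rfl
      rw [h1, Polynomial.eval_eq_sum_range, map_sum]
      exact Finset.sum_eq_zero fun e _ => by rw [map_mul, hcon, zero_mul]
    have hu := hρ _ hd
    refine ⟨2 * d, fun n hn => ?_⟩
    obtain ⟨n, rfl⟩ := Nat.exists_eq_add_of_le' hn
    refine subsingleton_of_forall_eq 0 fun y => ?_
    obtain ⟨x, hx⟩ := exists_ι_eq_pow_smul_chi hsurj d n y
    have h2 := hpx (M.ι n x)
    rw [hev, Polynomial.aeval_endomorphism, Polynomial.sum] at h2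
    have h3 := congrArg (M.π (n + 2 * d)) h2
    rw [map_sum, map_zero, Finset.sum_eq_single d] at h3
    · rwa [← hx, map_smul, π_ι, hu.smul_eq_zero] at h3
    · intro e _ he
      obtain ⟨z, hz⟩ := exists_pow_smul_chi_ι u l e n x
      rw [hz, map_smul, π_ι_of_ne (by lia), smul_zero]
    · intro hd'
      rw [Polynomial.notMem_support_iff.1 hd', zero_smul, map_zero]
  · rintro ⟨m, hm⟩
    obtain ⟨k, hk⟩ := Function.ne_iff.1 hb
    refine ⟨X k ^ m, by simpa using pow_ne_zero m hk, fun x => ?_⟩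
    induction x using total_induction with
    | zero => simp
    | add x y hx hy => rw [smul_add, hx, hy, add_zero]
    | ι n x =>
      obtain ⟨z, hz⟩ := exists_pow_smul_chi_ι 1 k m n x
      rw [smul_def, map_pow, action_X, ← one_smul R (M.chi k), hz]
      have := hm (n + 2 * m) (by lia)
      rw [Subsingleton.elim z 0, map_zero]

end Base

end OpModule

end TotallyAcyclic

/-! ### Homomorphisms in the homotopy category as graded modules -/

namespace TotallyAcyclic

open CochainComplex.HomComplex

variable {A : Type u} [CommRing A] {D : CochainComplex (ModuleCat.{u} A) ℤ}

section Module

variable {κ : Type} {s : κ → KHom D D 2}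
  (hs : ∀ k l, (s k).comp (s l) (show (2 : ℤ) + 2 = 4 by norm_num) =
    (s l).comp (s k) (show (2 : ℤ) + 2 = 4 by norm_num))

/-- The homotopy classes of maps `K ⟶ Σⁱ D`, on which commuting classes `s k : D ⟶ Σ² D` act by
composition on the side of `D`. -/
def khomModule (K : CochainComplex (ModuleCat.{u} A) ℤ) : OpModule A κ where
  H i := KHom K D i
  op k i j h :=
    { toFun := fun α => α.comp (s k) ((add_comm 2 i).trans h)
      map_add' := fun _ _ => ShiftedHom.add_comp _ _ _ _
      map_smul' := fun _ _ => ShiftedHom.smul_comp _ _ _ _ }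
  op_comm k l i j m hij hjm x := by
    simp only [LinearMap.coe_mk, AddHom.coe_mk]
    rw [ShiftedHom.comp_assoc _ _ _ _ (show (2 : ℤ) + 2 = 4 by norm_num) (by lia),
      ShiftedHom.comp_assoc _ _ _ _ (show (2 : ℤ) + 2 = 4 by norm_num) (by lia), hs]

lemma khomModule_op {K : CochainComplex (ModuleCat.{u} A) ℤ} (k : κ) (i j : ℤ) (h : i + 2 = j)
    (x : KHom K D i) : (khomModule hs K).op k i j h x = x.comp (s k) ((add_comm 2 i).trans h) :=
  rfl

/-- Composition with a class `K' ⟶ Σᵐ K`. -/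
def leftComp {K K' : CochainComplex (ModuleCat.{u} A) ℤ} {m : ℤ} (z : KHom K' K m) (i j : ℤ)
    (h : i + m = j) : (khomModule hs K).H i →ₗ[A] (khomModule hs K').H j where
  toFun α := z.comp (show KHom K D i from α) h
  map_add' _ _ := ShiftedHom.comp_add _ _ _ _
  map_smul' _ _ := ShiftedHom.comp_smul _ _ _ _

lemma leftComp_op {K K' : CochainComplex (ModuleCat.{u} A) ℤ} {m : ℤ} (z : KHom K' K m) (k : κ)
    (i i' j j' : ℤ) (hi : i + 2 = i') (hj : j + 2 = j') (hij : i + m = j) (hij' : i' + m = j')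
    (x : (khomModule hs K).H i) : leftComp hs z i' j' hij' ((khomModule hs K).op k i i' hi x) =
      (khomModule hs K').op k j j' hj (leftComp hs z i j hij x) :=
  (ShiftedHom.comp_assoc z (show KHom K D i from x) (s k) hij ((add_comm 2 i).trans hi)
    (by lia)).symm

end Module

section Finite

variable {K : CochainComplex (ModuleCat.{u} A) ℤ}

/-- Over a noetherian ring the homotopy classes of maps between totally acyclic complexes form a
finitely generated module, as they are determined by a single component. -/
lemma finite_KHom [IsNoetherianRing A] (hK : IsTotallyAcyclic K) (hD : IsTotallyAcyclic D) (i : ℤ) :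
    Module.Finite A (KHom K D i) := by
  have := hK.free
  have := hK.finite
  have := hD.free
  have := hD.finite
  have (n : ℤ) : Module.Projective A (D.X n) := hD.projective n
  have (n : ℤ) : Module.Projective A (K.X n) := hK.projective n
  have hf : Module.Finite A (K.X 0 ⟶ D.X (0 + i)) :=
    Module.Finite.equiv (ModuleCat.homLinearEquiv (S := A)).symm
  let v : Cocycle K D i →ₗ[A] (K.X 0 ⟶ D.X (0 + i)) :=
    { toFun := fun z => z.1.v 0 (0 + i) rfl
      map_add' := fun _ _ => rfl
      map_smul' := fun _ _ => rfl }
  let p : Cocycle K D i →ₗ[A] KHom K D i :=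
    { toFun := cls
      map_add' := cls_add
      map_smul' := cls_smul }
  have hp : LinearMap.ker v ≤ LinearMap.ker p := fun z hz =>
    cls_eq_zero_of_v_eq_zero (fun b => elemExact_of_acyclic hD.acyclic b)
      (fun a b => hK.homExact (D.X b) a) rfl z hz
  have : Module.Finite A (Cocycle K D i ⧸ LinearMap.ker v) :=
    Module.Finite.equiv v.quotKerEquivRange.symm
  refine Module.Finite.of_surjective ((LinearMap.ker v).liftQ p hp) fun y => ?_
  obtain ⟨z, rfl⟩ := cls_surjective y
  exact ⟨Submodule.Quotient.mk z, rfl⟩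

end Finite

section Family

variable {Q : Type u} [CommRing Q] {φ : Q →+* A} {κ : Type} [Fintype κ] {g : κ → Q}

variable (φ g) in
/-- The classes `θ l` are the Eisenbud operators of `D` with respect to the family `g`. -/
def IsEisenbudFamily (θ : κ → KHom D D 2) : Prop :=
  ∃ (P : MatSeq Q) (r : Realization φ P D) (T : κ → ∀ p q, Matrix (P.ι q) (P.ι p) Q),
    (∀ n, P.d (n + 1) * P.d n = ∑ k, g k • T k n (n + 1 + 1)) ∧
      ∀ k, ∃ t : Cocycle D D 2, (∀ p q h, t.1.v p q h = r.hom r (T k p q)) ∧ cls t = θ k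

lemma IsEisenbudFamily.comp_comm {θ : κ → KHom D D 2} (hθ : IsEisenbudFamily φ g θ)
    (hφ : Function.Surjective φ)
    (hrel : ∀ x : κ → Q, ∑ k, g k * x k = 0 → ∀ k, x k ∈ RingHom.ker φ)
    (hker : RingHom.ker φ = Ideal.span (Set.range g))
    {K : CochainComplex (ModuleCat.{u} A) ℤ} {P : MatSeq Q} (r : Realization φ P K)
    {T : κ → ∀ p q, Matrix (P.ι q) (P.ι p) Q}
    (hT : ∀ n, P.d (n + 1) * P.d n = ∑ k, g k • T k n (n + 1 + 1)) (k : κ)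
    (t : Cocycle K K 2) (ht : ∀ p q h, t.1.v p q h = r.hom r (T k p q))
    {i j : ℤ} (hij : i + 2 = j) (β : KHom K D i) :
    (cls t).comp β hij = β.comp (θ k) ((add_comm 2 i).trans hij) := by
  obtain ⟨P', r', T', hT', h⟩ := hθ
  obtain ⟨t', ht', h'⟩ := h k
  rw [← h']
  exact r.cls_comp_comm r' hφ hrel hker hT hT' k t ht t' ht' hij β

end Family

end TotallyAcyclic

/-! ### Intermediate complete intersections -/

namespace TotallyAcyclic

open CochainComplex.HomComplex

section Level

variable {Q : Type u} [CommRing Q]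

/-- The reduction modulo `J` of a sequence of matrices is a totally acyclic complex. -/
structure MatSeq.TotallyAcyclicMod (P : MatSeq Q) (J : Ideal Q) : Prop where
  isComplexMod : P.IsComplexMod J
  exactMod n : P.ExactMod (fun _ _ => True) J n
  dualExactMod n : P.DualExactMod J n

namespace MatSeq.TotallyAcyclicMod

variable {P : MatSeq Q} {J : Ideal Q} {x : Q}

lemma sup (h : P.TotallyAcyclicMod J) (hx : ∀ r, x * r ∈ J → r ∈ J) :
    P.TotallyAcyclicMod (J ⊔ Ideal.span {x}) where
  isComplexMod n i j := Ideal.mem_sup_left (h.isComplexMod n i j)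
  exactMod := exactMod_sup hx h.isComplexMod h.exactMod
  dualExactMod := dualExactMod_sup hx h.isComplexMod h.dualExactMod

lemma step (h : P.TotallyAcyclicMod (J ⊔ Ideal.span {x})) (hx : ∀ r, x * r ∈ J → r ∈ J)
    {t : ∀ n, Matrix (P.ι (n + 1 + 1)) (P.ι n) Q}
    (ht : ∀ n i j, (P.d (n + 1) * P.d n - x • t n) i j ∈ J) :
    (P.step x t).TotallyAcyclicMod J where
  isComplexMod := isComplexMod_step hx ht
  exactMod n v hv := by
    obtain ⟨u, hu⟩ := exactMod_step hx ht (S := fun _ _ => True)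
      (fun n i j _ hj => absurd trivial hj) (h.exactMod n) v fun i _ => hv i trivial
    refine ⟨u, ?_⟩
    rintro (i | i) -
    · exact hu (Sum.inl i) trivial
    · exact hu (Sum.inr i) trivial
  dualExactMod n := dualExactMod_step hx ht (h.dualExactMod (n + 1))

end MatSeq.TotallyAcyclicMod

variable {P : MatSeq Q} {κ : Type} [DecidableEq κ] {g : κ → Q}

lemma span_image_insert (g : κ → Q) (l : κ) (s : Finset κ) :
    Ideal.span (g '' (insert l s : Finset κ)) = Ideal.span (g '' s) ⊔ Ideal.span {g l} := by
  rw [Finset.coe_insert, Set.image_insert_eq, Ideal.span_insert, sup_comm]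

omit [DecidableEq κ] in
lemma span_image_le (g : κ → Q) (s : Finset κ) :
    Ideal.span (g '' s) ≤ Ideal.span (Set.range g) :=
  Ideal.span_mono (Set.image_subset_range _ _)

variable (hg : RegularFamily g)
include hg

/-- The relations between the members of a regular family have coefficients in the ideal that they
generate. -/
lemma RegularFamily.mem_of_sum_eq_zero [Fintype κ] (x : κ → Q) (hx : ∑ k, g k * x k = 0) (k : κ) :
    x k ∈ Ideal.span (Set.range g) := by
  refine span_image_le g _ (hg (Finset.univ.erase k) k (Finset.notMem_erase _ _) _ ?_)
  rw [← Finset.add_sum_erase _ _ (Finset.mem_univ k)] at hx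
  rw [eq_neg_of_add_eq_zero_left hx]
  exact neg_mem (sum_mem fun l hl => Ideal.mul_mem_right _ _ (Ideal.subset_span ⟨l, hl, rfl⟩))

lemma MatSeq.TotallyAcyclicMod.union {s : Finset κ} (h : P.TotallyAcyclicMod (Ideal.span (g '' s)))
    (s' : Finset κ) : P.TotallyAcyclicMod (Ideal.span (g '' (s ∪ s' : Finset κ))) := by
  induction s' using Finset.induction_on with
  | empty => rwa [Finset.union_empty]
  | insert l s' _ ih =>
    by_cases hl : l ∈ s ∪ s'
    · rwa [Finset.union_insert, Finset.insert_eq_of_mem hl]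
    · rw [Finset.union_insert, span_image_insert]
      exact ih.sup (hg _ l hl)

variable [Fintype κ] {A : Type u} [CommRing A] {φ : Q →+* A} (hφ : Function.Surjective φ)
  (hker : RingHom.ker φ = Ideal.span (Set.range g))
include hφ hker

lemma Realization.isTotallyAcyclic {K : CochainComplex (ModuleCat.{u} A) ℤ}
    (r : Realization φ P K) {s : Finset κ} (h : P.TotallyAcyclicMod (Ideal.span (g '' s))) :
    IsTotallyAcyclic K := by
  have h' := h.union hg Finset.univ
  rw [Finset.union_eq_right.2 (Finset.subset_univ s), Finset.coe_univ, Set.image_univ,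
    ← hker] at h'
  exact (r.isTotallyAcyclic_iff hφ).2 ⟨h'.exactMod, h'.dualExactMod⟩

/-- Removing one member of the family from the relations: the matrices that are totally acyclic
modulo the smaller ideal, and their realization as a cocone. -/
lemma exists_cocone {l : κ} {s : Finset κ} (hl : l ∉ s)
    (h : P.TotallyAcyclicMod (Ideal.span (g '' (insert l s : Finset κ))))
    {K : CochainComplex (ModuleCat.{u} A) ℤ} (r : Realization φ P K) :
    ∃ T : ∀ p q, Matrix (P.ι q) (P.ι p) Q,
      (∀ n i j, (P.d (n + 1) * P.d n - g l • T n (n + 1 + 1)) i j ∈ Ideal.span (g '' s)) ∧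
      (P.step (g l) fun n => T n (n + 1 + 1)).TotallyAcyclicMod (Ideal.span (g '' s)) ∧
      (∀ S : ∀ n, P.ι n → Prop, (∀ n, MatSeq.Triangular (S n) (S (n + 1)) (P.d n)) →
        ∀ n, MatSeq.Triangular (S n) (S (n + 1 + 1)) (T n (n + 1 + 1))) ∧
      ∃ t : Cocycle K K 2,
        (∀ (D : CochainComplex (ModuleCat.{u} A) ℤ) (θ : κ → KHom D D 2),
          IsEisenbudFamily φ g θ → ∀ (i j : ℤ) (hij : i + 2 = j) (β : KHom K D i),
            (cls t).comp β hij = β.comp (θ l) ((add_comm 2 i).trans hij)) ∧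
        ∀ (K' : CochainComplex (ModuleCat.{u} A) ℤ),
          Realization φ (P.step (g l) fun n => T n (n + 1 + 1)) K' → Nonempty (Cocone t K') := by
  have hrel : ∀ x : κ → Q, ∑ k, g k * x k = 0 → ∀ k, x k ∈ RingHom.ker φ := by
    rw [hker]
    exact hg.mem_of_sum_eq_zero
  obtain ⟨T, hT, hTs, hT0⟩ := MatSeq.exists_lift_of_isComplexMod g _ h.isComplexMod
  have ht : ∀ n i j, (P.d (n + 1) * P.d n - g l • T l n (n + 1 + 1)) i j ∈
      Ideal.span (g '' s) := fun n i j => by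
    rw [hT, ← Finset.add_sum_erase _ _ (Finset.mem_univ l), add_sub_cancel_left,
      Matrix.sum_apply]
    refine sum_mem fun k hk => ?_
    by_cases hks : k ∈ s
    · exact Ideal.mul_mem_right _ _ (Ideal.subset_span ⟨k, hks, rfl⟩)
    · rw [hTs k (by simpa [Finset.ne_of_mem_erase hk] using hks)]
      simp
  obtain ⟨t, htr⟩ := r.exists_cocycle hrel hT l
  refine ⟨T l, ht, ?_, fun S hS n i j hi hj => hT0 l n i j ?_, t,
    fun D θ hθ i j hij β => hθ.comp_comm hφ hrel hker r hT l t htr hij β,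
    fun K' r' => ⟨stepCocone r r' ?_ t htr⟩⟩
  · rw [span_image_insert] at h
    exact h.step (hg s l hl) ht
  · refine Finset.sum_eq_zero fun m _ => ?_
    by_cases hm : S (n + 1) m
    · exact mul_eq_zero_of_right _ (hS n m j hm hj)
    · exact mul_eq_zero_of_left (hS (n + 1) i m hi hm) _
  · rw [← RingHom.mem_ker, hker]
    exact Ideal.subset_span ⟨l, rfl⟩

/-- The operators that belong to the members of the family outside of `s` vanish on complexes that
lift to the quotient by the members in `s`. -/
lemma comp_eq_zero_of_notMem {l : κ} {s : Finset κ} (hl : l ∉ s)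
    (h : P.TotallyAcyclicMod (Ideal.span (g '' s)))
    {K D : CochainComplex (ModuleCat.{u} A) ℤ} (r : Realization φ P K) {θ : κ → KHom D D 2}
    (hθ : IsEisenbudFamily φ g θ) {i j : ℤ} (hij : i + 2 = j) (β : KHom K D i) :
    β.comp (θ l) ((add_comm 2 i).trans hij) = 0 := by
  have hrel : ∀ x : κ → Q, ∑ k, g k * x k = 0 → ∀ k, x k ∈ RingHom.ker φ := by
    rw [hker]
    exact hg.mem_of_sum_eq_zero
  obtain ⟨T, hT, hTs, -⟩ := MatSeq.exists_lift_of_isComplexMod g _ h.isComplexMod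
  rw [← hθ.comp_comm hφ hrel hker r hT l 0 (fun p q _ => ?_) hij β, cls_zero,
    ShiftedHom.zero_comp]
  rw [hTs l hl]
  exact (r.hom_zero r).symm

end Level

end TotallyAcyclic

/-! ### Induction over the intermediate complete intersections -/

namespace TotallyAcyclic

open CochainComplex.HomComplex MvPolynomial

section Induction

variable {A : Type u} [CommRing A]

/-- The image of a differential is the cokernel of the preceding one. -/
lemma subsingleton_KHom_iff_homExact {K D : CochainComplex (ModuleCat.{u} A) ℤ}
    (hK : IsTotallyAcyclic K) (hD : IsTotallyAcyclic D) {i a b : ℤ} (hab : a + i = b) :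
    Subsingleton (KHom K D i) ↔
      HomExact K (ModuleCat.of A (LinearMap.range (D.d b (b + 1)).hom)) a := by
  have (n : ℤ) : Module.Projective A (K.X n) := hK.projective n
  have (n : ℤ) : Module.Projective A (D.X n) := hD.projective n
  rw [subsingleton_KHom_iff (fun b => elemExact_of_acyclic hD.acyclic b)
    (fun a b => hK.homExact (D.X b) a) hab]
  refine cokerExact_iff_homExact (ModuleCat.ofHom (D.d b (b + 1)).hom.rangeRestrict)
    (LinearMap.surjective_rangeRestrict _) fun x => ?_
  have h : (D.d b (b + 1)).hom.rangeRestrict x = 0 ↔ (D.d b (b + 1)).hom x = 0 := by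
    rw [← Subtype.coe_inj]
    rfl
  refine h.trans ⟨fun hx => elemExact_of_acyclic hD.acyclic b _ _ (by lia) rfl x hx, ?_⟩
  rintro ⟨y, rfl⟩
  rw [← LinearMap.comp_apply, ← ModuleCat.hom_comp, D.d_comp_d]
  rfl

variable {Q : Type u} [CommRing Q] [IsRegularLocalRing Q] {κ : Type} [Fintype κ] [DecidableEq κ]
  {g : κ → Q} (hg : RegularFamily g) {φ : Q →+* A} (hφ : Function.Surjective φ)
  (hker : RingHom.ker φ = Ideal.span (Set.range g))
  {K D : CochainComplex (ModuleCat.{u} A) ℤ} (hD : IsTotallyAcyclic D) {P : MatSeq Q}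
include hg hφ hker hD

/-- There are no nonzero maps from a complex that lifts to the regular local ring. -/
lemma subsingleton_KHom_of_empty (h : P.TotallyAcyclicMod (Ideal.span (g '' (∅ : Finset κ))))
    (r : Realization φ P K) (i : ℤ) : Subsingleton (KHom K D i) := by
  rw [subsingleton_KHom_iff_homExact (r.isTotallyAcyclic hg hφ hker h) hD
    (show (0 + 1 : ℤ) + i = 1 + i by lia), r.homExact_iff]
  rw [Finset.coe_empty, Set.image_empty, Ideal.span_empty] at h
  exact MatSeq.homCond_of_exactMod φ h.isComplexMod h.exactMod _ _

variable {χ : κ → KHom D D 2}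
  (hχ : ∀ k l, (χ k).comp (χ l) (show (2 : ℤ) + 2 = 4 by norm_num) =
    (χ l).comp (χ k) (show (2 : ℤ) + 2 = 4 by norm_num))
  {c : κ → κ → A} (hθ : IsEisenbudFamily φ g fun l => ∑ k, c l k • χ k)

omit [IsRegularLocalRing Q] [Fintype κ] [DecidableEq κ] hg hφ hker hD in
lemma comp_sum_smul [Fintype κ] (a : κ → A) {i j : ℤ} (hij : i + 2 = j) (β : KHom K D i) :
    β.comp (∑ k, a k • χ k) ((add_comm 2 i).trans hij) =
      ∑ k, a k • (khomModule hχ K).op k i j hij β := by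
  simp only [khomModule_op]
  let F : KHom D D 2 →ₗ[A] KHom K D j :=
    { toFun := fun y => β.comp y ((add_comm 2 i).trans hij)
      map_add' := fun _ _ => ShiftedHom.comp_add _ _ _ _
      map_smul' := fun _ _ => ShiftedHom.comp_smul _ _ _ _ }
  exact (map_sum F _ _).trans (Finset.sum_congr rfl fun k _ => map_smul F _ _)

include hθ

/-- The total cohomology module is finitely generated over the ring of operators. -/
theorem finite_khomModule [IsNoetherianRing A] {s : Finset κ}
    (h : P.TotallyAcyclicMod (Ideal.span (g '' s))) (r : Realization φ P K) :
    Module.Finite (MvPolynomial κ A) (khomModule hχ K).Total := by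
  induction s using Finset.induction_on generalizing P K with
  | empty =>
    have : Subsingleton (khomModule hχ K).Total := by
      refine subsingleton_of_forall_eq 0 fun x => ?_
      induction x using OpModule.total_induction with
      | zero => rfl
      | add x y hx hy => rw [hx, hy, add_zero]
      | ι n x =>
        have : Subsingleton ((khomModule hχ K).H n) :=
          subsingleton_KHom_of_empty hg hφ hker hD h r n
        rw [Subsingleton.elim x 0, map_zero]
    infer_instance
  | insert l s hl ih =>
    obtain ⟨T, -, hP', -, t, ht, he⟩ := exists_cocone hg hφ hker hl h r
    have hP'' : MatSeq.IsComplexMod _ (RingHom.ker φ) := fun n i j =>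
      hker ▸ span_image_le g s (hP'.isComplexMod n i j)
    let r' := MatSeq.realization φ _ hP''
    obtain ⟨e⟩ := he _ r'
    have := ih hP' r'
    refine OpModule.finite_of_ker (fun n => finite_KHom (r.isTotallyAcyclic hg hφ hker h) hD n)
      (fun i j hij => leftComp hχ (cls e.fst) i j (by simpa using hij))
      (fun k i i' j j' hi hj hij hij' x => leftComp_op hχ _ k i i' j j' hi hj _ _ x) (c l)
      fun i j hij x hx => ?_
    obtain ⟨β, hβ⟩ := e.exists_eq_comp_of_fst_comp_eq_zero hij x hx
    exact ⟨β, hβ.trans ((ht D _ hθ i j hij β).trans (comp_sum_smul hχ (c l) hij β))⟩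

variable {k : Type*} [Field k] {ρ : A →+* k} {b : κ → k} (hb : b ≠ 0) {l₀ : κ}
  (hc : ∀ l, l ≠ l₀ → ∑ k, ρ (c l k) * b k = 0)
include hb hc

/-- A resolution over `R` of a module `M`, given by matrices over `Q`, can be changed to one over
the hypersurface given by the element `g l₀`, without changing whether `b` is in the support. -/
theorem exists_resolves_and_isKilled_iff [IsNoetherianRing A] {s : Finset κ} (hs : l₀ ∉ s)
    (h : P.TotallyAcyclicMod (Ideal.span (g '' (insert l₀ s : Finset κ))))
    (r : Realization φ P K) {S : ∀ n, P.ι n → Prop} {m : ℤ} {M : Type u} [AddCommGroup M]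
    [Module A M] {e : P.ι (m + 1) → M}
    (he : MatSeq.Resolves φ P S m (Ideal.span (g '' (insert l₀ s : Finset κ))) e) :
    ∃ (P' : MatSeq Q) (K' : CochainComplex (ModuleCat.{u} A) ℤ) (_ : Realization φ P' K')
      (S' : ∀ n, P'.ι n → Prop) (e' : P'.ι (m + 1) → M),
      P'.TotallyAcyclicMod (Ideal.span {g l₀}) ∧
      MatSeq.Resolves φ P' S' m (Ideal.span {g l₀}) e' ∧
      ((khomModule hχ K).IsKilled ρ b ↔ (khomModule hχ K').IsKilled ρ b) := by
  induction s using Finset.induction_on generalizing P K with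
  | empty =>
    rw [span_image_insert, Finset.coe_empty, Set.image_empty, Ideal.span_empty, bot_sup_eq] at h he
    exact ⟨P, K, r, S, e, h, he, Iff.rfl⟩
  | insert l s hl ih =>
    rw [Finset.mem_insert, not_or] at hs
    have hl' : l ∉ insert l₀ s := by
      rw [Finset.mem_insert, not_or]
      exact ⟨Ne.symm hs.1, hl⟩
    rw [Finset.insert_comm] at h he
    obtain ⟨T, hT, hP', hT', t, ht, hcone⟩ := exists_cocone hg hφ hker hl' h r
    have hP'' : MatSeq.IsComplexMod _ (RingHom.ker φ) := fun n i j =>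
      hker ▸ span_image_le g _ (hP'.isComplexMod n i j)
    let r' := MatSeq.realization φ _ hP''
    obtain ⟨x⟩ := hcone _ r'
    rw [span_image_insert] at he
    have he' := he.step (hg _ l hl') (by
      rw [← RingHom.mem_ker, hker]
      exact Ideal.subset_span ⟨l, rfl⟩) hT (hT' S he.triangular)
    obtain ⟨P₁, K₁, r₁, S₁, e₁, h₁, he₁, hiff⟩ := ih hs.2 hP' r' he'
    refine ⟨P₁, K₁, r₁, S₁, e₁, h₁, he₁, Iff.trans ?_ hiff⟩
    -- The cone `K'` of `t` gives an exact sequence relating `Hom(K, D)` and `Hom(K', D)`.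
    -- Composition with `t` is the action of `∑ c l k χₖ`, which vanishes at `b`.
    have := finite_khomModule hg hφ hker hD hχ hθ h r
    constructor
    · refine OpModule.isKilled_of_isKilled'
        (fun i j hij => leftComp hχ (cls x.fst) i j (by simpa using hij))
        (fun k i i' j j' hi hj hij hij' x => leftComp_op hχ _ k i i' j j' hi hj _ _ x)
        (fun i j hij => leftComp hχ (cls x.inr) i j (by lia))
        (fun k i i' j j' hi hj hij hij' x => leftComp_op hχ _ k i i' j j' hi hj _ _ x)
        (fun i j hij y hy => x.exists_eq_fst_comp_of_inr_comp_eq_zero hij y hy) hb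
    · refine OpModule.isKilled_of_isKilled
        (fun i j hij => leftComp hχ (cls x.fst) i j (by simpa using hij))
        (fun k i i' j j' hi hj hij hij' x => leftComp_op hχ _ k i i' j j' hi hj _ _ x) (c l)
        (hc l (Ne.symm hs.1)) (fun i j hij y hy => ?_) hb
      obtain ⟨β, hβ⟩ := x.exists_eq_comp_of_fst_comp_eq_zero hij y hy
      exact ⟨β, hβ.trans ((ht D _ hθ i j hij β).trans (comp_sum_smul hχ (c l) hij β))⟩

omit hb hc in
/-- Over a hypersurface, the support of a complex contains the corresponding point if and only if
there are nonzero maps in infinitely many degrees. -/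
theorem isKilled_iff_of_singleton (hρ : ∀ r, ρ r ≠ 0 → IsUnit r) {a : κ → A} {u : A}
    (hu : a l₀ * u = 1) (hc₀ : c l₀ = Pi.single l₀ u)
    (hc₁ : ∀ l, l ≠ l₀ → c l = Pi.single l 1 - Pi.single l₀ (a l * u))
    (h : P.TotallyAcyclicMod (Ideal.span {g l₀})) (r : Realization φ P K)
    (hb : (fun l => ρ (a l)) ≠ 0) :
    (khomModule hχ K).IsKilled ρ (fun l => ρ (a l)) ↔
      ∃ m : ℕ, ∀ n : ℕ, m ≤ n → Subsingleton (KHom K D n) := by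
  have h' : P.TotallyAcyclicMod (Ideal.span (g '' (insert l₀ ∅ : Finset κ))) := by
    rwa [span_image_insert, Finset.coe_empty, Set.image_empty, Ideal.span_empty, bot_sup_eq]
  refine OpModule.isKilled_iff_of_surjective (u := u) (l := l₀) hρ (fun k i j hij x => ?_)
    (fun i j hij y => ?_) hb
  -- The operators for the other members of the family vanish, and they are `χₖ - aₖ u χ_{l₀}`.
  · by_cases hk : k = l₀
    · rw [hk, smul_smul, hu, one_smul]
    · have h0 := comp_eq_zero_of_notMem hg hφ hker (l := k) (by simpa using hk) h' r hθ hij x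
      replace h0 := (comp_sum_smul hχ (c k) hij x).symm.trans h0
      rw [hc₁ k hk] at h0
      simp only [Pi.sub_apply, sub_smul, Finset.sum_sub_distrib, Pi.single_apply, ite_smul,
        zero_smul, one_smul, Finset.sum_ite_eq', Finset.mem_univ, if_true] at h0
      rw [smul_smul]
      exact sub_eq_zero.1 h0
  -- The cone of the operator for `g l₀` lifts to the regular ring, so every map from it to `D` is
  -- zero, and every class is a multiple of the operator.
  · obtain ⟨T, -, hP', -, t, ht, he⟩ := exists_cocone hg hφ hker (Finset.notMem_empty l₀) h' r
    have hP'' : MatSeq.IsComplexMod _ (RingHom.ker φ) := fun n i j =>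
      hker ▸ span_image_le g _ (hP'.isComplexMod n i j)
    let r' := MatSeq.realization φ _ hP''
    obtain ⟨e⟩ := he _ r'
    have := subsingleton_KHom_of_empty hg hφ hker hD hP' r' j
    obtain ⟨β, hβ⟩ := e.exists_eq_comp_of_fst_comp_eq_zero hij y (Subsingleton.elim _ _)
    refine ⟨β, hβ.trans ((ht D _ hθ i j hij β).trans ((comp_sum_smul hχ (c l₀) hij β).trans ?_))⟩
    rw [hc₀]
    simp [Pi.single_apply]
    rfl

end Induction

end TotallyAcyclic

/-! ### The support variety -/

namespace TotallyAcyclic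

open MvPolynomial
open scoped TensorProduct

/-- For a quotient `k` of `R`, the kernel of `H → k ⊗ H` consists of multiples of the kernel of
`R → k`. -/
lemma mem_ker_smul_top_of_tmul_eq_zero {R k H : Type*} [CommRing R] [CommRing k] [Algebra R k]
    (hs : Function.Surjective (algebraMap R k)) [AddCommGroup H] [Module R H] {x : H}
    (hx : (1 : k) ⊗ₜ[R] x = 0) : x ∈ RingHom.ker (algebraMap R k) • (⊤ : Submodule R H) := by
  let e := (Algebra.linearMap R k).quotKerEquivOfSurjective hs
  have h1 : e (Submodule.Quotient.mk 1) = 1 :=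
    ((Algebra.linearMap R k).quotKerEquivOfSurjective_apply_mk hs 1).trans
      (map_one (algebraMap R k))
  have h2 := congrArg (TensorProduct.congr e.symm (LinearEquiv.refl R H)) hx
  rw [TensorProduct.congr_tmul, map_zero, ← h1, LinearEquiv.symm_apply_apply] at h2
  have h3 := congrArg (TensorProduct.quotTensorEquivQuotSMul H
    (LinearMap.ker (Algebra.linearMap R k) : Ideal R)) h2
  rw [map_zero] at h3
  have h4 := (TensorProduct.quotTensorEquivQuotSMul_mk_tmul
    (LinearMap.ker (Algebra.linearMap R k) : Ideal R) 1 x).symm.trans h3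
  rwa [one_smul, Submodule.Quotient.mk_eq_zero] at h4

section Support

variable {Q : Type u} [CommRing Q] [IsLocalRing Q] {c : ℕ} {f : Fin c → Q}
  [hf : Fact (RingTheory.Sequence.IsRegular Q (List.ofFn f))]
  {C D : CochainComplex (ModuleCat.{u} (CIRing f)) ℤ} (L : EisenbudLift f C)
  {χ : Fin c → KHom D D 2}
  (hχ : ∀ k l, (χ k).comp (χ l) (show (2 : ℤ) + 2 = 4 by norm_num) =
    (χ l).comp (χ k) (show (2 : ℤ) + 2 = 4 by norm_num))
  (hL : ∀ k (i j : ℤ) (hij : i + 2 = j) (β : KHom C D i),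
    (L.classOp k).comp β hij = β.comp (χ k) ((add_comm 2 i).trans hij))

lemma algebraMap_surjective (f : Fin c → Q)
    [hf : Fact (RingTheory.Sequence.IsRegular Q (List.ofFn f))] :
    Function.Surjective (algebraMap (CIRing f) (IsLocalRing.ResidueField Q)) := fun y => by
  obtain ⟨x, rfl⟩ := IsLocalRing.residue_surjective y
  exact ⟨Ideal.Quotient.mk _ x, rfl⟩

/-- The element `1 ⊗ x` of `E`. -/
def toReduced (x : (khomModule hχ C).Total) : Reduced L D :=
  TensorProduct.mk (CIRing f) (IsLocalRing.ResidueField Q) (GradedHom C D) 1 x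

lemma toReduced_surjective : Function.Surjective (toReduced L hχ) :=
  TensorProduct.mk_surjective (CIRing f) (GradedHom C D) (IsLocalRing.ResidueField Q)
    (algebraMap_surjective f)

omit [IsLocalRing Q] in
include hL in
lemma chi_eq (k : Fin c) (x : (khomModule hχ C).Total) :
    (khomModule hχ C).chi k x = L.chi D k x := by
  induction x using OpModule.total_induction with
  | zero => rw [map_zero]; exact (map_zero (L.chi D k)).symm
  | add x y hx hy =>
    rw [map_add, hx, hy]
    exact (map_add (L.chi D k) x y).symm
  | ι n x =>
    rw [OpModule.chi_ι]
    have h := DirectSum.toModule_lof (CIRing f) (ι := ℕ) (M := fun i : ℕ => KHom C D (i : ℤ))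
      (φ := fun i => DirectSum.lof (CIRing f) ℕ (fun i : ℕ => KHom C D (i : ℤ)) (i + 2) ∘ₗ
        L.chiHom D k i) n x
    refine Eq.trans ?_ h.symm
    exact congrArg (DirectSum.lof (CIRing f) ℕ (fun i : ℕ => KHom C D (i : ℤ)) (n + 2))
      (hL k n _ _ x).symm

include hL in
lemma map_smul_toReduced (p : MvPolynomial (Fin c) (CIRing f)) (x : (khomModule hχ C).Total) :
    MvPolynomial.map (algebraMap (CIRing f) (IsLocalRing.ResidueField Q)) p • toReduced L hχ x =
      toReduced L hχ (p • x) := by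
  induction p using MvPolynomial.induction_on generalizing x with
  | C r =>
    rw [map_C, OpModule.C_smul]
    have h1 : operatorHom L D (MvPolynomial.C (algebraMap (CIRing f) _ r)) =
        algebraMap (IsLocalRing.ResidueField Q) _ (algebraMap (CIRing f) _ r) :=
      AlgHom.commutes _ _
    refine (LinearMap.congr_fun h1 _).trans ?_
    have h2 : (algebraMap (CIRing f) (IsLocalRing.ResidueField Q) r) •
        ((1 : IsLocalRing.ResidueField Q) ⊗ₜ[CIRing f] (show GradedHom C D from x)) =
          (1 : IsLocalRing.ResidueField Q) ⊗ₜ[CIRing f] (r • show GradedHom C D from x) := by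
      rw [TensorProduct.smul_tmul', TensorProduct.tmul_smul, TensorProduct.smul_tmul',
        algebraMap_smul]
    exact h2
  | add p q hp hq =>
    rw [map_add, add_smul, hp, hq, add_smul]
    exact (map_add (TensorProduct.mk (CIRing f) (IsLocalRing.ResidueField Q) (GradedHom C D) 1)
      _ _).symm
  | mul_X p k hp =>
    rw [map_mul, mul_smul, map_X, mul_smul, ← hp, OpModule.X_smul, chi_eq L hχ hL]
    refine congrArg (MvPolynomial.map _ p • ·)
      ((LinearMap.congr_fun (operatorHom_X L D k) _).trans ?_)
    exact LinearMap.baseChange_tmul ..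

include hL in
/-- A nonzero point is outside of the support variety if and only if some polynomial over `R` that
does not vanish there annihilates the cohomology: this is Nakayama's lemma. -/
lemma mem_supportVariety_iff
    [Module.Finite (MvPolynomial (Fin c) (CIRing f)) (khomModule hχ C).Total]
    {b : Fin c → IsLocalRing.ResidueField Q} (hb : b ≠ 0) :
    b ∈ supportVariety L D ↔
      ¬ (khomModule hχ C).IsKilled (algebraMap (CIRing f) (IsLocalRing.ResidueField Q)) b := by
  set ρ := algebraMap (CIRing f) (IsLocalRing.ResidueField Q) with hρ
  have h1 : b ∈ supportVariety L D ↔ ∀ p ∈ Module.annihilator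
      (MvPolynomial (Fin c) (IsLocalRing.ResidueField Q)) (Reduced L D), aeval b p = 0 := by
    rw [supportVariety, Set.mem_union, Set.mem_singleton_iff, or_iff_left hb,
      mem_zeroLocus_iff]
  rw [h1, not_iff_not.symm, not_not]
  push Not
  constructor
  · rintro ⟨p, hp, hpb⟩
    obtain ⟨p, rfl⟩ := map_surjective ρ (algebraMap_surjective f) p
    -- A lift `p` of the polynomial maps the cohomology to its multiples by the maximal ideal.
    obtain ⟨y, hy, n, hn⟩ := exists_pow_add_smul_eq_zero (M := (khomModule hχ C).Total)
      ((RingHom.ker ρ).map MvPolynomial.C) p fun x => by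
        have h2 : toReduced L hχ (p • x) = 0 := by
          rw [← map_smul_toReduced L hχ hL]
          exact Module.mem_annihilator.1 hp _
        have h3 : p • x ∈ RingHom.ker ρ • (⊤ : Submodule (CIRing f) (khomModule hχ C).Total) :=
          mem_ker_smul_top_of_tmul_eq_zero (algebraMap_surjective f) h2
        refine Submodule.smul_induction_on h3 (fun r hr y _ => ?_) fun _ _ => add_mem
        rw [← OpModule.C_smul]
        exact Submodule.smul_mem_smul (Ideal.mem_map_of_mem _ hr) trivial
    refine ⟨_, ?_, hn⟩
    have hy' : eval₂Hom ρ b y = 0 := by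
      refine RingHom.mem_ker.1 ((Ideal.map_le_iff_le_comap.2 fun r hr => ?_ :
        (RingHom.ker ρ).map MvPolynomial.C ≤ RingHom.ker (eval₂Hom ρ b)) hy)
      simpa using hr
    rw [map_add, hy', add_zero, map_pow]
    exact pow_ne_zero _ (by simpa [aeval_def, eval₂_map] using hpb)
  · rintro ⟨p, hp, hpx⟩
    refine ⟨map ρ p, Module.mem_annihilator.2 fun x => ?_, by
      simpa [aeval_def, eval₂_map] using hp⟩
    obtain ⟨x, rfl⟩ := toReduced_surjective L hχ x
    rw [map_smul_toReduced L hχ hL, hpx]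
    exact map_zero (TensorProduct.mk (CIRing f) (IsLocalRing.ResidueField Q) (GradedHom C D) 1)

end Support

end TotallyAcyclic

/-! ### Complexes over the complete intersection -/

namespace TotallyAcyclic

open CochainComplex.HomComplex

section Range

variable {Q : Type u} [CommRing Q] {A : Type u} [CommRing A] {φ : Q →+* A}
  {P P' : MatSeq Q} {K K' : CochainComplex (ModuleCat.{u} A) ℤ}

lemma Realization.hom_sum_smul (r : Realization φ P K) (r' : Realization φ P' K') {κ : Type*}
    (s : Finset κ) {p q : ℤ} (x : κ → Q) (M : κ → Matrix (P'.ι q) (P.ι p) Q) :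
    r.hom r' (∑ k ∈ s, x k • M k) = ∑ k ∈ s, φ (x k) • r.hom r' (M k) := by
  classical
  induction s using Finset.induction_on with
  | empty => simp [hom_zero]
  | insert k s hk ih => rw [Finset.sum_insert hk, Finset.sum_insert hk, hom_add, hom_smul, ih]

lemma cls_sum_smul {κ : Type*} (s : Finset κ) {i : ℤ} (x : κ → A) (z : κ → Cocycle K K' i) :
    cls (∑ k ∈ s, x k • z k) = ∑ k ∈ s, x k • cls (z k) := by
  classical
  induction s using Finset.induction_on with
  | empty => simp [cls_zero]
  | insert k s hk ih => rw [Finset.sum_insert hk, Finset.sum_insert hk, cls_add, cls_smul, ih]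

lemma Realization.d_vec_eq_sum (r : Realization φ P K) {p q : ℤ} (v : P.ι p → Q) :
    (K.d p q).hom (r.vec v) = ∑ i, φ (v i) • (K.d p q).hom (r.basis p i) := by
  rw [vec, Module.Basis.equivFun_symm_apply, map_sum]
  exact Finset.sum_congr rfl fun i _ => map_smul _ _ _

/-- A totally acyclic complex resolves the images of its differentials. -/
lemma Realization.exists_resolves (hφ : Function.Surjective φ) (r : Realization φ P K)
    (h : P.TotallyAcyclicMod (RingHom.ker φ)) (m z z' : ℤ) (hz : m + 1 = z) (hz' : z + 1 = z') :
    ∃ e : P.ι (m + 1) → LinearMap.range (K.d z z').hom,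
      MatSeq.Resolves φ P (fun n _ => n ≤ m + 1) m (RingHom.ker φ) e := by
  subst hz hz'
  have hsum : ∀ v : P.ι (m + 1) → Q, ((∑ i, φ (v i) • (⟨_, r.basis (m + 1) i, rfl⟩ :
      LinearMap.range (K.d (m + 1) (m + 1 + 1)).hom) :
      LinearMap.range (K.d (m + 1) (m + 1 + 1)).hom) : K.X (m + 1 + 1)) =
        (K.d (m + 1) (m + 1 + 1)).hom (r.vec v) := fun v => by
    rw [r.d_vec_eq_sum, AddSubmonoidClass.coe_finsetSum]
    rfl
  refine ⟨fun i => ⟨_, r.basis (m + 1) i, rfl⟩, fun n i j hi hj => by lia,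
    fun i hi => absurd le_rfl hi, fun j => ?_, ?_, fun v hv => ?_, fun n hn v hv => ?_,
    fun n hn i hi => by lia, m + 1, fun n hn _ => hn⟩
  · rw [← Subtype.coe_inj, hsum fun i => P.d m i j]
    have h1 : (fun i => P.d m i j) = Matrix.mulVec (P.d m) (Pi.single j 1) :=
      (Matrix.mulVec_single_one (P.d m) j).symm
    rw [h1, ← r.d_vec, ← LinearMap.comp_apply, ← ModuleCat.hom_comp, K.d_comp_d]
    rfl
  · rintro ⟨_, x, rfl⟩
    obtain ⟨v, rfl⟩ := r.vec_surjective hφ x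
    exact ⟨v, Subtype.ext (hsum v)⟩
  · rw [← Subtype.coe_inj, hsum v] at hv
    obtain ⟨u, hu⟩ := h.exactMod m v fun i _ => by
      rw [r.d_vec] at hv
      exact (r.vec_eq_zero_iff _).1 hv i
    exact ⟨u, fun i _ => hu i trivial⟩
  · obtain ⟨u, hu⟩ := h.exactMod n v fun i _ => hv i (by lia)
    exact ⟨u, fun i _ => hu i trivial⟩

end Range

section Lift

variable {Q : Type u} [CommRing Q] {c : ℕ} {f : Fin c → Q}

namespace EisenbudLift

variable {C : CochainComplex (ModuleCat.{u} (CIRing f)) ℤ} (L : EisenbudLift f C)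

/-- The sequence of matrices of a lift. -/
def matSeq : MatSeq Q where
  ι n := Fin (L.rank n)
  fintype _ := inferInstance
  decidableEq _ := inferInstance
  d n := L.d n (n + 1)

/-- A complex is a realization of its lift. -/
def realization : Realization (Ideal.Quotient.mk (Ideal.span (Set.range f))) L.matSeq C where
  basis := L.basis
  d_eq n := by
    refine Eq.trans ?_ (congrArg (Matrix.toLin (L.basis n) (L.basis (n + 1)))
      (L.d_map n (n + 1))).symm
    exact (Matrix.toLin_toMatrix ..).symm

lemma matSeq_d_mul_d (n : ℤ) : L.matSeq.d (n + 1) * L.matSeq.d n =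
    ∑ k, f k • (L.t k n (n + 1 + 1) : Matrix (L.matSeq.ι (n + 1 + 1)) (L.matSeq.ι n) Q) :=
  L.d_mul_d n (n + 1) (n + 1 + 1) rfl rfl

variable [hf : Fact (RingTheory.Sequence.IsRegular Q (List.ofFn f))]
  {D : CochainComplex (ModuleCat.{u} (CIRing f)) ℤ} (L' : EisenbudLift f D)

/-- The action of the Eisenbud operators does not depend on the side on which it is taken. -/
lemma classOp_comp_comm (k : Fin c) (i j : ℤ) (hij : i + 2 = j) (β : KHom C D i) :
    (L.classOp k).comp β hij = β.comp (L'.classOp k) ((add_comm 2 i).trans hij) := by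
  obtain ⟨z, hz, hzv⟩ := L.classOp_eq_cls k
  obtain ⟨z', hz', hzv'⟩ := L'.classOp_eq_cls k
  rw [hz, hz']
  exact L.realization.cls_comp_comm L'.realization Ideal.Quotient.mk_surjective
    (fun x hx k => by
      rw [Ideal.mk_ker]
      exact coeff_mem_of_sum_eq_zero f hf.out.toIsWeaklyRegular x hx k)
    Ideal.mk_ker L.matSeq_d_mul_d L'.matSeq_d_mul_d k z hzv z' hzv' hij β

/-- The Eisenbud operators with respect to another family of generators of the ideal. -/
lemma isEisenbudFamily {g : Fin c → Q} (x : Fin c → Fin c → Q)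
    (hx : ∀ k, f k = ∑ l, x l k * g l) :
    IsEisenbudFamily (Ideal.Quotient.mk (Ideal.span (Set.range f))) g
      fun l => ∑ k, Ideal.Quotient.mk (Ideal.span (Set.range f)) (x l k) • L.classOp k := by
  choose z hz hzv using L.classOp_eq_cls
  refine ⟨L.matSeq, L.realization, fun l p q => ∑ k, x l k • L.t k p q, fun n => ?_, fun l =>
    ⟨∑ k, Ideal.Quotient.mk (Ideal.span (Set.range f)) (x l k) • z k, fun p q h => ?_, ?_⟩⟩
  · have h1 : ∑ k, f k • L.t k n (n + 1 + 1) =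
        ∑ l, g l • ∑ k, x l k • L.t k n (n + 1 + 1) := by
      simp only [Finset.smul_sum]
      rw [Finset.sum_comm]
      refine Finset.sum_congr rfl fun k _ => ?_
      rw [hx k, Finset.sum_smul]
      exact Finset.sum_congr rfl fun l _ => by rw [smul_smul, mul_comm]
    exact (L.matSeq_d_mul_d n).trans h1
  · let F : Cocycle C C 2 →ₗ[CIRing f] (C.X p ⟶ C.X q) :=
      { toFun := fun z => z.1.v p q h
        map_add' := fun _ _ => rfl
        map_smul' := fun _ _ => rfl }
    refine (map_sum F _ _).trans (Eq.trans ?_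
      (L.realization.hom_sum_smul L.realization Finset.univ (x l) (fun k => L.t k p q)).symm)
    refine Finset.sum_congr rfl fun k _ => (map_smul F _ _).trans ?_
    exact congrArg _ (hzv k p q h)
  · rw [cls_sum_smul]
    exact Finset.sum_congr rfl fun k _ => by rw [hz]

end EisenbudLift

end Lift

end TotallyAcyclic

/-! ### Comparison of the support variety and the rank variety -/

namespace TotallyAcyclic

open CochainComplex.HomComplex

lemma not_infinitelyManyHom_iff {A : Type u} [CommRing A]
    {X Y : CochainComplex (ModuleCat.{u} A) ℤ} :
    ¬ InfinitelyManyHom X Y ↔ ∃ m : ℕ, ∀ n : ℕ, m ≤ n → Subsingleton (KHom X Y n) := by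
  rw [InfinitelyManyHom, Set.not_infinite]
  constructor
  · intro h
    obtain ⟨m, hm⟩ := h.bddAbove
    refine ⟨m + 1, fun n hn => ?_⟩
    rw [← not_nontrivial_iff_subsingleton]
    exact fun hn' => absurd (hm ⟨by lia, hn'⟩) (by lia)
  · rintro ⟨m, hm⟩
    refine (Set.finite_lt_nat m).subset fun n hn => ?_
    by_contra hmn
    exact not_nontrivial_iff_subsingleton.2 (hm n (not_lt.1 hmn)) hn.2

section Coordinates

variable {Q : Type u} [CommRing Q] {κ : Type} [DecidableEq κ]

/-- The coefficients that express a family in terms of the one in which the member with index `l₀`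
is replaced by `∑ aₖ fₖ`, where `w` is the inverse of `a l₀`. -/
def coeffs (l₀ : κ) (a : κ → Q) (w : Q) (l : κ) : κ → Q :=
  if l = l₀ then Pi.single l₀ w else Pi.single l 1 - Pi.single l₀ (a l * w)

lemma eq_sum_coeffs [Fintype κ] {l₀ : κ} {a : κ → Q} {w : Q} (hw : a l₀ * w = 1) (f : κ → Q)
    (k : κ) : f k = ∑ l, coeffs l₀ a w l k * Function.update f l₀ (∑ k, a k * f k) l := by
  have h : ∀ l ∈ Finset.univ.erase l₀,
      coeffs l₀ a w l k * Function.update f l₀ (∑ k, a k * f k) l =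
        Pi.single (M := fun _ => Q) l 1 k * f l -
          Pi.single (M := fun _ => Q) l₀ w k * (a l * f l) := fun l hl => by
    have hl' := Finset.ne_of_mem_erase hl
    rw [coeffs, if_neg hl', Function.update_of_ne hl', Pi.sub_apply, sub_mul]
    simp only [Pi.single_apply]
    split_ifs <;> ring
  rw [← Finset.add_sum_erase _ _ (Finset.mem_univ l₀), Finset.sum_congr rfl h,
    Finset.sum_sub_distrib, ← Finset.mul_sum, coeffs, if_pos rfl, Function.update_self,
    ← Finset.add_sum_erase _ (fun k => a k * f k) (Finset.mem_univ l₀)]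
  have h2 : ∑ l, Pi.single (M := fun _ => Q) l 1 k * f l = f k := by
    simp [Pi.single_apply]
  rw [← Finset.add_sum_erase _ _ (Finset.mem_univ l₀)] at h2
  by_cases hk : k = l₀
  · subst hk
    rw [Pi.single_eq_same] at h2 ⊢
    linear_combination (-f k) * hw - h2
  · rw [Pi.single_eq_of_ne hk] at h2 ⊢
    linear_combination -h2

end Coordinates

section Main

variable {Q : Type u} [CommRing Q] [IsRegularLocalRing Q] {c : ℕ} {f : Fin c → Q}
  [hf : Fact (RingTheory.Sequence.IsRegular Q (List.ofFn f))]
  {C D : CochainComplex (ModuleCat.{u} (CIRing f)) ℤ}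

/-- There is a complete resolution over `Q_a` of the image of `d₀`, given by matrices over `Q` that
define a complex `K` over `R` as well, such that `ā` is in the support variety if and only if
`Hom(K, Σⁿ D)` does not vanish for all large `n`. -/
theorem exists_isT_and_mem_supportVariety_iff (hC : IsTotallyAcyclic C) (hD : IsTotallyAcyclic D)
    (L : EisenbudLift f C) {a : Fin c → Q} (ha : (fun i => IsLocalRing.residue Q (a i)) ≠ 0) :
    ∃ (P : MatSeq Q) (h : P.IsComplexMod (RingHom.ker (Ideal.Quotient.mk
        (Ideal.span {∑ i, a i * f i})))) (K : CochainComplex (ModuleCat.{u} (CIRing f)) ℤ)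
      (_ : Realization (Ideal.Quotient.mk (Ideal.span (Set.range f))) P K),
      IsT f a C (P.cplx (Ideal.Quotient.mk (Ideal.span {∑ i, a i * f i})) h) ∧
      IsTotallyAcyclic K ∧
      ((fun i => IsLocalRing.residue Q (a i)) ∈ supportVariety L D ↔
        ¬ ∃ m : ℕ, ∀ n : ℕ, m ≤ n → Subsingleton (KHom K D n)) := by
  obtain ⟨l₀, hl₀⟩ := Function.ne_iff.1 ha
  have hunit : IsUnit (a l₀) := (IsLocalRing.residue_ne_zero_iff_isUnit _).1 hl₀
  obtain ⟨w, hw⟩ := hunit.exists_right_inv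
  obtain ⟨L'⟩ := hD.nonempty_eisenbudLift
  -- New generators of the ideal of `R`, with the equation of `Q_a` as one member.
  set g := Function.update f l₀ (∑ k, a k * f k) with hgdef
  have hgl : g l₀ = ∑ k, a k * f k := Function.update_self _ _ _
  set φ := Ideal.Quotient.mk (Ideal.span (Set.range f)) with hφdef
  have hφ : Function.Surjective φ := Ideal.Quotient.mk_surjective
  have hg : RegularFamily g := (regularFamily_of_isRegular hf.out).update
    (mem_maximalIdeal_of_isRegular hf.out) a hunit
  have hspan : Ideal.span (Set.range g) = Ideal.span (Set.range f) :=
    span_update_eq f a l₀ hunit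
  have hker : RingHom.ker φ = Ideal.span (Set.range g) := by rw [hspan, hφdef, Ideal.mk_ker]
  have huniv : Ideal.span (g '' (insert l₀ (Finset.univ.erase l₀) : Finset (Fin c))) =
      RingHom.ker φ := by
    rw [Finset.insert_erase (Finset.mem_univ _), Finset.coe_univ, Set.image_univ, hker]
  let x := coeffs l₀ a w
  have hθ := L'.isEisenbudFamily x (eq_sum_coeffs hw f)
  have hχ := L'.classOp_comm
  let ρ := algebraMap (CIRing f) (IsLocalRing.ResidueField Q)
  have hρφ : ∀ y, ρ (φ y) = IsLocalRing.residue Q y := fun y => rfl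
  have h : L.matSeq.TotallyAcyclicMod (RingHom.ker φ) := by
    obtain ⟨h₁, h₂⟩ := (L.realization.isTotallyAcyclic_iff hφ).1 hC
    exact ⟨L.realization.isComplexMod, h₁, h₂⟩
  obtain ⟨e, he⟩ := L.realization.exists_resolves hφ h (-1) 0 1 rfl rfl
  rw [← huniv] at h he
  have hfin := finite_khomModule hg hφ hker hD hχ hθ h L.realization
  -- The operators for the other new generators vanish at `ā`.
  have hc : ∀ l, l ≠ l₀ → ∑ k, ρ (φ (x l k)) * IsLocalRing.residue Q (a k) = 0 := fun l hl => by
    have h1 : ∑ k, x l k * a k = 0 := by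
      simp only [x, coeffs, if_neg hl, Pi.sub_apply, sub_mul, Finset.sum_sub_distrib,
        Pi.single_apply, ite_mul, one_mul, zero_mul, Finset.sum_ite_eq', Finset.mem_univ, if_true]
      linear_combination (-a l) * hw
    simp only [hρφ, ← map_mul, ← map_sum, h1, map_zero]
  obtain ⟨P, K, r, S, e', hP, he', hiff⟩ := exists_resolves_and_isKilled_iff hg hφ hker hD hχ hθ
    ha hc (Finset.notMem_erase l₀ _) h L.realization he
  rw [hgl] at hP he'
  rw [← Ideal.mk_ker (I := Ideal.span {∑ k, a k * f k})] at he'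
  have hP' := hP
  rw [← Ideal.mk_ker (I := Ideal.span {∑ k, a k * f k})] at hP'
  refine ⟨P, hP'.isComplexMod, K, r, ?_, ?_, ?_⟩
  · refine MatSeq.Resolves.isCompleteResolution (M := imageZero C) Ideal.Quotient.mk_surjective
      (hyperToCI f a) he' rfl _ ?_
    exact ((MatSeq.realization _ P hP'.isComplexMod).isTotallyAcyclic_iff
      Ideal.Quotient.mk_surjective).2 ⟨hP'.exactMod, hP'.dualExactMod⟩
  · refine r.isTotallyAcyclic hg hφ hker (s := {l₀}) ?_
    rwa [Finset.coe_singleton, Set.image_singleton, hgl]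
  · rw [mem_supportVariety_iff L hχ (L.classOp_comp_comm L') ha, hiff]
    refine not_congr (isKilled_iff_of_singleton hg hφ hker hD hχ hθ (l₀ := l₀)
      (a := fun l => φ (a l)) (u := φ w) (fun y hy => ?_) ?_ ?_ (fun l hl => ?_) ?_ r ha)
    · obtain ⟨y, rfl⟩ := hφ y
      exact ((IsLocalRing.residue_ne_zero_iff_isUnit _).1 hy).map φ
    · rw [← map_mul, hw, map_one]
    · funext k
      simp only [x, coeffs, if_true, Pi.single_apply]
      split_ifs <;> rfl
    · funext k
      simp only [x, coeffs, if_neg hl, Pi.single_apply, Pi.sub_apply, map_sub]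
      split_ifs <;> simp <;> rfl
    · rwa [hgl]

/-- For any complete resolutions `X` and `Y` over `Q_a`, infinitely many of the groups
`Hom(X, Σⁱ Y)` are nonzero if and only if `ā` lies in the support variety: in high degrees their
vanishing is an `Ext` condition over `Q_a`, which base change along `Q_a → R` turns into the
vanishing of `Hom(K, Σⁱ D)`. -/
theorem infinitelyManyHom_iff (hC : IsTotallyAcyclic C) (hD : IsTotallyAcyclic D)
    (L : EisenbudLift f C) {a : Fin c → Q} (ha : (fun i => IsLocalRing.residue Q (a i)) ≠ 0)
    {X Y : CochainComplex (ModuleCat.{u} (HyperRing f a)) ℤ} (hX : IsT f a C X)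
    (hY : IsT f a D Y) :
    InfinitelyManyHom X Y ↔ (fun i => IsLocalRing.residue Q (a i)) ∈ supportVariety L D := by
  obtain ⟨P, hP, K, r, hX', hK, hiff⟩ := exists_isT_and_mem_supportVariety_iff hC hD L ha
  obtain ⟨m, hm⟩ := IsCompleteResolution.homExact_iff hX hX'
  have key : ∀ n : ℕ, -(n : ℤ) < m →
      (Subsingleton (KHom X Y n) ↔ Subsingleton (KHom K D n)) := fun n hn => by
    rw [IsCompleteResolution.subsingleton_KHom_iff hX.1 hY n, hm _ _ hn,
      subsingleton_KHom_iff_homExact hK hD (show -(n : ℤ) + n = 0 by lia)]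
    obtain ⟨q, hq⟩ : ∃ q : ℤ, -(n : ℤ) = q + 1 := ⟨-n - 1, by lia⟩
    rw [hq, r.homExact_iff]
    exact (P.realization _ hP).homExact_iff _ q
  rw [hiff, ← not_iff_not, not_not, not_infinitelyManyHom_iff]
  constructor
  · rintro ⟨d, hd⟩
    exact ⟨d + (1 - m).toNat, fun n hn => (key n (by lia)).1 (hd n (by lia))⟩
  · rintro ⟨d, hd⟩
    exact ⟨d + (1 - m).toNat, fun n hn => (key n (by lia)).2 (hd n (by lia))⟩

end Main

end TotallyAcyclic

end

theorem theorem5p1 {Q : Type u} [CommRing Q] [IsRegularLocalRing Q] {c : ℕ} (f : Fin c → Q)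
    [hf : Fact (RingTheory.Sequence.IsRegular Q (List.ofFn f))]
    (C D : CochainComplex (ModuleCat.{u} (TotallyAcyclic.CIRing f)) ℤ)
    (hC : TotallyAcyclic.IsTotallyAcyclic C) (hD : TotallyAcyclic.IsTotallyAcyclic D) :
    (∀ L : TotallyAcyclic.EisenbudLift f C,
      TotallyAcyclic.supportVariety L D = TotallyAcyclic.rankVariety f C D) ∧
    ∀ a : Fin c → Q, (fun i => IsLocalRing.residue Q (a i)) ≠ 0 →
      (∃ X, TotallyAcyclic.IsT f a C X) ∧ (∃ Y, TotallyAcyclic.IsT f a D Y) ∧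
      ∀ X Y, TotallyAcyclic.IsT f a C X → TotallyAcyclic.IsT f a D Y →
        ((fun i => IsLocalRing.residue Q (a i)) ∈ TotallyAcyclic.rankVariety f C D ↔
          TotallyAcyclic.InfinitelyManyHom X Y) := by
  have exT : ∀ {C : CochainComplex (ModuleCat.{u} (TotallyAcyclic.CIRing f)) ℤ},
      TotallyAcyclic.IsTotallyAcyclic C → ∀ a : Fin c → Q,
      (fun i => IsLocalRing.residue Q (a i)) ≠ 0 → ∃ X, TotallyAcyclic.IsT f a C X := by
    intro C hC a ha
    obtain ⟨L⟩ := hC.nonempty_eisenbudLift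
    obtain ⟨P, h, K, r, hX, -⟩ :=
      TotallyAcyclic.exists_isT_and_mem_supportVariety_iff hC hC L ha
    exact ⟨_, hX⟩
  have main : ∀ L : TotallyAcyclic.EisenbudLift f C,
      TotallyAcyclic.supportVariety L D = TotallyAcyclic.rankVariety f C D := by
    intro L
    ext b
    by_cases hb : b = 0
    · exact iff_of_true (Or.inr hb) (Or.inr hb)
    constructor
    · intro h
      choose a ha using fun i => IsLocalRing.residue_surjective (b i)
      obtain rfl : (fun i => IsLocalRing.residue Q (a i)) = b := funext ha
      obtain ⟨X, hX⟩ := exT hC a hb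
      obtain ⟨Y, hY⟩ := exT hD a hb
      exact Or.inl ⟨a, ha, X, Y, hX, hY,
        (TotallyAcyclic.infinitelyManyHom_iff hC hD L hb hX hY).2 h⟩
    · rintro (⟨a, ha, X, Y, hX, hY, h⟩ | h)
      · obtain rfl : (fun i => IsLocalRing.residue Q (a i)) = b := funext ha
        exact (TotallyAcyclic.infinitelyManyHom_iff hC hD L hb hX hY).1 h
      · exact absurd h hb
  refine ⟨main, fun a ha => ⟨exT hC a ha, exT hD a ha, fun X Y hX hY => ?_⟩⟩
  obtain ⟨L⟩ := hC.nonempty_eisenbudLift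
  rw [← main L]
  exact (TotallyAcyclic.infinitelyManyHom_iff hC hD L ha hX hY).symm
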